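/- Let $\mathbf{K}$ be an abstract elementary class (in a finitary vocabulary) and let $\lambda \ge \mathrm{LS}(\mathbf{K})$ be a cardinal. Write $\mathbf{K}_\lambda$ for the class of models of cardinality $\lambda$, $\mathrm{tp}(b/M;N)$ for orbital (Galois) types, and $\mathbf{S}(M)$ for the set of types over $M$ of single elements. A model $N \in \mathbf{K}_\lambda$ is *universal* over $M \le_{\mathbf{K}} N$ if every extension of $M$ of cardinality $\lambda$ embeds into $N$ over $M$. A *universal chain* is an increasing continuous chain $\langle M_i : i \le \delta\rangle$ in $\mathbf{K}_\lambda$, $\delta<\lambda^+$ a limit ordinal, with $M_{i+1}$ universal over $M_i$ for all $i<\delta$; a *limit model* is the last model of a universal chain. A type $p \in \mathbf{S}(N)$ *does not split* over $M \le_{\mathbf{K}} N$ if $f(p\restriction N_1)=p\restriction N_2$ whenever $N_1,N_2 \in \mathbf{K}_\lambda$, $M \le_{\mathbf{K}} N_\ell \le_{\mathbf{K}} N$ and $f:N_1\cong_M N_2$. $\mathbf{K}$ is *$\lambda$-superstable* if $\lambda \ge \mathrm{LS}(\mathbf{K})$, $\mathbf{K}_\lambda\ne\emptyset$ has amalgamation,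 joint embedding and no maximal models, $|\mathbf{S}(M)|\le\lambda$ for all $M\in\mathbf{K}_\lambda$, and for every universal chain $\langle M_i : i \le \delta\rangle$ and $p\in\mathbf{S}(M_\delta)$ there is $i<\delta$ such that $p$ does not split over $M_i$. For limit models $M \le_{\mathbf{K}} N$ in $\mathbf{K}_\lambda$, $p\in\mathbf{S}(N)$ *does not fork* over $M$ if there is $M_0\in\mathbf{K}_\lambda$ such that $M$ is universal over $M_0$ and $p$ does not split over $M_0$. $\mathbf{K}$ has *$\lambda$-symmetry* if for all limit models $M\le_{\mathbf{K}}N$ in $\mathbf{K}_\lambda$ and all $a,b\in N$, the following condition is equivalent to the one obtained by exchanging $a$ and $b$: there are limit models $M_b\le_{\mathbf{K}}N_b$ in $\mathbf{K}_\lambda$ with $N\le_{\mathbf{K}}N_b$, $M\le_{\mathbf{K}}M_b$, $b\in M_b$, and $\mathrm{tp}(a/M_b;N_b)$ does not fork over $M$. For $M_0\le_{\mathbf{K}}M\le_{\mathbf{K}}N$ in $\mathbf{K}_\lambda$ and $\alpha<\lambda^+$, a sequence $\langle a_i:i<\alpha\rangle$ of elements of $N$ is *independent in $(M_0,M,N)$*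 if there are an extension $N'\in\mathbf{K}_\lambda$ of $N$ and an increasing continuous chain $\langle M_i' : i\le\alpha\rangle$ in $\mathbf{K}_\lambda$ with $M'_0=M$ and $M'_\alpha\le_{\mathbf{K}}N'$, such that for all $i<\alpha$, $a_i\in M'_{i+1}\setminus M'_i$ and $\mathrm{tp}(a_i/M'_i;M'_{i+1})$ does not fork over $M_0$. The *frame of independent sequences of length less than $\lambda^+$* has this as its nonforking relation; its basic types over $M\in\mathbf{K}_\lambda$ are the types $\mathrm{tp}(\bar a/M;N)$ with $\bar a$ independent in $(M,M,N)$. **Theorem.** Let $\mathbf{K}$ be a $\lambda$-superstable AEC with $\lambda$-symmetry that is categorical in $\lambda$ (it has exactly one model of cardinality $\lambda$ up to isomorphism). Then the frame of independent sequences of length less than $\lambda^+$ has the symmetry property: if $\bar a_1$ is independent in $(M_0,M_2,N)$ and $\bar a_2$ is a sequence of elements of $M_2$ whose type over $M_0$ is basic, then there are an extension $N'$ of $N$ and a model $M_1$ with $M_0\le_{\mathbf{K}}M_1\le_{\mathbf{K}}N'$ containing all elements of $\bar a_1$ such that $\bar a_2$ is independent in $(M_0,M_1,N')$. Moreover, independence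 does not depend on the enumeration: if $\langle a_i:i<\alpha\rangle$ is independent in $(M_0,M,N)$ and $\pi$ is a bijection from an ordinal $\beta$ onto $\alpha$, then $\langle a_{\pi(j)}:j<\beta\rangle$ is independent in $(M_0,M,N)$. -/

import Mathlib

open Cardinal
open scoped FirstOrder

universe u v

/-- An abstract class of structures in the finitary vocabulary `L`: a class of `L`-structures with
a partial order refining "substructure", both respecting isomorphisms.
`Strong S`, for `S` a substructure of `N`, means `S ≤_K N` (antisymmetry is automatic). -/
structure AbstractClass (L : FirstOrder.Language.{u, u}) where
  Mem : ∀ (N : Type u) [L.Structure N], Prop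
  Strong : ∀ {N : Type u} [L.Structure N], L.Substructure N → Prop
  mem_of_strong : ∀ {N : Type u} [L.Structure N] {S : L.Substructure N}, Strong S → Mem S ∧ Mem N
  mem_iso : ∀ {N N' : Type u} [L.Structure N] [L.Structure N'], (N ≃[L] N') → Mem N → Mem N'
  strong_iso : ∀ {N N' : Type u} [L.Structure N] [L.Structure N'] (e : N ≃[L] N')
    {S : L.Substructure N}, Strong S → Strong (S.map e.toHom)
  strong_refl : ∀ {N : Type u} [L.Structure N], Mem N → Strong (⊤ : L.Substructure N)
  strong_trans : ∀ {N : Type u} [L.Structure N] {S T : L.Substructure N}, S ≤ T →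
    Strong (S.comap T.subtype.toHom) → Strong T → Strong S

namespace AbstractClass

variable {L : FirstOrder.Language.{u, u}} (K : AbstractClass L)

/-- `S ≤_K T` for two substructures of a common structure (which need not be in the class). -/
def LE {N : Type u} [L.Structure N] (S T : L.Substructure N) : Prop :=
  S ≤ T ∧ K.Strong (S.comap T.subtype.toHom)

/-- `M` belongs to the class and has cardinality `lam`. -/
def MemCard (lam : Cardinal.{u}) (M : Type u) [L.Structure M] : Prop := K.Mem M ∧ #M = lam

/-- `K`-embeddings. An extension `M ≤_K N` is represented, up to isomorphism, by a `K`-embedding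
of `M` into `N`. -/
structure Emb (M N : Type u) [L.Structure M] [L.Structure N] where
  toEmb : M ↪[L] N
  strong : K.Strong toEmb.toHom.range

variable {K}

namespace Emb

variable {M N P : Type u} [L.Structure M] [L.Structure N] [L.Structure P]

instance : CoeFun (K.Emb M N) (fun _ => M → N) := ⟨fun f => f.toEmb⟩

/-- The image of a substructure under a `K`-embedding. -/
def image (f : K.Emb M N) (S : L.Substructure M) : L.Substructure N := S.map f.toEmb.toHom

theorem strong_image (f : K.Emb M N) {S : L.Substructure M} (hS : K.Strong S) :
    K.Strong (f.image S) := by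
  refine K.strong_trans (T := f.toEmb.toHom.range) ?_ ?_ f.strong
  · exact FirstOrder.Language.Hom.map_le_range
  · have h := K.strong_iso f.toEmb.equivRange hS
    convert h using 1
    ext x
    simp only [FirstOrder.Language.Substructure.mem_comap, FirstOrder.Language.Substructure.mem_map, image]
    constructor
    · rintro ⟨y, hy, hxy⟩
      exact ⟨y, hy, Subtype.ext hxy⟩
    · rintro ⟨y, hy, hxy⟩
      exact ⟨y, hy, congrArg Subtype.val hxy⟩

/-- Composition of `K`-embeddings: first `f`, then `g`. -/
def comp (g : K.Emb N P) (f : K.Emb M N) : K.Emb M P where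
  toEmb := g.toEmb.comp f.toEmb
  strong := by
    rw [FirstOrder.Language.Embedding.comp_toHom, FirstOrder.Language.Hom.range_comp]
    exact g.strong_image f.strong

/-- An isomorphism between members of the class, as a `K`-embedding. -/
def ofEquiv (hN : K.Mem N) (e : M ≃[L] N) : K.Emb M N where
  toEmb := e.toEmbedding
  strong := by
    rw [FirstOrder.Language.Equiv.toEmbedding_toHom, FirstOrder.Language.Equiv.toHom_range]
    exact K.strong_refl hN

/-- The inclusion of `S` in `N`, for `S ≤_K N`. -/
def incl {S : L.Substructure N} (hS : K.Strong S) : K.Emb S N where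
  toEmb := S.subtype
  strong := by rwa [FirstOrder.Language.Substructure.range_subtype]

/-- The inclusion of `S` in `T`, for `S ≤_K T`. -/
def inclusion {S T : L.Substructure N} (h : K.LE S T) : K.Emb S T where
  toEmb := FirstOrder.Language.Substructure.inclusion h.1
  strong := by
    convert h.2 using 1
    ext x
    simp only [FirstOrder.Language.Hom.mem_range, FirstOrder.Language.Substructure.mem_comap]
    constructor
    · rintro ⟨y, rfl⟩
      exact y.2
    · intro hx
      exact ⟨⟨x, hx⟩, rfl⟩

end Emb

/-! ### Orbital (Galois) types -/

variable (K)

/-- A sequence `b`, indexed by `ι`, in some extension `N` of `M`. -/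
structure Realization (M : Type u) [L.Structure M] (ι : Type v) where
  N : Type u
  [str : L.Structure N]
  emb : K.Emb M N
  b : ι → N

attribute [instance] Realization.str

/-- Atomic equivalence: the two sequences can be identified in a common extension, over `M`. -/
def EAt {M : Type u} [L.Structure M] {ι : Type v} (x y : K.Realization M ι) : Prop :=
  ∃ (P : Type u) (_ : L.Structure P) (f : K.Emb x.N P) (g : K.Emb y.N P),
    (∀ m : M, f (x.emb m) = g (y.emb m)) ∧ ∀ i, f (x.b i) = g (y.b i)

/-- Orbital types over `M` of sequences indexed by `ι`: the quotient of the realizations by the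
equivalence relation generated by atomic equivalence. -/
def GType (M : Type u) [L.Structure M] (ι : Type v) : Type (max (u + 1) v) :=
  Quot (K.EAt (M := M) (ι := ι))

variable {K}

/-- The type over `M` of the sequence `b` of elements of `N`, where `M` is embedded in `N`. -/
def tpEmb {M N : Type u} [L.Structure M] [L.Structure N] {ι : Type v} (f : K.Emb M N)
    (b : ι → N) : K.GType M ι :=
  Quot.mk _ ⟨N, f, b⟩

/-- `tp (b / S; N)` for `S ≤_K N`. -/
def tp {N : Type u} [L.Structure N] {S : L.Substructure N} (hS : K.Strong S) {ι : Type v}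
    (b : ι → N) : K.GType S ι :=
  tpEmb (Emb.incl hS) b

/-- Transport of a type along a `K`-embedding `h : M' → M`. For an inclusion this is the
restriction of the type to `M'`; for an isomorphism it is the image of the type under `h⁻¹`. -/
def GType.pull {M' M : Type u} [L.Structure M'] [L.Structure M] {ι : Type v} (h : K.Emb M' M) :
    K.GType M ι → K.GType M' ι :=
  Quot.map (fun x => ⟨x.N, x.emb.comp h, x.b⟩) (by
    rintro x y ⟨P, _, f, g, h1, h2⟩
    exact ⟨P, _, f, g, fun m => h1 (h m), h2⟩)

/-! ### Universal and limit models -/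

/-- The target of `g` is universal over its source (for extensions of cardinality `lam`). -/
def UniversalOver (lam : Cardinal.{u}) {M N : Type u} [L.Structure M] [L.Structure N]
    (g : K.Emb M N) : Prop :=
  ∀ (M' : Type u) [L.Structure M'] (h : K.Emb M M'), #M' = lam →
    ∃ f : K.Emb M' N, ∀ m, f (h m) = g m

variable (K)

/-- `T` is universal over `S`. -/
def Universal (lam : Cardinal.{u}) {N : Type u} [L.Structure N] (S T : L.Substructure N) : Prop :=
  ∃ h : K.LE S T, UniversalOver lam (Emb.inclusion h)

/-- `⟨C i : i ≤ δ⟩` is an increasing continuous chain of models of cardinality `lam`, all of them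
`≤_K N`. -/
def IsContChain (lam : Cardinal.{u}) {N : Type u} [L.Structure N] (δ : Ordinal.{u})
    (C : Ordinal.{u} → L.Substructure N) : Prop :=
  (∀ i ≤ δ, K.Strong (C i) ∧ #(C i) = lam) ∧
  (∀ i j, i ≤ j → j ≤ δ → K.LE (C i) (C j)) ∧
  (∀ j ≤ δ, Order.IsSuccLimit j → ∀ x ∈ C j, ∃ i < j, x ∈ C i)

/-- A chain as above of limit length with union `N`, each successor being universal over its
predecessor. -/
def IsUniversalChain (lam : Cardinal.{u}) {N : Type u} [L.Structure N] (δ : Ordinal.{u})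
    (C : Ordinal.{u} → L.Substructure N) : Prop :=
  Order.IsSuccLimit δ ∧ δ < (Order.succ lam).ord ∧ K.IsContChain lam δ C ∧ C δ = ⊤ ∧
  ∀ i < δ, K.Universal lam (C i) (C (Order.succ i))

/-- `N` is a limit model of cardinality `lam`: it is `(lam, δ)`-limit over some model `C 0`, for
some limit ordinal `δ < lam⁺`. -/
def IsLimitModel (lam : Cardinal.{u}) (N : Type u) [L.Structure N] : Prop :=
  ∃ (δ : Ordinal.{u}) (C : Ordinal.{u} → L.Substructure N), K.IsUniversalChain lam δ C

/-! ### Splitting, forking, superstability and symmetry -/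

/-- The type `p` over `N` does not `lam`-split over `S`. -/
def NonSplit (lam : Cardinal.{u}) {N : Type u} [L.Structure N] (S : L.Substructure N)
    (p : K.GType N Unit) : Prop :=
  K.Strong S ∧
  ∀ (N₁ N₂ : L.Substructure N) (h₁ : K.Strong N₁) (h₂ : K.Strong N₂) (le₁ : S ≤ N₁) (le₂ : S ≤ N₂),
    #N₁ = lam → #N₂ = lam → ∀ f : N₁ ≃[L] N₂,
      (∀ x : S, f (FirstOrder.Language.Substructure.inclusion le₁ x) = FirstOrder.Language.Substructure.inclusion le₂ x) →
      p.pull (Emb.incl h₁) = p.pull ((Emb.incl h₂).comp (Emb.ofEquiv (K.mem_of_strong h₂).1 f))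

/-- `p`, a type over `N`, does not `lam`-fork over `S`, where `S ≤_K N` are limit models. -/
def NonFork (lam : Cardinal.{u}) {N : Type u} [L.Structure N] (S : L.Substructure N)
    (p : K.GType N Unit) : Prop :=
  K.IsLimitModel lam N ∧ K.Strong S ∧ K.IsLimitModel lam S ∧
  ∃ S₀ : L.Substructure N, #S₀ = lam ∧ K.Universal lam S₀ S ∧ K.NonSplit lam S₀ p

/-- `tp (a / M; N)` does not `lam`-fork over `M₀`, for `M₀ ≤_K M ≤_K N`. -/
def ElemNonFork (lam : Cardinal.{u}) {N : Type u} [L.Structure N] (M₀ M : L.Substructure N)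
    (a : N) : Prop :=
  ∃ (_ : K.LE M₀ M) (hM : K.Strong M),
    K.NonFork lam (M₀.comap M.subtype.toHom) (tp hM (fun _ : Unit => a))

/-- Amalgamation in `lam`. -/
def Amalgamation (lam : Cardinal.{u}) : Prop :=
  ∀ (M₀ M₁ M₂ : Type u) [L.Structure M₀] [L.Structure M₁] [L.Structure M₂]
    (g₁ : K.Emb M₀ M₁) (g₂ : K.Emb M₀ M₂), #M₀ = lam → #M₁ = lam → #M₂ = lam →
    ∃ (M₃ : Type u) (_ : L.Structure M₃) (f₁ : K.Emb M₁ M₃) (f₂ : K.Emb M₂ M₃),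
      #M₃ = lam ∧ ∀ m, f₁ (g₁ m) = f₂ (g₂ m)

/-- Joint embedding in `lam`. -/
def JointEmbedding (lam : Cardinal.{u}) : Prop :=
  ∀ (M₁ M₂ : Type u) [L.Structure M₁] [L.Structure M₂], K.MemCard lam M₁ → K.MemCard lam M₂ →
    ∃ (M₃ : Type u) (_ : L.Structure M₃), #M₃ = lam ∧
      Nonempty (K.Emb M₁ M₃) ∧ Nonempty (K.Emb M₂ M₃)

/-- No maximal models in `lam`. -/
def NoMaximalModels (lam : Cardinal.{u}) : Prop :=
  ∀ (M : Type u) [L.Structure M], K.MemCard lam M →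
    ∃ (N : Type u) (_ : L.Structure N) (f : K.Emb M N), #N = lam ∧ ¬ Function.Surjective f

/-- Stability in `lam`. -/
def Stable (lam : Cardinal.{u}) : Prop :=
  ∀ (M : Type u) [L.Structure M], K.MemCard lam M →
    #(K.GType M Unit) ≤ Cardinal.lift.{u + 1} lam

/-- Universal local character of splitting in `lam`. -/
def SplittingLocalCharacter (lam : Cardinal.{u}) : Prop :=
  ∀ (N : Type u) [L.Structure N] (δ : Ordinal.{u}) (C : Ordinal.{u} → L.Substructure N),
    K.IsUniversalChain lam δ C → ∀ p : K.GType N Unit, ∃ i < δ, K.NonSplit lam (C i) p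

/-- Categoricity in `lam`: there is exactly one model of cardinality `lam`, up to isomorphism. -/
def Categorical (lam : Cardinal.{u}) : Prop :=
  (∃ (M : Type u) (_ : L.Structure M), K.MemCard lam M) ∧
  ∀ (M N : Type u) [L.Structure M] [L.Structure N], K.MemCard lam M → K.MemCard lam N →
    Nonempty (M ≃[L] N)

/-- Some extension `N'` of `N` contains a model `M'` with `M ≤_K M' ≤_K N'`, `b ∈ M'`, both
`M'` and `N'` limit, such that `tp (a / M'; N')` does not fork over `M`. -/
def SymmetryWitness (lam : Cardinal.{u}) {N : Type u} [L.Structure N] (M : L.Substructure N)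
    (a b : N) : Prop :=
  ∃ (N' : Type u) (_ : L.Structure N') (f : K.Emb N N') (M' : L.Substructure N'),
    K.IsLimitModel lam N' ∧ K.IsLimitModel lam M' ∧ f b ∈ M' ∧
    K.ElemNonFork lam (f.image M) M' (f a)

/-- `lam`-symmetry. -/
def SymmetryAt (lam : Cardinal.{u}) : Prop :=
  ∀ (N : Type u) [L.Structure N] (M : L.Substructure N), K.IsLimitModel lam N → K.Strong M →
    K.IsLimitModel lam M → ∀ a b : N, K.SymmetryWitness lam M a b ↔ K.SymmetryWitness lam M b a

/-! ### The frame of independent sequences -/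

/-- The data of a frame for sequences of length an ordinal: a nonforking relation
`nf N M₀ M a`, for `M₀ ≤_K M ≤_K N` and `a` a sequence of elements of `N`, and a set of basic
types over each model. -/
structure SeqFrame where
  nf : ∀ {N : Type u} [L.Structure N] (_ _ : L.Substructure N) {α : Ordinal.{u}}
    (_ : Set.Iio α → N), Prop
  basic : ∀ (M : Type u) [L.Structure M] (α : Ordinal.{u}), Set (K.GType M (Set.Iio α))

variable {K}

/-- The symmetry property of a frame: if `a₁` is independent from `M₂` over `M₀` in `N` and `a₂`
is a sequence from `M₂` with basic type over `M₀`, then in some extension `N'` of `N` there is a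
model `M₁` containing `a₁` such that `a₂` is independent from `M₁` over `M₀`. -/
def SeqFrame.Symmetry (s : K.SeqFrame) : Prop :=
  ∀ (N : Type u) [L.Structure N] (M₀ M₂ : L.Substructure N) (α₁ α₂ : Ordinal.{u})
    (a₁ : Set.Iio α₁ → N) (a₂ : Set.Iio α₂ → N) (h₀ : K.Strong M₀),
    s.nf M₀ M₂ a₁ → (∀ i, a₂ i ∈ M₂) → tp h₀ a₂ ∈ s.basic M₀ α₂ →
    ∃ (N' : Type u) (_ : L.Structure N') (f : K.Emb N N') (M₁ : L.Substructure N'),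
      (∀ i, f (a₁ i) ∈ M₁) ∧ s.nf (f.image M₀) M₁ (fun i => f (a₂ i))

/-- Independence of a sequence does not depend on the order in which it is enumerated. -/
def SeqFrame.OrderInvariant (s : K.SeqFrame) : Prop :=
  ∀ (N : Type u) [L.Structure N] (M₀ M : L.Substructure N) (α β : Ordinal.{u})
    (a : Set.Iio α → N) (e : Set.Iio β ≃ Set.Iio α), s.nf M₀ M a → s.nf M₀ M (fun i => a (e i))

variable (K)

/-- `⟨a i : i < α⟩` is independent in `(M₀, M, N)`, where `M₀ ≤_K M ≤_K N` all have cardinality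
`lam` and `α < lam⁺`: in some extension `N'` of `N` of cardinality `lam`, there is an increasing
continuous chain `⟨C i : i ≤ α⟩` starting at `M` with `a i ∈ C (i + 1)` and
`tp (a i / C i; C (i + 1))` nonalgebraic and not forking over `M₀`, for all `i < α`. -/
def Independent (lam : Cardinal.{u}) {N : Type u} [L.Structure N] (M₀ M : L.Substructure N)
    {α : Ordinal.{u}} (a : Set.Iio α → N) : Prop :=
  α < (Order.succ lam).ord ∧ #N = lam ∧ #M = lam ∧ #M₀ = lam ∧ K.LE M₀ M ∧ K.Strong M ∧
  ∃ (N' : Type u) (_ : L.Structure N') (f : K.Emb N N') (C : Ordinal.{u} → L.Substructure N'),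
    #N' = lam ∧ K.IsContChain lam α C ∧ C 0 = f.image M ∧
    ∀ i : Set.Iio α, f (a i) ∈ C (Order.succ (i : Ordinal.{u})) ∧ f (a i) ∉ C i ∧
      K.ElemNonFork lam (f.image M₀) (C i) (f (a i))

/-- The frame of independent sequences of length less than `lam⁺`. Its basic types are the types
over `M` of sequences independent in `(M, M, N)` for some extension `N` of `M`. -/
def indepSeqFrame (lam : Cardinal.{u}) : K.SeqFrame where
  nf M₀ M _ a := K.Independent lam M₀ M a
  basic M _ α := {p | ∃ (N : Type u) (_ : L.Structure N) (g : K.Emb M N) (a : Set.Iio α → N),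
    p = tpEmb g a ∧ K.Independent lam g.toEmb.toHom.range g.toEmb.toHom.range a}

end AbstractClass

/-- Abstract elementary classes. -/
structure AEC (L : FirstOrder.Language.{u, u}) extends AbstractClass L where
  coherence : ∀ {N : Type u} [L.Structure N] {S T : L.Substructure N}, S ≤ T →
    Strong S → Strong T → toAbstractClass.LE S T
  union_mem : ∀ {M : Type u} [L.Structure M] (D : Set (L.Substructure M)), D.Nonempty →
    (∀ S ∈ D, Mem S) → DirectedOn toAbstractClass.LE D → (∀ x, ∃ S ∈ D, x ∈ S) →
    Mem M ∧ ∀ S ∈ D, Strong S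
  union_strong : ∀ {N : Type u} [L.Structure N] (D : Set (L.Substructure N)), D.Nonempty →
    DirectedOn toAbstractClass.LE D → (∀ S ∈ D, Strong S) → Strong (sSup D)
  lst : ∃ κ : Cardinal.{u}, L.card + ℵ₀ ≤ κ ∧ ∀ (N : Type u) [L.Structure N], Mem N →
    ∀ A : Set N, ∃ S : L.Substructure N, Strong S ∧ A ⊆ S ∧ #S ≤ #A + κ

namespace AEC

variable {L : FirstOrder.Language.{u, u}} (K : AEC L)

/-- The Löwenheim-Skolem-Tarski number. -/
noncomputable def LS : Cardinal.{u} :=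
  sInf {κ : Cardinal.{u} | L.card + ℵ₀ ≤ κ ∧ ∀ (N : Type u) [L.Structure N], K.Mem N →
    ∀ A : Set N, ∃ S : L.Substructure N, K.Strong S ∧ A ⊆ S ∧ #S ≤ #A + κ}

/-- `lam`-superstability. -/
structure Superstable (lam : Cardinal.{u}) : Prop where
  ls_le : K.LS ≤ lam
  nonempty : ∃ (M : Type u) (_ : L.Structure M), K.MemCard lam M
  amalgamation : K.Amalgamation lam
  jointEmbedding : K.JointEmbedding lam
  noMaximalModels : K.NoMaximalModels lam
  stable : K.Stable lam
  localCharacter : K.SplittingLocalCharacter lam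

end AEC

/-! Stability and amalgamation give a model `C` of cardinality at most `lam⁺` that realizes all
types over its submodels of cardinality `lam`. Such a model is homogeneous: types over small models
become orbits of the automorphism group, and abstract extensions become submodels of `C`. By
categoricity any two models of cardinality `lam` inside `C` are conjugate, so all of them are limit
models and the limit clauses in the definition of nonforking are automatic. The combinatorics then
only needs the axioms of `HomogeneousSystem`.

The first task is the calculus of nonforking for elements. Extension holds because the larger model
embeds into the smaller one over the nonsplitting witness. Uniqueness is the delicate point
(`eqType_of_omegaLimit`): two witnesses leading to different extensions produce an ω-chain of
universal extensions along which a single type splits over every term, against local character.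
Uniqueness gives transitivity, and transitivity with local character gives continuity, though only
along chains of universal extensions (`NoFork.iUnion`). This is why all families of models below are
kept universal over one another.

The core is `exists_enlarged_family`: in a chain of models witnessing independence, one element `b`
of the sequence can be put into all the models while the other elements stay independent. The
element `b` is held fixed and the chain is moved. When an index before that of `b` is passed,
symmetry for elements turns "`a i` is free from a model containing `b`" into "`b` is free from a
model containing `a i`", so `b` remains free from the initial segment built so far. Repeating this
along a new enumeration gives a matrix of models whose row `j` has absorbed the first `j` elements
of the new enumeration; the entries in the first column witness independence in the new order
(`Indep.reorder`). Universality inside a row yields continuity at limit indices, universality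
between rows yields continuity at limit rows.

Symmetry for sequences follows by reordering: the concatenation of `a₂` and `a₁` is independent over
`M₀`, hence so is the concatenation of `a₁` and `a₂`, and the model reached after `a₁` is the
required `M₁`. -/

/-- Transfinite recursion where the value at `i` is only required to satisfy a relation with the
values below `i`. -/
theorem exists_of_history {ι : Type*} [LinearOrder ι] [WellFoundedLT ι] {P : Type*} [Nonempty P]
    (Φ : ι → (ι → P) → P → Prop)
    (hΦ : ∀ i f g x, (∀ j < i, f j = g j) → Φ i f x → Φ i g x)
    (step : ∀ i f, (∀ j < i, Φ j f (f j)) → ∃ x, Φ i f x) : ∃ f : ι → P, ∀ i, Φ i f (f i) := by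
  classical
  let arb : P := Classical.arbitrary P
  let rec' : ∀ i, (∀ j, j < i → P) → P := fun i ih =>
    if h : ∃ x, Φ i (fun j => if hj : j < i then ih j hj else arb) x then h.choose else arb
  let F : ι → P := (wellFounded_lt (α := ι)).fix rec'
  have hF : ∀ i, F i = rec' i (fun j _ => F j) := fun i => WellFounded.fix_eq _ _ _
  refine ⟨F, fun i => ?_⟩
  induction i using WellFoundedLT.induction with
  | _ i ih =>
    obtain ⟨x, hx⟩ := step i F ih
    have h : ∃ x, Φ i (fun j => if hj : j < i then F j else arb) x :=
      ⟨x, hΦ i F _ x (fun j hj => by simp [hj]) hx⟩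
    have h2 : F i = h.choose := by
      rw [hF i]
      exact dif_pos h
    rw [h2]
    exact hΦ i _ F _ (fun j hj => by simp [hj]) h.choose_spec

/-! ### Small models in a homogeneous model, and universal extensions -/

open Pointwise

/-- A set `C` with a group action and an invariant family of small subsets, the models, with the
closure and homogeneity properties of the small models inside a homogeneous model. -/
structure HomogeneousSystem (G : Type v) (C : Type u) [Group G] [MulAction G C]
    (lam : Cardinal.{u}) where
  IsModel : Set C → Prop
  aleph0_le : ℵ₀ ≤ lam
  card_le : ∀ {S}, IsModel S → #S ≤ lam
  exists_superset : ∀ A : Set C, #A ≤ lam → ∃ S, IsModel S ∧ A ⊆ S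
  smul : ∀ (g : G) {S}, IsModel S → IsModel (g • S)
  iUnion : ∀ {ι : Type u} [LinearOrder ι] [Nonempty ι] (S : ι → Set C), #ι ≤ lam → Monotone S →
    (∀ i, IsModel (S i)) → IsModel (⋃ i, S i)
  glue : ∀ {ι : Type u} [LinearOrder ι] [Nonempty ι] (S : ι → Set C) (g : ι → G), #ι ≤ lam →
    Monotone S → (∀ i, IsModel (S i)) → (∀ i j, i ≤ j → ∀ x ∈ S i, g j • x = g i • x) →
    ∃ h : G, ∀ i, ∀ x ∈ S i, h • x = g i • x
  small_types : ∀ {S}, IsModel S → ∃ R : Set C, #R ≤ lam ∧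
    ∀ a, ∃ g : G, (∀ x ∈ S, g • x = x) ∧ g • a ∈ R
  conj : ∀ {S T}, IsModel S → IsModel T → ∃ g : G, g • S = T

namespace HomogeneousSystem

variable {G : Type v} {C : Type u} [Group G] [MulAction G C] {lam : Cardinal.{u}}

/-- `g` fixes `S` pointwise. -/
def Fixes (g : G) (S : Set C) : Prop := ∀ x ∈ S, g • x = x

theorem Fixes.mono {g : G} {S T : Set C} (h : Fixes g T) (hST : S ⊆ T) : Fixes g S :=
  fun x hx => h x (hST hx)

theorem Fixes.one (S : Set C) : Fixes (1 : G) S := fun x _ => one_smul G x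

theorem Fixes.inv {g : G} {S : Set C} (h : Fixes g S) : Fixes g⁻¹ S := fun x hx => by
  rw [inv_smul_eq_iff, h x hx]

theorem Fixes.mul {g h : G} {S : Set C} (hg : Fixes g S) (hh : Fixes h S) : Fixes (g * h) S :=
  fun x hx => by rw [mul_smul, hh x hx, hg x hx]

theorem Fixes.smul_eq {g : G} {S : Set C} (hg : Fixes g S) : g • S = S := by
  ext x
  constructor
  · rintro ⟨y, hy, rfl⟩
    change g • y ∈ S
    rwa [hg y hy]
  · exact fun hx => ⟨x, hx, hg x hx⟩

theorem Fixes.conj {g : G} {S : Set C} (hg : Fixes g S) (k : G) : Fixes (k * g * k⁻¹) (k • S) := by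
  rintro _ ⟨x, hx, rfl⟩
  change (k * g * k⁻¹) • k • x = k • x
  rw [smul_smul, inv_mul_cancel_right, mul_smul, hg x hx]

theorem smul_congr {g h : G} {S : Set C} (H : ∀ x ∈ S, g • x = h • x) : g • S = h • S :=
  Set.image_congr H

variable (H : HomogeneousSystem G C lam)

variable (G) in
/-- `a` and `b` are conjugate over `S`. -/
def EqType (S : Set C) (a b : C) : Prop := ∃ g : G, Fixes g S ∧ g • a = b

theorem EqType.refl (S : Set C) (a : C) : EqType G S a a := ⟨1, Fixes.one S, one_smul G a⟩

theorem EqType.symm {S : Set C} {a b : C} : EqType G S a b → EqType G S b a := by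
  rintro ⟨g, hg, rfl⟩
  exact ⟨g⁻¹, hg.inv, inv_smul_smul g a⟩

theorem EqType.trans {S : Set C} {a b c : C} :
    EqType G S a b → EqType G S b c → EqType G S a c := by
  rintro ⟨g, hg, rfl⟩ ⟨h, hh, rfl⟩
  exact ⟨h * g, hh.mul hg, mul_smul _ _ _⟩

theorem EqType.mono {S T : Set C} {a b : C} (h : EqType G T a b) (hST : S ⊆ T) :
    EqType G S a b := by
  obtain ⟨g, hg, e⟩ := h
  exact ⟨g, hg.mono hST, e⟩

theorem EqType.smul {S : Set C} {a b : C} (h : EqType G S a b) (k : G) :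
    EqType G (k • S) (k • a) (k • b) := by
  obtain ⟨g, hg, rfl⟩ := h
  exact ⟨k * g * k⁻¹, hg.conj k, by simp [mul_smul]⟩

/-- `T` is universal over `S`. -/
def Univ (S T : Set C) : Prop :=
  S ⊆ T ∧ ∀ S', H.IsModel S' → S ⊆ S' → ∃ g : G, Fixes g S ∧ g • S' ⊆ T

variable {H}

theorem Univ.mono_right {S T T' : Set C} (h : H.Univ S T) (hT : T ⊆ T') : H.Univ S T' :=
  ⟨h.1.trans hT, fun S' h1 h2 => (h.2 S' h1 h2).imp fun _ hg => ⟨hg.1, hg.2.trans hT⟩⟩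

theorem exists_superset₂ (H : HomogeneousSystem G C lam) {A B : Set C} (hA : #A ≤ lam)
    (hB : #B ≤ lam) : ∃ S, H.IsModel S ∧ A ⊆ S ∧ B ⊆ S := by
  obtain ⟨S, hS, h⟩ := H.exists_superset (A ∪ B)
    ((mk_union_le _ _).trans (add_le_of_le H.aleph0_le hA hB))
  exact ⟨S, hS, (Set.subset_union_left).trans h, (Set.subset_union_right).trans h⟩

theorem exists_superset_iUnion (H : HomogeneousSystem G C lam) {ι : Type u} (S : ι → Set C)
    (hι : #ι ≤ lam) (hS : ∀ i, #(S i) ≤ lam) : ∃ T, H.IsModel T ∧ ∀ i, S i ⊆ T := by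
  obtain ⟨T, hT, h⟩ := H.exists_superset (⋃ i, S i) (by
    refine (mk_iUnion_le _).trans ?_
    calc #ι * ⨆ i, #(S i) ≤ lam * lam := mul_le_mul' hι (ciSup_le' hS)
      _ = lam := mul_eq_self H.aleph0_le)
  exact ⟨T, hT, fun i => (Set.subset_iUnion S i).trans h⟩

theorem Univ.mono_left {S T S' : Set C} (h : H.Univ S T) (hM : H.IsModel S) (hS : S' ⊆ S) :
    H.Univ S' T := by
  refine ⟨hS.trans h.1, fun W hW hSW => ?_⟩
  obtain ⟨W', h1, h2, h3⟩ := H.exists_superset₂ (H.card_le hW) (H.card_le hM)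
  obtain ⟨g, hg, hg'⟩ := h.2 W' h1 h3
  exact ⟨g, hg.mono hS, (Set.smul_set_mono h2).trans hg'⟩

theorem Univ.smul {S T : Set C} (h : H.Univ S T) (k : G) : H.Univ (k • S) (k • T) := by
  refine ⟨Set.smul_set_mono h.1, fun W hW hSW => ?_⟩
  obtain ⟨g, hg, hg'⟩ :=
    h.2 (k⁻¹ • W) (H.smul _ hW) (Set.subset_smul_set_iff.2 (by simpa using hSW))
  refine ⟨k * g * k⁻¹, hg.conj k, ?_⟩
  rw [mul_smul, mul_smul]
  exact Set.smul_set_mono hg'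

/-- A coherent family of group elements, indexed by a well-order, also prescribed at one more point
at each stage, has a common extension. -/
theorem glue_points (H : HomogeneousSystem G C lam) {ι : Type u} [LinearOrder ι]
    (S : ι → Set C) (a : ι → C) (g : ι → G) (hι : #ι ≤ lam) (hS : Monotone S)
    (hM : ∀ i, H.IsModel (S i)) (haS : ∀ i j, i < j → a i ∈ S j)
    (hg : ∀ i j, i < j → ∀ x ∈ S i, g j • x = g i • x)
    (hga : ∀ i j, i < j → g j • a i = g i • a i) :
    ∃ h : G, (∀ i, ∀ x ∈ S i, h • x = g i • x) ∧ ∀ i, h • a i = g i • a i := by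
  have hg' : ∀ i j, i ≤ j → ∀ x ∈ S i, g j • x = g i • x := fun i j hij => by
    rcases hij.eq_or_lt with rfl | h
    · exact fun _ _ => rfl
    · exact hg i j h
  -- With a last index `m`, the element `g m` is already the extension. Otherwise every `a i` lies
  -- in a later model, and gluing along the models suffices.
  by_cases hmax : ∃ m, ∀ i : ι, i ≤ m
  · obtain ⟨m, hm⟩ := hmax
    refine ⟨g m, fun i => hg' i m (hm i), fun i => ?_⟩
    rcases (hm i).eq_or_lt with rfl | h
    · rfl
    · exact hga i m h
  · push Not at hmax
    rcases isEmpty_or_nonempty ι with hE | hN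
    · exact ⟨1, fun i => hE.elim i, fun i => hE.elim i⟩
    · obtain ⟨h, hh⟩ := H.glue S g hι hS hM hg'
      refine ⟨h, hh, fun i => ?_⟩
      obtain ⟨j, hj⟩ := hmax i
      rw [hh j _ (haS i j hj), hga i j hj]

theorem mk_lt_subtype_le {ι : Type u} [LinearOrder ι] (hι : #ι ≤ lam) (i : ι) :
    #{j // j < i} ≤ lam := (mk_subtype_le _).trans hι

/-- The union of a chain of length `lam` in which each term realizes all types over the earlier ones
is universal: a given model is embedded by treating its elements one at a time, each being
conjugated into a term of the chain. -/
theorem exists_univ (H : HomogeneousSystem G C lam) {S : Set C} (hS : H.IsModel S) :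
    ∃ T, H.IsModel T ∧ H.Univ S T := by
  classical
  let κ : Type u := lam.ord.ToType
  have hκ : #κ = lam := by simp [κ]
  have : NoMaxOrder κ := Cardinal.noMaxOrder H.aleph0_le
  have : Nonempty κ := by
    rw [← mk_ne_zero_iff, hκ]
    exact (aleph0_pos.trans_le H.aleph0_le).ne'
  obtain ⟨T, hT⟩ := exists_of_history (ι := κ) (P := Set C)
    (fun k f x => H.IsModel x ∧ S ⊆ x ∧ ∀ j < k, f j ⊆ x ∧
      ∀ a, ∃ g : G, Fixes g (f j) ∧ g • a ∈ x) (by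
      rintro i f g x hfg ⟨h1, h2, h3⟩
      exact ⟨h1, h2, fun j hj => hfg j hj ▸ h3 j hj⟩) (by
      intro k f hf
      choose R hR hR' using fun j : {j // j < k} => H.small_types (hf j j.2).1
      obtain ⟨x, hx, hx'⟩ := H.exists_superset_iUnion
        (fun j : Option {j // j < k} => j.elim S fun j => f j ∪ R j)
        (by rw [mk_option]; exact add_le_of_le H.aleph0_le (mk_lt_subtype_le hκ.le k)
              (one_le_aleph0.trans H.aleph0_le))
        (by
          rintro (_ | j)
          · exact H.card_le hS
          · exact (mk_union_le _ _).trans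
              (add_le_of_le H.aleph0_le (H.card_le (hf j j.2).1) (hR j)))
      refine ⟨x, hx, hx' none, fun j hj => ⟨Set.subset_union_left.trans (hx' (some ⟨j, hj⟩)),
        fun a => ?_⟩⟩
      obtain ⟨g, h1, h2⟩ := hR' ⟨j, hj⟩ a
      exact ⟨g, h1, hx' (some ⟨j, hj⟩) (Or.inr h2)⟩)
  have hTm : Monotone T := fun i j hij => by
    rcases hij.eq_or_lt with rfl | h
    · rfl
    · exact ((hT j).2.2 i h).1
  have hTM : ∀ i, H.IsModel (T i) := fun i => (hT i).1
  refine ⟨_, H.iUnion T hκ.le hTm hTM, ?_, fun N hN hSN => ?_⟩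
  · exact ((hT (Classical.arbitrary κ)).2.1).trans (Set.subset_iUnion T _)
  rcases N.eq_empty_or_nonempty with rfl | hNe
  · exact ⟨1, Fixes.one S, by simp⟩
  obtain ⟨ν, hν⟩ : ∃ ν : κ → C, N ⊆ Set.range ν := by
    have := hNe.to_subtype
    have : #N ≤ #κ := hκ ▸ H.card_le hN
    obtain ⟨e⟩ := this
    refine ⟨fun k => (Function.invFun e k : N), fun x hx => ⟨e ⟨x, hx⟩, ?_⟩⟩
    exact congrArg Subtype.val (Function.leftInverse_invFun e.injective _)
  -- The maps act on the chain rather than on `N`, since gluing requires models; the inverse of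
  -- their common extension sends `N` into the union.
  obtain ⟨g, hg⟩ := exists_of_history (ι := κ) (P := G)
    (fun k f x => Fixes x S ∧ ∀ j < k, (∀ t ∈ T j, x • t = f j • t) ∧ ν j ∈ x • T k) (by
      rintro i f g x hfg ⟨h1, h2⟩
      exact ⟨h1, fun j hj => hfg j hj ▸ h2 j hj⟩) (by
      intro k f hf
      obtain ⟨τ, hτ⟩ : ∃ τ : G, Fixes τ S ∧ ∀ j < k, ∀ t ∈ T j, τ • t = f j • t := by
        rcases isEmpty_or_nonempty {j // j < k} with hE | hE
        · exact ⟨1, Fixes.one S, fun j hj => hE.elim ⟨j, hj⟩⟩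
        · obtain ⟨τ, hτ⟩ := H.glue (fun j : {j // j < k} => T j) (fun j => f j)
            (mk_lt_subtype_le hκ.le k) (fun i j h => hTm h) (fun j => hTM j) (fun i j hij x hx => by
              rcases hij.eq_or_lt with rfl | h
              · rfl
              · exact ((hf j j.2).2 i h).1 x hx)
          refine ⟨τ, fun x hx => ?_, fun j hj => hτ ⟨j, hj⟩⟩
          obtain ⟨j⟩ := hE
          rw [hτ j x ((hT j).2.1 hx), (hf j j.2).1 x hx]
      by_cases hmax : ∃ m < k, ∀ j < k, j ≤ m
      · obtain ⟨m, hmk, hm⟩ := hmax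
        -- Stage after `m`: `τ⁻¹ • ν m` has a conjugate over `T m` in `T k`. Composing `τ` with the
        -- inverse conjugation brings `ν m` into the image of `T k` and changes nothing on `T m`.
        obtain ⟨h, hh, hh'⟩ := ((hT k).2.2 m hmk).2 (τ⁻¹ • ν m)
        have key : ∀ t ∈ T m, (τ * h⁻¹) • t = τ • t := fun t ht => by
          rw [mul_smul, hh.inv t ht]
        refine ⟨τ * h⁻¹, hτ.1.mul (hh.inv.mono (hT m).2.1), fun j hj => ⟨fun t ht => ?_, ?_⟩⟩
        · rw [key t (hTm (hm j hj) ht), hτ.2 j hj t ht]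
        · rcases (hm j hj).eq_or_lt with rfl | hjm
          · exact ⟨_, hh', by simp [mul_smul]⟩
          · obtain ⟨t, ht, e⟩ := ((hf m hmk).2 j hjm).2
            refine ⟨t, hTm hmk.le ht, ?_⟩
            change (τ * h⁻¹) • t = ν j
            rw [key t ht, hτ.2 m hmk t ht]
            exact e
      · push Not at hmax
        refine ⟨τ, hτ.1, fun j hj => ⟨hτ.2 j hj, ?_⟩⟩
        obtain ⟨j', hj', hjj'⟩ := hmax j hj
        obtain ⟨t, ht, e⟩ := ((hf j' hj').2 j hjj').2
        refine ⟨t, hTm hj'.le ht, ?_⟩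
        change τ • t = ν j
        rw [hτ.2 j' hj' t ht]
        exact e)
  obtain ⟨h, hh⟩ := H.glue T g hκ.le hTm hTM (fun i j hij x hx => by
    rcases hij.eq_or_lt with rfl | hij
    · rfl
    · exact ((hg j).2 i hij).1 x hx)
  have hS : Fixes h S := fun x hx => by
    let k : κ := Classical.arbitrary κ
    rw [hh k x ((hT k).2.1 hx), (hg k).1 x hx]
  refine ⟨h⁻¹, hS.inv, ?_⟩
  rintro _ ⟨x, hx, rfl⟩
  obtain ⟨k, rfl⟩ := hν hx
  obtain ⟨k', hk'⟩ := exists_gt k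
  obtain ⟨t, ht, e⟩ := ((hg k').2 k hk').2
  refine Set.mem_iUnion.2 ⟨k', ?_⟩
  change h⁻¹ • ν k ∈ T k'
  rw [show ν k = g k' • t from e.symm, ← hh k' t ht, inv_smul_smul]
  exact ht

end HomogeneousSystem

/-! ### Nonsplitting and nonforking: extension, uniqueness, transitivity, continuity -/

namespace HomogeneousSystem

variable {G : Type v} {C : Type u} [Group G] [MulAction G C] {lam : Cardinal.{u}}
variable (H : HomogeneousSystem G C lam)

/-- The type of `a` over `M` does not split over `S`. -/
def NoSplit (S M : Set C) (a : C) : Prop :=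
  ∀ N, H.IsModel N → S ⊆ N → N ⊆ M → ∀ σ : G, Fixes σ S → σ • N ⊆ M →
    ∃ g : G, (∀ x ∈ N, g • x = σ • x) ∧ g • a = a

/-- The type of `a` over `M` does not fork over `M₀`. -/
def NoFork (M₀ M : Set C) (a : C) : Prop :=
  M₀ ⊆ M ∧ ∃ S, H.IsModel S ∧ H.Univ S M₀ ∧ H.NoSplit S M a

/-- `T` is the union of a chain of length `ω` starting with `S`, each term being universal over the
previous one. -/
def OmegaLimit (S T : Set C) : Prop :=
  ∃ t : ℕ → Set C, t 0 = S ∧ (∀ n, H.IsModel (t n)) ∧ (∀ n, H.Univ (t n) (t (n + 1))) ∧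
    T = ⋃ n, t n

/-- Local character of nonsplitting along chains of universal extensions. -/
def LocalCharacter : Prop :=
  ∀ {ι : Type u} [LinearOrder ι] [WellFoundedLT ι] [Nonempty ι] [NoMaxOrder ι] (S : ι → Set C),
    #ι ≤ lam → (∀ i, H.IsModel (S i)) → (∀ i j, i < j → H.Univ (S i) (S j)) →
    ∀ a, ∃ i, H.NoSplit (S i) (⋃ i, S i) a

/-- Symmetry of nonforking for elements. -/
def ElemSymmetry : Prop :=
  ∀ M, H.IsModel M → ∀ a b : C, (∃ M', H.IsModel M' ∧ b ∈ M' ∧ H.NoFork M M' a) →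
    ∃ M', H.IsModel M' ∧ a ∈ M' ∧ H.NoFork M M' b

variable {H}

theorem NoSplit.mono {S S' M M' : Set C} {a : C} (h : H.NoSplit S M a) (hS : S ⊆ S')
    (hM : M' ⊆ M) : H.NoSplit S' M' a :=
  fun N h1 h2 h3 σ h4 h5 => h N h1 (hS.trans h2) (h3.trans hM) σ (h4.mono hS) (h5.trans hM)

theorem smul_subset_iff {g : G} {S T : Set C} : g • S ⊆ T ↔ S ⊆ g⁻¹ • T := by
  constructor
  · intro h
    have := Set.smul_set_mono (a := g⁻¹) h
    rwa [inv_smul_smul] at this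
  · intro h
    have := Set.smul_set_mono (a := g) h
    rwa [smul_inv_smul] at this

theorem Fixes.of_conj {g k : G} {S : Set C} (hg : Fixes g (k • S)) : Fixes (k⁻¹ * g * k) S := by
  simpa using hg.conj k⁻¹

theorem NoSplit.smul {S M : Set C} {a : C} (h : H.NoSplit S M a) (k : G) :
    H.NoSplit (k • S) (k • M) (k • a) := by
  intro N h1 h2 h3 σ h4 h5
  obtain ⟨g, hg, hga⟩ := h (k⁻¹ • N) (H.smul _ h1) (smul_subset_iff.1 h2)
    (by rw [smul_subset_iff, inv_inv]; exact h3) (k⁻¹ * σ * k) h4.of_conj (by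
      rw [smul_smul, mul_assoc, mul_inv_cancel, mul_one, mul_smul, smul_subset_iff, inv_inv]
      exact h5)
  refine ⟨k * g * k⁻¹, fun x hx => ?_, ?_⟩
  · rw [mul_smul, mul_smul, hg _ (Set.smul_mem_smul_set hx)]
    simp [mul_smul]
  · simp [mul_smul, hga]

theorem NoFork.smul {M₀ M : Set C} {a : C} (h : H.NoFork M₀ M a) (k : G) :
    H.NoFork (k • M₀) (k • M) (k • a) := by
  obtain ⟨h1, S, h2, h3, h4⟩ := h
  exact ⟨Set.smul_set_mono h1, k • S, H.smul _ h2, h3.smul k, h4.smul k⟩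

theorem NoFork.mono {M₀ M₀' M M' : Set C} {a : C} (h : H.NoFork M₀ M a) (h1 : M₀ ⊆ M₀')
    (h2 : M₀' ⊆ M') (h3 : M' ⊆ M) : H.NoFork M₀' M' a := by
  obtain ⟨_, S, hS, hU, hN⟩ := h
  exact ⟨h2, S, hS, hU.mono_right h1, hN.mono subset_rfl h3⟩

theorem NoSplit.of_eqType {S M : Set C} {a b : C} (h : H.NoSplit S M a) (hSM : S ⊆ M)
    (e : EqType G M a b) : H.NoSplit S M b := by
  obtain ⟨g, hg, rfl⟩ := e
  have := h.smul g
  rwa [hg.smul_eq, (hg.mono hSM).smul_eq] at this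

theorem NoFork.of_eqType {M₀ M : Set C} {a b : C} (h : H.NoFork M₀ M a)
    (e : EqType G M a b) : H.NoFork M₀ M b := by
  obtain ⟨h1, S, h2, h3, h4⟩ := h
  exact ⟨h1, S, h2, h3, h4.of_eqType (h3.1.trans h1) e⟩

/-- Weak uniqueness of nonsplitting extensions. -/
theorem NoSplit.eqType {S M N : Set C} {a b : C} (hN : H.IsModel N) (hU : H.Univ S M)
    (hMN : M ⊆ N) (ha : H.NoSplit S N a) (hb : H.NoSplit S N b) (e : EqType G M a b) :
    EqType G N a b := by
  -- Nonsplitting identifies the types of `a` and `b` over `N` with their copies over `f • N`, which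
  -- lies inside `M`, where the two types agree.
  obtain ⟨f, hf, hfN⟩ := hU.2 N hN (hU.1.trans hMN)
  obtain ⟨g, hg, hga⟩ := ha N hN (hU.1.trans hMN) subset_rfl f hf (hfN.trans hMN)
  obtain ⟨k, hk, hkb⟩ := hb N hN (hU.1.trans hMN) subset_rfl f hf (hfN.trans hMN)
  obtain ⟨σ, hσ, rfl⟩ := e
  refine ⟨k⁻¹ * σ * g, fun x hx => ?_, ?_⟩
  · have : f • x ∈ M := hfN (Set.smul_mem_smul_set hx)
    rw [mul_smul, mul_smul, hg x hx, hσ _ this, ← hk x hx, inv_smul_smul]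
  · rw [mul_smul, mul_smul, hga, inv_smul_eq_iff, hkb]

/-- Extension of nonsplitting. -/
theorem NoSplit.exists_extension {S M N : Set C} {a : C} (hM : H.IsModel M) (hN : H.IsModel N)
    (hU : H.Univ S M) (hMN : M ⊆ N) (ha : H.NoSplit S M a) :
    ∃ b, EqType G M b a ∧ H.NoSplit S N b := by
  obtain ⟨f, hf, hfN⟩ := hU.2 N hN (hU.1.trans hMN)
  obtain ⟨g, hg, hga⟩ := ha M hM hU.1 subset_rfl f hf ((Set.smul_set_mono hMN).trans hfN)
  -- The extension is the pullback of the type of `a` over `f • N ⊆ M`; nonsplitting of `a` applied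
  -- to `f` on `M` shows that it restricts to the type of `a` over `M`.
  refine ⟨f⁻¹ • a, ⟨g⁻¹ * f, fun x hx => ?_, ?_⟩, ?_⟩
  · rw [mul_smul, ← hg x hx, inv_smul_smul]
  · rw [mul_smul, smul_inv_smul, inv_smul_eq_iff, hga]
  · have := (ha.mono subset_rfl hfN).smul f⁻¹
    rwa [inv_smul_smul, hf.inv.smul_eq] at this

/-- A realization of a nonforking type outside the base lies outside the larger model. -/
theorem NoFork.notMem {M₀ M : Set C} {a : C} (hM : H.IsModel M) (h : H.NoFork M₀ M a)
    (ha : a ∉ M₀) : a ∉ M := by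
  intro haM
  obtain ⟨h1, S, h2, h3, h4⟩ := h
  -- An embedding of `M` into `M₀` over `S` must fix `a`, by nonsplitting applied to a model that
  -- contains `a`; hence `a` would lie in `M₀`.
  obtain ⟨f, hf, hfM⟩ := h3.2 M hM (h3.1.trans h1)
  obtain ⟨g, hg, hga⟩ := h4 M hM (h3.1.trans h1) subset_rfl f hf (hfM.trans h1)
  rw [hg a haM] at hga
  exact ha (hga ▸ hfM (Set.smul_mem_smul_set haM))

theorem exists_omegaLimit (H : HomogeneousSystem G C lam) {S : Set C} (hS : H.IsModel S) :
    ∃ T, H.OmegaLimit S T := by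
  choose f hf hU using fun S : {S // H.IsModel S} => H.exists_univ S.2
  let t : ℕ → {S // H.IsModel S} := fun n => (fun S => ⟨f S, hf S⟩)^[n] ⟨S, hS⟩
  refine ⟨_, fun n => t n, rfl, fun n => (t n).2, fun n => ?_, rfl⟩
  have : t (n + 1) = ⟨f (t n), hf (t n)⟩ := Function.iterate_succ_apply' _ _ _
  change H.Univ (t n) (t (n + 1))
  rw [this]
  exact hU (t n)

theorem monotone_of_univ {t : ℕ → Set C} (h : ∀ n, H.Univ (t n) (t (n + 1))) : Monotone t :=
  monotone_nat_of_le_succ fun n => (h n).1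

theorem univ_of_lt {t : ℕ → Set C} (h : ∀ n, H.Univ (t n) (t (n + 1))) {m n : ℕ} (hmn : m < n) :
    H.Univ (t m) (t n) :=
  (h m).mono_right (monotone_of_univ h hmn)

theorem isModel_iUnion_nat (H : HomogeneousSystem G C lam) {t : ℕ → Set C} (ht : Monotone t)
    (hM : ∀ n, H.IsModel (t n)) : H.IsModel (⋃ n, t n) := by
  have := H.iUnion (ι := ULift.{u} ℕ) (fun n => t n.down) (by simpa using H.aleph0_le)
    (fun i j h => ht h) (fun n => hM _)
  convert this using 1
  ext x
  simp

theorem OmegaLimit.isModel {S T : Set C} (h : H.OmegaLimit S T) : H.IsModel T := by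
  obtain ⟨t, -, h2, h3, rfl⟩ := h
  exact H.isModel_iUnion_nat (monotone_of_univ h3) h2

theorem OmegaLimit.univ {S T : Set C} (h : H.OmegaLimit S T) : H.Univ S T := by
  obtain ⟨t, rfl, h2, h3, rfl⟩ := h
  exact (h3 0).mono_right (Set.subset_iUnion t 1)

theorem OmegaLimit.mono_left {S S' T : Set C} (h : H.OmegaLimit S T) (hS' : H.IsModel S')
    (hS : S' ⊆ S) : H.OmegaLimit S' T := by
  obtain ⟨t, rfl, h2, h3, rfl⟩ := h
  refine ⟨fun n => n.casesOn S' fun n => t (n + 1), rfl, ?_, ?_, ?_⟩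
  · rintro (_ | n)
    exacts [hS', h2 _]
  · rintro (_ | n)
    exacts [(h3 0).mono_left (h2 0) hS, h3 _]
  · apply subset_antisymm
    · refine Set.iUnion_subset fun n => ?_
      exact (h3 n).1.trans (Set.subset_iUnion (fun n : ℕ => (n.casesOn S' fun n => t (n + 1) :
        Set C))
        (n + 1))
    · refine Set.iUnion_subset fun n => ?_
      rcases n with _ | n
      · exact hS.trans (Set.subset_iUnion t 0)
      · exact Set.subset_iUnion t (n + 1)

theorem OmegaLimit.smul {S T : Set C} (h : H.OmegaLimit S T) (k : G) :
    H.OmegaLimit (k • S) (k • T) := by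
  obtain ⟨t, rfl, h2, h3, rfl⟩ := h
  exact ⟨fun n => k • t n, rfl, fun n => H.smul k (h2 n), fun n => (h3 n).smul k,
    Set.smul_set_iUnion _ _⟩

/-- Back and forth: universality of `t (n + 1)` over `t n` absorbs the preimage of `t' n`, and
universality of `t' (n + 1)` over `t' n` then absorbs the image of `t (n + 1)`. -/
theorem OmegaLimit.exists_conj {S T T' : Set C} (h : H.OmegaLimit S T) (h' : H.OmegaLimit S T') :
    ∃ g : G, Fixes g S ∧ g • T = T' := by
  obtain ⟨t, rfl, h2, h3, rfl⟩ := h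
  obtain ⟨t', h1', h2', h3', rfl⟩ := h'
  have step : ∀ n (g : G), g • t n ⊆ t' n → ∃ g' : G, (∀ x ∈ t n, g' • x = g • x) ∧
      g' • t (n + 1) ⊆ t' (n + 1) ∧ t' n ⊆ g' • t (n + 1) := by
    intro n g hg
    obtain ⟨h, hh, hh'⟩ := (h3 n).2 (g⁻¹ • t' n) (H.smul _ (h2' n)) (smul_subset_iff.1 hg)
    have e1 : t' n ⊆ (g * h⁻¹) • t (n + 1) := by
      have := smul_subset_iff.1 hh'
      rw [mul_smul]
      have := Set.smul_set_mono (a := g) this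
      rwa [smul_inv_smul] at this
    obtain ⟨k, hk, hk'⟩ := (h3' n).2 _ (H.smul (g * h⁻¹) (h2 (n + 1))) e1
    refine ⟨k * (g * h⁻¹), fun x hx => ?_, ?_, ?_⟩
    · rw [mul_smul, mul_smul, hh.inv x hx, hk _ (hg (Set.smul_mem_smul_set hx))]
    · rwa [mul_smul]
    · have := Set.smul_set_mono (a := k) e1
      rwa [hk.smul_eq, smul_smul] at this
  choose! s hs1 hs2 hs3 using step
  let g : ℕ → G := fun n => n.rec 1 fun n g => s n g
  have hg : ∀ n, g n • t n ⊆ t' n := fun n => by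
    induction n with
    | zero => simp [g, h1']
    | succ n ih => exact hs2 n _ ih
  have hm := monotone_of_univ h3
  have hc : ∀ m n, m ≤ n → ∀ x ∈ t m, g n • x = g m • x := by
    intro m n hmn
    induction n, hmn using Nat.le_induction with
    | base => exact fun _ _ => rfl
    | succ n hmn ih => exact fun x hx => (hs1 n _ (hg n) x (hm hmn hx)).trans (ih x hx)
  obtain ⟨k, hk⟩ := H.glue (ι := ULift.{u} ℕ) (fun n => t n.down) (fun n => g n.down)
    (by simpa using H.aleph0_le) (fun i j h => hm h) (fun n => h2 _)
    (fun i j h => hc _ _ h)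
  have hk' : ∀ n, k • t n = g n • t n := fun n => smul_congr (hk ⟨n⟩)
  refine ⟨k, fun x hx => ?_, ?_⟩
  · rw [hk ⟨0⟩ x hx]
    exact one_smul _ _
  · rw [Set.smul_set_iUnion]
    apply subset_antisymm
    · refine Set.iUnion_subset fun n => ?_
      rw [hk' n]
      exact (hg n).trans (Set.subset_iUnion t' n)
    · refine Set.iUnion_subset fun n => ?_
      refine (hs3 n _ (hg n)).trans ?_
      change g (n + 1) • t (n + 1) ⊆ _
      rw [← hk' (n + 1)]
      exact Set.subset_iUnion (fun n => k • t n) (n + 1)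

theorem Univ.exists_omegaLimit {S M : Set C} (hS : H.IsModel S) (h : H.Univ S M) :
    ∃ M', H.OmegaLimit S M' ∧ M' ⊆ M := by
  obtain ⟨T, hT⟩ := H.exists_omegaLimit hS
  obtain ⟨g, hg, hgT⟩ := h.2 T hT.isModel hT.univ.1
  exact ⟨g • T, hg.smul_eq ▸ hT.smul g, hgT⟩

/-- The only use of `conj`, the form that categoricity takes here: some ω-limit exists, and every
model is conjugate to it. -/
theorem exists_eq_omegaLimit (H : HomogeneousSystem G C lam) {M : Set C} (hM : H.IsModel M) :
    ∃ S, H.OmegaLimit S M := by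
  obtain ⟨T, hT⟩ := H.exists_omegaLimit hM
  obtain ⟨g, rfl⟩ := H.conj hT.isModel hM
  exact ⟨_, hT.smul g⟩

theorem LocalCharacter.nat (hL : H.LocalCharacter) {t : ℕ → Set C} (hM : ∀ n, H.IsModel (t n))
    (hU : ∀ n, H.Univ (t n) (t (n + 1))) (a : C) : ∃ n, H.NoSplit (t n) (⋃ n, t n) a := by
  have : NoMaxOrder (ULift.{u} ℕ) := ⟨fun n => ⟨⟨n.down + 1⟩, Nat.lt_succ_self _⟩⟩
  obtain ⟨n, hn⟩ := hL (ι := ULift.{u} ℕ) (fun n => t n.down) (by simpa using H.aleph0_le)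
    (fun n => hM _) (fun i j h => univ_of_lt hU h) a
  refine ⟨n.down, ?_⟩
  convert hn using 1
  ext x
  simp

/-- A tail of a universal ω-chain still exhausts `M`, so the nonsplitting base supplied by local
character can be taken as the start of the chain. -/
theorem LocalCharacter.exists_omegaLimit (hL : H.LocalCharacter) {M : Set C} (hM : H.IsModel M)
    (a : C) : ∃ S, H.IsModel S ∧ H.OmegaLimit S M ∧ H.NoSplit S M a := by
  obtain ⟨S, t, rfl, h2, h3, rfl⟩ := H.exists_eq_omegaLimit hM
  obtain ⟨n, hn⟩ := hL.nat h2 h3 a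
  refine ⟨t n, h2 n, ⟨fun m => t (n + m), rfl, fun m => h2 _, fun m => h3 _, ?_⟩, hn⟩
  apply subset_antisymm
  · refine Set.iUnion_subset fun m => ?_
    exact (monotone_of_univ h3 (Nat.le_add_left m n)).trans
      (Set.subset_iUnion (fun m => t (n + m)) m)
  · exact Set.iUnion_subset fun m => Set.subset_iUnion t (n + m)

theorem NoFork.exists_extension {M₀ M N : Set C} {a : C} (hM : H.IsModel M) (hN : H.IsModel N)
    (hMN : M ⊆ N) (h : H.NoFork M₀ M a) : ∃ b, EqType G M b a ∧ H.NoFork M₀ N b := by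
  obtain ⟨h1, S, h2, h3, h4⟩ := h
  obtain ⟨b, hb, hb'⟩ := h4.exists_extension hM hN (h3.mono_right h1) hMN
  exact ⟨b, hb, h1.trans hMN, S, h2, h3, hb'⟩

/-- A universal witness and a limit witness of nonforking determine the same extension. -/
theorem LocalCharacter.eqType_of_omegaLimit (hL : H.LocalCharacter) {S₀ S₁ M N : Set C} {a b : C}
    (hM : H.IsModel M) (hN : H.IsModel N) (hS₀ : H.IsModel S₀) (hS₁ : H.IsModel S₁)
    (hMN : M ⊆ N) (hU : H.Univ S₀ M) (hl : H.OmegaLimit S₁ M) (ha : H.NoSplit S₀ N a)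
    (hb : H.NoSplit S₁ N b) (e : EqType G M b a) : EqType G N b a := by
  by_contra hne
  obtain ⟨N', hN'⟩ := H.exists_omegaLimit hN
  have hNN' : N ⊆ N' := hN'.univ.1
  have hMN' : M ⊆ N' := hMN.trans hNN'
  have hN'M : H.IsModel N' := hN'.isModel
  have hlim : H.OmegaLimit M N' := hN'.mono_left hM hMN
  obtain ⟨a', ea, ha'⟩ := ha.exists_extension hN hN'M (hU.mono_right hMN) hNN'
  obtain ⟨b', eb, hb'⟩ := hb.exists_extension hN hN'M (hl.univ.mono_right hMN) hNN'
  have hne' : ¬ EqType G N' b' a' := fun h => hne (eb.symm.trans ((h.mono hNN').trans ea))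
  have eaM : EqType G M a' a := ea.mono hMN
  have ebM : EqType G M b' a := (eb.mono hMN).trans e
  -- By weak uniqueness at most one of `a'` and `b'` does not split over `Y` on `N'`. The one that
  -- splits is put, by means of its own nonsplitting witness, on a conjugate of the pair `(M, a)`
  -- whose model is universal over `M`.
  have key : ∀ Y, H.Univ Y M → ∃ X' x', H.Univ M X' ∧ (∃ g : G, g • M = X' ∧ g • a = x') ∧
      EqType G M x' a ∧ ¬ H.NoSplit Y X' x' := by
    intro Y hY
    by_cases hYb : H.NoSplit Y N' b'
    · have hYa : ¬ H.NoSplit Y N' a' := fun h =>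
        hne' (hYb.eqType hN'M hY hMN' h (ebM.trans eaM.symm))
      -- Only a submodel `M'` of `M` is known to be an ω-limit over `S₀`. It is conjugate to `N'`
      -- over `S₀`, and nonsplitting of `a'` replaces the conjugation by one fixing `a'`; the image
      -- of all of `M` then contains `N'`.
      obtain ⟨M', hM', hM'M⟩ := hU.exists_omegaLimit hS₀
      obtain ⟨g, hg, rfl⟩ := hM'.exists_conj (hlim.mono_left hS₀ hU.1)
      obtain ⟨g', hg', hga⟩ := ha' M' hM'.isModel hM'.univ.1 (hM'M.trans hMN') g hg subset_rfl
      obtain ⟨k, hk, rfl⟩ := eaM.symm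
      have hsub : g • M' ⊆ g' • M := by
        rw [← smul_congr hg']
        exact Set.smul_set_mono hM'M
      refine ⟨g' • M, k • a, hlim.univ.mono_right hsub, ⟨g' * k, ?_, ?_⟩, eaM, fun h => hYa ?_⟩
      · rw [mul_smul, hk.smul_eq]
      · rw [mul_smul, hga]
      · exact h.mono subset_rfl hsub
    -- Here `M` and `N'` are both ω-limits over `S₁`, so they are conjugate, and nonsplitting of
    -- `b'` makes the conjugation fix `b'`.
    · obtain ⟨g, hg, rfl⟩ := hl.exists_conj (hlim.mono_left hS₁ hl.univ.1)
      obtain ⟨g', hg', hgb⟩ := hb' M hM hl.univ.1 hMN' g hg subset_rfl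
      obtain ⟨k, hk, rfl⟩ := ebM.symm
      refine ⟨g • M, k • a, hlim.univ, ⟨g' * k, ?_, ?_⟩, ebM, hYb⟩
      · rw [mul_smul, hk.smul_eq, smul_congr hg']
      · rw [mul_smul, hgb]
  -- The same step, conjugated so that the element is always `a` itself; in this form it can be
  -- iterated.
  have key' : ∀ p : Set C × Set C, (H.Univ p.1 p.2 ∧ ∃ k : G, k • M = p.2 ∧ k • a = a) →
      ∃ X', (H.Univ p.2 X' ∧ ∃ k : G, k • M = X' ∧ k • a = a) ∧ ¬ H.NoSplit p.1 X' a := by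
    rintro ⟨Y, X⟩ ⟨hY, k, rfl, hka⟩
    have hY' : H.Univ (k⁻¹ • Y) M := by simpa using hY.smul k⁻¹
    obtain ⟨X', x', h1, ⟨g, rfl, rfl⟩, ⟨f, hf, hfe⟩, h4⟩ := key _ hY'
    refine ⟨(k * f) • g • M, ⟨?_, k * f * g, ?_, ?_⟩, fun h => h4 ?_⟩
    · have := h1.smul (k * f)
      rwa [mul_smul k f M, hf.smul_eq] at this
    · rw [mul_smul]
    · rw [mul_smul, mul_smul, hfe, hka]
    · have := h.smul (k * f)⁻¹
      rw [inv_smul_smul, mul_inv_rev, mul_smul, mul_smul, inv_smul_eq_iff.2 hka.symm,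
        (hf.inv.mono hY'.1).smul_eq, inv_smul_eq_iff.2 hfe.symm] at this
      exact this
  choose! nx hnx hsplit using key'
  let q : ℕ → Set C × Set C := fun n => n.rec (S₀, M) fun _ p => (p.2, nx p)
  have hq : ∀ n, H.Univ (q n).1 (q n).2 ∧ ∃ k : G, k • M = (q n).2 ∧ k • a = a := fun n => by
    induction n with
    | zero => exact ⟨hU, 1, one_smul _ _, one_smul _ _⟩
    | succ n ih => exact hnx _ ih
  have hqM : ∀ n, H.IsModel (q n).1 := fun n => by
    rcases n with _ | n
    · exact hS₀
    · obtain ⟨k, hk, -⟩ := (hq n).2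
      change H.IsModel (q n).2
      exact hk ▸ H.smul k hM
  obtain ⟨n, hn⟩ := hL.nat hqM (fun n => (hq n).1) a
  refine hsplit (q n) (hq n) (hn.mono subset_rfl ?_)
  -- The shift by two: splitting over the first component of `q n` occurs on `nx (q n)`, which is
  -- the first component of `q (n + 2)`.
  exact Set.subset_iUnion (fun n => (q n).1) (n + 2)

/-- Uniqueness of nonforking extensions. -/
theorem NoFork.eqType (hL : H.LocalCharacter) {M₀ N : Set C} {a b : C} (hM : H.IsModel M₀)
    (hN : H.IsModel N) (ha : H.NoFork M₀ N a) (hb : H.NoFork M₀ N b) (e : EqType G M₀ a b) :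
    EqType G N a b := by
  -- Both elements are compared with `c`, the extension determined by a limit witness for the type
  -- of `a` over `M₀`.
  obtain ⟨S, h1, h2, h3⟩ := hL.exists_omegaLimit hM a
  obtain ⟨c, hc, hc'⟩ := h3.exists_extension hM hN h2.univ ha.1
  obtain ⟨hMN, S₀, h4, h5, h6⟩ := ha
  obtain ⟨-, S₁, h4', h5', h6'⟩ := hb
  have e1 := hL.eqType_of_omegaLimit hM hN h4 h1 hMN h5 h2 h6 hc' hc
  have e2 := hL.eqType_of_omegaLimit hM hN h4' h1 hMN h5' h2 h6' hc' (hc.trans e)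
  exact e1.symm.trans e2

/-- The extension of the type of `a` over `M` to `N` that does not fork over `M₀` does not fork over
`M` either, so uniqueness over `M` identifies it with the type of `a` over `N`. -/
theorem NoFork.trans (hL : H.LocalCharacter) {M₀ M N : Set C} {a : C} (hM : H.IsModel M)
    (hN : H.IsModel N) (h1 : H.NoFork M₀ M a) (h2 : H.NoFork M N a) : H.NoFork M₀ N a := by
  obtain ⟨b, hb, hb'⟩ := h1.exists_extension hM hN h2.1
  exact hb'.of_eqType (NoFork.eqType hL hM hN (hb'.mono h1.1 h2.1 subset_rfl) h2 hb)

/-- Continuity of nonforking along chains of universal extensions. -/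
theorem NoFork.iUnion (hL : H.LocalCharacter) {ι : Type u} [LinearOrder ι] [WellFoundedLT ι]
    [Nonempty ι] [NoMaxOrder ι] (S : ι → Set C) (hι : #ι ≤ lam) (hS : ∀ i, H.IsModel (S i))
    (hU : ∀ i j, i < j → H.Univ (S i) (S j)) {M₀ : Set C} {a : C}
    (h : ∀ i, H.NoFork M₀ (S i) a) : H.NoFork M₀ (⋃ i, S i) a := by
  obtain ⟨i, hi⟩ := hL S hι hS hU a
  obtain ⟨j, hj⟩ := exists_gt i
  have hm : Monotone S := fun i j hij => by
    rcases hij.eq_or_lt with rfl | h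
    · rfl
    · exact (hU i j h).1
  exact NoFork.trans hL (hS j) (H.iUnion S hι hm hS) (h j)
    ⟨Set.subset_iUnion S j, S i, hS i, hU i j hj, hi⟩

end HomogeneousSystem

/-! ### Enlarging a family of models around independent elements -/

namespace HomogeneousSystem

variable {G : Type v} {C : Type u} [Group G] [MulAction G C] {lam : Cardinal.{u}}
variable (H : HomogeneousSystem G C lam)

/-- The requirements on the model `x.2` and the map `x.1` chosen at stage `i` when a family `N` is
enlarged while the element `b` is added to all its terms. -/
structure Stage {ι : Type u} [LinearOrder ι] (M₀ M : Set C) (N : ι → Set C) (a : ι → C)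
    (R : Set ι) (k : Option ι) (Z : Set C) (b : C) (i : ι) (f : ι → G × Set C)
    (x : G × Set C) : Prop where
  fixes : Fixes x.1 M
  isModel : H.IsModel x.2
  univ : H.Univ (x.1 • N i) x.2
  subset : Z ⊆ x.2
  mem : b ∈ x.2
  eqOn : ∀ j < i, ∀ y ∈ N j, x.1 • y = (f j).1 • y
  eq : ∀ j < i, x.1 • a j = (f j).1 • a j
  univ_prev : ∀ j < i, H.Univ (f j).2 x.2
  -- Required only up to the index of `b`: beyond it, `b` is the image of `a l` and belongs to the
  -- image of `N i`.
  noFork_base : ∀ l ∈ k, i ≤ l → H.NoFork M₀ (x.1 • N i) b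
  eq_of_mem : i ∈ k → x.1 • a i = b
  noFork : i ∈ R → i ∉ k → H.NoFork M₀ x.2 (x.1 • a i)

variable {H}

theorem Stage.congr {ι : Type u} [LinearOrder ι] {M₀ M : Set C} {N : ι → Set C} {a : ι → C}
    {R : Set ι} {k : Option ι} {Z : Set C} {b : C} {i : ι} {f g : ι → G × Set C}
    {x : G × Set C} (hfg : ∀ j < i, f j = g j) (h : H.Stage M₀ M N a R k Z b i f x) :
    H.Stage M₀ M N a R k Z b i g x :=
  ⟨h.fixes, h.isModel, h.univ, h.subset, h.mem, fun j hj => hfg j hj ▸ h.eqOn j hj,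
    fun j hj => hfg j hj ▸ h.eq j hj, fun j hj => hfg j hj ▸ h.univ_prev j hj,
    h.noFork_base, h.eq_of_mem, h.noFork⟩

/-- `b` is independent over `M₀` from some model that contains the images of all earlier terms and
elements. -/
theorem exists_base_of_stage (hL : H.LocalCharacter) (hSym : H.ElemSymmetry) {ι : Type u}
    [LinearOrder ι] [WellFoundedLT ι] (hι : #ι ≤ lam) {M₀ M : Set C}
    (hM : H.IsModel M) (hM₀M : M₀ ⊆ M) {N : ι → Set C} {a : ι → C} {R : Set ι}
    {k : Option ι} {Z : Set C} {b : C} (hN : ∀ i, H.IsModel (N i)) (hMN : ∀ i, M ⊆ N i)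
    (haN : ∀ i j, i < j → a i ∈ N j) (hR' : ∀ i ∉ R, ∀ j, a i ∈ N j)
    (hU : ∀ i j, i < j → H.Univ (N i) (N j)) (hbM : H.NoFork M₀ M b) {l : ι} (hl : l ∈ k)
    {i : ι} (hil : i ≤ l) {f : ι → G × Set C}
    (hf : ∀ j < i, H.Stage M₀ M N a R k Z b j f (f j)) {τ : G} (hτM : Fixes τ M)
    (hτ : ∀ j < i, ∀ y ∈ N j, τ • y = (f j).1 • y) (hτa : ∀ j < i, τ • a j = (f j).1 • a j) :
    ∃ Q, H.IsModel Q ∧ M ⊆ Q ∧ (∀ j < i, τ • N j ⊆ Q) ∧ (∀ j < i, τ • a j ∈ Q) ∧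
      H.NoFork M₀ Q b := by
  have hMτ : ∀ j, M ⊆ τ • N j := fun j => by
    have := Set.smul_set_mono (a := τ) (hMN j)
    rwa [hτM.smul_eq] at this
  have hN' : ∀ j < i, τ • N j = (f j).1 • N j := fun j hj => smul_congr (hτ j hj)
  have hbN : ∀ j < i, H.NoFork M₀ (τ • N j) b := fun j hj => by
    rw [hN' j hj]
    exact (hf j hj).noFork_base l hl (hj.le.trans hil)
  have hm : ∀ i j, i ≤ j → N i ⊆ N j := fun i j hij => by
    rcases hij.eq_or_lt with rfl | h
    · rfl
    · exact (hU i j h).1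
  by_cases hmax : ∃ m < i, ∀ j < i, j ≤ m
  · obtain ⟨m, hmi, hm'⟩ := hmax
    have hmk : m ∉ k := fun h => by
      obtain rfl : m = l := Option.mem_unique h hl
      exact absurd hmi (not_lt.2 hil)
    have hsub : ∀ j < i, τ • N j ⊆ τ • N m := fun j hj => Set.smul_set_mono (hm _ _ (hm' j hj))
    have hlt : ∀ j < m, τ • a j ∈ τ • N m := fun j hj => Set.smul_mem_smul_set (haN j m hj)
    by_cases hmR : m ∈ R
    · have h1 : H.NoFork (τ • N m) (f m).2 (τ • a m) := by
        rw [hτa m hmi, hN' m hmi]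
        refine ((hf m hmi).noFork hmR hmk).mono ?_ (hf m hmi).univ.1 subset_rfl
        rw [← hN' m hmi]
        exact hM₀M.trans (hMτ m)
      -- The image of `a m` is free over `τ • N m` from a model containing `b`. Symmetry reverses
      -- the roles, and transitivity moves the base of `b` from `τ • N m` down to `M₀`.
      obtain ⟨Q, hQ, haQ, hbQ⟩ := hSym _ (H.smul τ (hN m)) _ b
        ⟨_, (hf m hmi).isModel, (hf m hmi).mem, h1⟩
      refine ⟨Q, hQ, (hMτ m).trans hbQ.1, fun j hj => (hsub j hj).trans hbQ.1, fun j hj => ?_,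
        (hbN m hmi).trans hL (H.smul τ (hN m)) hQ hbQ⟩
      rcases (hm' j hj).eq_or_lt with rfl | h
      · exact haQ
      · exact hbQ.1 (hlt j h)
    · refine ⟨τ • N m, H.smul τ (hN m), hMτ m, hsub, fun j hj => ?_, hbN m hmi⟩
      rcases (hm' j hj).eq_or_lt with rfl | h
      · exact Set.smul_mem_smul_set (hR' j hmR j)
      · exact hlt j h
  · push Not at hmax
    rcases isEmpty_or_nonempty {j // j < i} with hE | hE
    · exact ⟨M, hM, subset_rfl, fun j hj => hE.elim ⟨j, hj⟩, fun j hj => hE.elim ⟨j, hj⟩, hbM⟩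
    · have : NoMaxOrder {j // j < i} := ⟨fun j => by
        obtain ⟨j', h1, h2⟩ := hmax j j.2
        exact ⟨⟨j', h1⟩, h2⟩⟩
      -- Limit index: each `a j` lies in a later term, so the union of the images contains
      -- everything required. Freeness of `b` from it is continuity, for which the terms must be
      -- universal over one another.
      let S : {j // j < i} → Set C := fun j => τ • N j
      have hS : Monotone S := fun i j h => Set.smul_set_mono (hm _ _ h)
      refine ⟨⋃ j, S j, H.iUnion S (mk_lt_subtype_le hι i) hS (fun j => H.smul τ (hN _)), ?_,
        fun j hj => Set.subset_iUnion S ⟨j, hj⟩, fun j hj => ?_,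
        NoFork.iUnion hL S (mk_lt_subtype_le hι i) (fun j => H.smul τ (hN _))
          (fun i j h => (hU i j h).smul τ) (fun j => hbN j j.2)⟩
      · obtain ⟨j⟩ := hE
        exact (hMτ j).trans (Set.subset_iUnion S j)
      · obtain ⟨j', h1, h2⟩ := hmax j hj
        exact Set.subset_iUnion S ⟨j', h1⟩ (Set.smul_mem_smul_set (haN j j' h2))

/-- The glued earlier maps `τ` are corrected twice. First `σ`, agreeing with `τ` on the earlier
models and elements, makes `b` free from the image of `N i` as long as the index of `b` has not been
passed. After `P` has been chosen universal over all data so far, `ρ` fixes the image of `N i` and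
moves the image of `a i` to its proper place. -/
theorem exists_stage (hL : H.LocalCharacter) (hSym : H.ElemSymmetry) {ι : Type u}
    [LinearOrder ι] [WellFoundedLT ι] (hι : #ι ≤ lam) {M₀ M : Set C} (hM₀ : H.IsModel M₀)
    (hM : H.IsModel M) (hM₀M : M₀ ⊆ M) {N : ι → Set C} {a : ι → C} {R : Set ι}
    {k : Option ι} {Z : Set C} (hZ : #Z ≤ lam) {b : C} (hb : ∀ l ∈ k, a l = b)
    (hN : ∀ i, H.IsModel (N i)) (hMN : ∀ i, M ⊆ N i) (hm : Monotone N)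
    (haN : ∀ i j, i < j → a i ∈ N j) (hR : ∀ i ∈ R, H.NoFork M₀ (N i) (a i))
    (hR' : ∀ i ∉ R, ∀ j, a i ∈ N j) (hkR : ∀ l ∈ k, l ∈ R)
    (hU : k.isSome → ∀ i j, i < j → H.Univ (N i) (N j))
    (i : ι) {f : ι → G × Set C} (hf : ∀ j < i, H.Stage M₀ M N a R k Z b j f (f j)) :
    ∃ x, H.Stage M₀ M N a R k Z b i f x := by
  obtain ⟨τ, hτM, hτ, hτa⟩ : ∃ τ : G, Fixes τ M ∧ (∀ j < i, ∀ y ∈ N j, τ • y = (f j).1 • y) ∧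
      ∀ j < i, τ • a j = (f j).1 • a j := by
    rcases isEmpty_or_nonempty {j // j < i} with hE | hE
    · exact ⟨1, Fixes.one M, fun j hj => hE.elim ⟨j, hj⟩, fun j hj => hE.elim ⟨j, hj⟩⟩
    · obtain ⟨τ, h1, h2⟩ := H.glue_points (fun j : {j // j < i} => N j) (fun j => a j)
        (fun j => (f j).1) (mk_lt_subtype_le hι i) (fun _ _ h => hm h) (fun j => hN j)
        (fun i j h => haN i j h) (fun i j h => (hf j j.2).eqOn i h) (fun i j h => (hf j j.2).eq i h)
      refine ⟨τ, fun x hx => ?_, fun j hj => h1 ⟨j, hj⟩, fun j hj => h2 ⟨j, hj⟩⟩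
      obtain ⟨j⟩ := hE
      rw [h1 j x (hMN j hx), (hf j j.2).fixes x hx]
  obtain ⟨σ, hσM, hσ, hσa, hσb⟩ : ∃ σ : G, Fixes σ M ∧ (∀ j < i, ∀ y ∈ N j, σ • y = τ • y) ∧
      (∀ j < i, σ • a j = τ • a j) ∧ ∀ l ∈ k, i ≤ l → H.NoFork M₀ (σ • N i) b := by
    by_cases hk : ∃ l ∈ k, i ≤ l
    · obtain ⟨l, hl, hil⟩ := hk
      have hbM : H.NoFork M₀ M b := hb l hl ▸ (hR l (hkR l hl)).mono subset_rfl hM₀M (hMN l)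
      obtain ⟨Q, hQ, hMQ, hQN, hQa, hQb⟩ := exists_base_of_stage hL hSym hι hM hM₀M hN hMN
        haN hR' (hU (Option.isSome_iff_exists.2 ⟨l, hl⟩)) hbM hl hil hf hτM hτ hτa
      obtain ⟨Q', hQ', hQQ', hQ'N⟩ := H.exists_superset₂ (H.card_le hQ)
        (H.card_le (H.smul τ (hN i)))
      -- The type of `b` over `Q` is extended to a model containing `τ • N i`. Pulling back along
      -- `ψ`, which fixes `Q`, returns the realization to `b` and moves `N i` instead.
      obtain ⟨_, ⟨ψ, hψ, rfl⟩, hψb⟩ : ∃ c, EqType G Q b c ∧ H.NoFork M₀ Q' c := by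
        obtain ⟨c, hc, hc'⟩ := hQb.exists_extension hQ hQ' hQQ'
        exact ⟨c, hc.symm, hc'⟩
      refine ⟨ψ⁻¹ * τ, (hψ.inv.mono hMQ).mul hτM, fun j hj y hy => ?_, fun j hj => ?_,
        fun l' hl' hil' => ?_⟩
      · rw [mul_smul, hψ.inv _ (hQN j hj (Set.smul_mem_smul_set hy))]
      · rw [mul_smul, hψ.inv _ (hQa j hj)]
      · have := hψb.smul ψ⁻¹
        rw [inv_smul_smul, (hψ.inv.mono (hM₀M.trans hMQ)).smul_eq] at this
        refine this.mono subset_rfl ?_ ?_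
        · have h := Set.smul_set_mono (a := ψ⁻¹ * τ) (hM₀M.trans (hMN i))
          rwa [((hψ.inv.mono (hM₀M.trans hMQ)).mul (hτM.mono hM₀M)).smul_eq] at h
        · rw [mul_smul]
          exact Set.smul_set_mono hQ'N
    · push Not at hk
      exact ⟨τ, hτM, fun _ _ _ _ => rfl, fun _ _ => rfl,
        fun l hl h => absurd h (not_le.2 (hk l hl))⟩
  have hσMN : M ⊆ σ • N i := by
    have := Set.smul_set_mono (a := σ) (hMN i)
    rwa [hσM.smul_eq] at this
  obtain ⟨W, hW, hWs⟩ := H.exists_superset_iUnion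
    (fun o : Option (Option {j // j < i}) =>
      o.elim (σ • N i) fun o => o.elim (Z ∪ {b}) fun j => (f j).2)
    (by
      rw [mk_option, mk_option]
      have h1 := one_le_aleph0.trans H.aleph0_le
      exact add_le_of_le H.aleph0_le (add_le_of_le H.aleph0_le (mk_lt_subtype_le hι i) h1) h1)
    (by
      rintro (_ | _ | j)
      · exact H.card_le (H.smul _ (hN i))
      · refine (mk_union_le _ _).trans (add_le_of_le H.aleph0_le hZ ?_)
        rw [mk_singleton]
        exact one_le_aleph0.trans H.aleph0_le
      · exact H.card_le (hf j j.2).isModel)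
  obtain ⟨P, hP, hWP⟩ := H.exists_univ hW
  have hNW : σ • N i ⊆ W := hWs none
  have hZW : Z ∪ {b} ⊆ W := hWs (some none)
  have hPW : ∀ j < i, (f j).2 ⊆ W := fun j hj => hWs (some (some ⟨j, hj⟩))
  have hσNM := H.smul σ (hN i)
  obtain ⟨ρ, hρ, hρk, hρR⟩ : ∃ ρ : G, Fixes ρ (σ • N i) ∧ (i ∈ k → ρ • σ • a i = b) ∧
      (i ∈ R → i ∉ k → H.NoFork M₀ P (ρ • σ • a i)) := by
    have hsm : ∀ i ∈ R, H.NoFork M₀ (σ • N i) (σ • a i) := fun i hi => by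
      have := (hR i hi).smul σ
      rwa [(hσM.mono hM₀M).smul_eq] at this
    by_cases hik : i ∈ k
    -- The elements `σ • a i` and `b` are conjugate over `M₀` and both free over `M₀` from `σ • N
    -- i`, so uniqueness sends one to the other.
    · obtain ⟨ρ, hρ, e⟩ := NoFork.eqType hL hM₀ hσNM (hsm i (hkR i hik)) (hσb i hik le_rfl)
        ⟨σ⁻¹, hσM.inv.mono hM₀M, by rw [inv_smul_smul, hb i hik]⟩
      exact ⟨ρ, hρ, fun _ => e, fun _ h => absurd hik h⟩
    · by_cases hiR : i ∈ R
      · obtain ⟨c, hc, hc'⟩ := (hsm i hiR).exists_extension hσNM hP (hNW.trans hWP.1)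
        obtain ⟨ρ, hρ, rfl⟩ := hc.symm
        exact ⟨ρ, hρ, fun h => absurd h hik, fun _ _ => hc'⟩
      · exact ⟨1, Fixes.one _, fun h => absurd h hik, fun h => absurd h hiR⟩
  have hρN : (ρ * σ) • N i = σ • N i := by rw [mul_smul, hρ.smul_eq]
  refine ⟨(ρ * σ, P), ⟨(hρ.mono hσMN).mul hσM, hP, ?_, ?_, ?_, fun j hj y hy => ?_, fun j hj => ?_,
    fun j hj => ?_, fun l hl h => ?_, fun h => ?_, fun h h₁ => ?_⟩⟩
  · rw [hρN]
    exact hWP.mono_left hW hNW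
  · exact (Set.subset_union_left.trans hZW).trans hWP.1
  · exact hWP.1 (hZW (Or.inr rfl))
  · rw [mul_smul, hρ _ (Set.smul_mem_smul_set (hm hj.le hy)), hσ j hj y hy, hτ j hj y hy]
  · rw [mul_smul, hρ _ (Set.smul_mem_smul_set (haN j i hj)), hσa j hj, hτa j hj]
  · exact hWP.mono_left hW (hPW j hj)
  · rw [hρN]
    exact hσb l hl h
  · rw [mul_smul]
    exact hρk h
  · rw [mul_smul]
    exact hρR h h₁

/-- Enlarging a family of models together with independent elements: the new models are universal
over the old ones and over each other, contain a conjugate of a given small set, and contain the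
element with index `k`, the other elements remaining independent. -/
theorem exists_enlarged_family (hL : H.LocalCharacter) (hSym : H.ElemSymmetry) {ι : Type u}
    [LinearOrder ι] [WellFoundedLT ι] (hι : #ι ≤ lam) {M₀ M : Set C} (hM₀ : H.IsModel M₀)
    (hM : H.IsModel M) (hM₀M : M₀ ⊆ M) {N : ι → Set C} {a : ι → C} {R : Set ι}
    (k : Option ι) {Z : Set C} (hZ : #Z ≤ lam)
    (hN : ∀ i, H.IsModel (N i)) (hMN : ∀ i, M ⊆ N i) (hm : Monotone N)
    (haN : ∀ i j, i < j → a i ∈ N j) (hR : ∀ i ∈ R, H.NoFork M₀ (N i) (a i))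
    (hR' : ∀ i ∉ R, ∀ j, a i ∈ N j) (hkR : ∀ l ∈ k, l ∈ R)
    (hU : k.isSome → ∀ i j, i < j → H.Univ (N i) (N j)) :
    ∃ (N' : ι → Set C) (σ : G), Fixes σ M ∧ (∀ i, H.IsModel (N' i)) ∧
      (∀ i, H.Univ (N i) (N' i)) ∧ (∀ i j, i < j → H.Univ (N' i) (N' j)) ∧
      (∀ i ∈ R, i ∉ k → H.NoFork M₀ (N' i) (a i)) ∧ (∀ i, σ • Z ⊆ N' i) ∧
      ∀ l ∈ k, ∀ i, a l ∈ N' i := by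
  rcases isEmpty_or_nonempty ι with hE | hE
  · exact ⟨N, 1, Fixes.one M, fun i => hE.elim i, fun i => hE.elim i, fun i => hE.elim i,
      fun i => hE.elim i, fun i => hE.elim i, fun _ _ i => hE.elim i⟩
  obtain ⟨b, hb⟩ : ∃ b, ∀ l ∈ k, a l = b := by
    rcases k with _ | l
    · exact ⟨a (Classical.arbitrary ι), by simp⟩
    · exact ⟨a l, by simp⟩
  obtain ⟨f, hf⟩ := exists_of_history (fun i f x => H.Stage M₀ M N a R k Z b i f x)
    (fun i f g x hfg h => h.congr hfg) (fun i f hf => exists_stage hL hSym hι hM₀ hM hM₀M hZ hb hN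
      hMN hm haN hR hR' hkR hU i hf)
  obtain ⟨σ, hσ, hσa⟩ := H.glue_points N a (fun i => (f i).1) hι hm hN haN
    (fun i j h => (hf j).eqOn i h) (fun i j h => (hf j).eq i h)
  have hσN : ∀ i, σ • N i = (f i).1 • N i := fun i => smul_congr (hσ i)
  have hσM : Fixes σ M := fun x hx => by
    let i : ι := Classical.arbitrary ι
    rw [hσ i x (hMN i hx), (hf i).fixes x hx]
  -- The family was moved around the fixed `b`. Undoing the common extension of the maps restores
  -- `N` and `a`; the price is that `Z` is replaced by a conjugate over `M`.
  refine ⟨fun i => σ⁻¹ • (f i).2, σ⁻¹, hσM.inv, fun i => H.smul _ (hf i).isModel, fun i => ?_,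
    fun i j h => ((hf j).univ_prev i h).smul _, fun i hi hik => ?_,
    fun i => Set.smul_set_mono (hf i).subset, fun l hl i => ?_⟩
  · have := (hf i).univ.smul σ⁻¹
    rwa [← hσN, inv_smul_smul] at this
  · have := ((hf i).noFork hi hik).smul σ⁻¹
    rwa [← hσa, inv_smul_smul, (hσM.inv.mono hM₀M).smul_eq] at this
  · rw [Set.mem_inv_smul_set_iff, hσa, (hf l).eq_of_mem hl]
    exact (hf i).mem

end HomogeneousSystem

/-! ### Independent sequences: reordering and symmetry -/

namespace HomogeneousSystem

variable {G : Type v} {C : Type u} [Group G] [MulAction G C] {lam : Cardinal.{u}}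
variable (H : HomogeneousSystem G C lam)

/-- The chain `N` of models witnesses that `a` is independent from `M` over `M₀`. -/
structure IndepChain {ι : Type u} [LinearOrder ι] (M₀ M : Set C) (a : ι → C) (N : ι → Set C) :
    Prop where
  mono : Monotone N
  isModel : ∀ i, H.IsModel (N i)
  subset : ∀ i, M ⊆ N i
  noFork : ∀ i, H.NoFork M₀ (N i) (a i)
  notMem : ∀ i, a i ∉ N i
  mem : ∀ i j, i < j → a i ∈ N j

/-- `a` is independent from `M` over `M₀`. -/
def Indep {ι : Type u} [LinearOrder ι] (M₀ M : Set C) (a : ι → C) : Prop :=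
  ∃ N, H.IndepChain M₀ M a N

variable {H}

theorem Indep.smul {ι : Type u} [LinearOrder ι] {M₀ M : Set C} {a : ι → C}
    (h : H.Indep M₀ M a) (g : G) : H.Indep (g • M₀) (g • M) (fun i => g • a i) := by
  obtain ⟨N, h⟩ := h
  exact ⟨fun i => g • N i, fun i j hij => Set.smul_set_mono (h.mono hij),
    fun i => H.smul g (h.isModel i), fun i => Set.smul_set_mono (h.subset i),
    fun i => (h.noFork i).smul g, fun i hi => h.notMem i (Set.smul_mem_smul_set_iff.1 hi),
    fun i j hij => Set.smul_mem_smul_set (h.mem i j hij)⟩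

/-- The family chosen at stage `j` when a sequence, independent in the order of `ι`, is enumerated
again in the order of `ι'`. -/
structure Reorder {ι ι' : Type u} [LinearOrder ι] [LinearOrder ι'] (H : HomogeneousSystem G C lam)
    (M₀ M : Set C) (a : ι → C) (e : ι' ≃ ι) (j : ι') (f : ι' → ι → Set C) (X : ι → Set C) :
    Prop where
  isModel : ∀ i, H.IsModel (X i)
  subset : ∀ i, M ⊆ X i
  univ : ∀ i i', i < i' → H.Univ (X i) (X i')
  noFork : ∀ i, j ≤ e.symm i → H.NoFork M₀ (X i) (a i)
  mem : ∀ i i', i < i' → a i ∈ X i'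
  mem_prev : ∀ l < j, ∀ i, a (e l) ∈ X i
  univ_prev : ∀ l < j, ∀ i, H.Univ (f l i) (X i)

theorem Reorder.congr {ι ι' : Type u} [LinearOrder ι] [LinearOrder ι'] {M₀ M : Set C} {a : ι → C}
    {e : ι' ≃ ι} {j : ι'} {f g : ι' → ι → Set C} {X : ι → Set C} (hfg : ∀ l < j, f l = g l)
    (h : H.Reorder M₀ M a e j f X) : H.Reorder M₀ M a e j g X :=
  ⟨h.isModel, h.subset, h.univ, h.noFork, h.mem, h.mem_prev,
    fun l hl => hfg l hl ▸ h.univ_prev l hl⟩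

theorem monotone_of_univ_lt {ι : Type*} [LinearOrder ι] {X : ι → Set C}
    (h : ∀ i i', i < i' → H.Univ (X i) (X i')) : Monotone X := fun i j hij => by
  rcases hij.eq_or_lt with rfl | hlt
  · rfl
  · exact (h i j hlt).1

/-- A row is an enlargement of the previous row that absorbs one more element, or of the union of
the previous rows at a limit, or of the given chain at the start. In the last two cases nothing is
absorbed and the enlargement only provides universality. The set `R` marks the elements still
independent. -/
theorem exists_reorder (hL : H.LocalCharacter) (hSym : H.ElemSymmetry) {ι ι' : Type u}
    [LinearOrder ι] [WellFoundedLT ι] [LinearOrder ι'] [WellFoundedLT ι'] (hι : #ι ≤ lam)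
    {M₀ M : Set C} (hM₀ : H.IsModel M₀) (hM : H.IsModel M) (hM₀M : M₀ ⊆ M) {a : ι → C}
    {N : ι → Set C} (hN : H.IndepChain M₀ M a N) (e : ι' ≃ ι) (j : ι') {f : ι' → ι → Set C}
    (hf : ∀ l < j, H.Reorder M₀ M a e l f (f l)) : ∃ X, H.Reorder M₀ M a e j f X := by
  have hι' : #ι' ≤ lam := (mk_congr e).trans_le hι
  obtain ⟨U, R, k, hUM, hMU, hUm, haU, hUR, hUR', hkR, hkU, hjR, haj, hfU⟩ :
      ∃ (U : ι → Set C) (R : Set ι) (k : Option ι), (∀ i, H.IsModel (U i)) ∧ (∀ i, M ⊆ U i) ∧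
        Monotone U ∧ (∀ i i', i < i' → a i ∈ U i') ∧ (∀ i ∈ R, H.NoFork M₀ (U i) (a i)) ∧
        (∀ i ∉ R, ∀ i', a i ∈ U i') ∧ (∀ l ∈ k, l ∈ R) ∧
        (k.isSome → ∀ i i', i < i' → H.Univ (U i) (U i')) ∧
        (∀ i, j ≤ e.symm i → i ∈ R ∧ i ∉ k) ∧ (∀ l < j, (∀ i, a (e l) ∈ U i) ∨ e l ∈ k) ∧
        ∀ l < j, ∀ i, f l i ⊆ U i := by
    by_cases hmax : ∃ m < j, ∀ l < j, l ≤ m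
    · obtain ⟨m, hmj, hm⟩ := hmax
      have h := hf m hmj
      refine ⟨f m, {i | m ≤ e.symm i}, some (e m), h.isModel, h.subset,
        monotone_of_univ_lt h.univ, h.mem, h.noFork, fun i hi i' => ?_, by simp,
        fun _ => h.univ, fun i hi => ⟨hmj.le.trans hi, ?_⟩, fun l hl => ?_, fun l hl i => ?_⟩
      · simpa using h.mem_prev (e.symm i) (not_le.1 hi) i'
      · rintro hi'
        obtain rfl : e m = i := by simpa using hi'
        simp only [Equiv.symm_apply_apply] at hi
        exact absurd hmj (not_lt.2 hi)
      · rcases (hm l hl).eq_or_lt with rfl | hlm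
        · exact Or.inr (by simp)
        · exact Or.inl (h.mem_prev l hlm)
      · rcases (hm l hl).eq_or_lt with rfl | hlm
        · exact subset_rfl
        · exact (h.univ_prev l hlm i).1
    · push Not at hmax
      rcases isEmpty_or_nonempty {l // l < j} with hE | hE
      · exact ⟨N, Set.univ, none, hN.isModel, hN.subset, hN.mono, hN.mem, fun i _ => hN.noFork i,
          by simp, by simp, by simp, by simp, fun l hl => hE.elim ⟨l, hl⟩,
          fun l hl => hE.elim ⟨l, hl⟩⟩
      · have : NoMaxOrder {l // l < j} := ⟨fun l => by
          obtain ⟨l', h1, h2⟩ := hmax l l.2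
          exact ⟨⟨l', h1⟩, h2⟩⟩
        have hUl : ∀ i, ∀ l l' : {l // l < j}, l < l' → H.Univ (f l i) (f l' i) :=
          fun i l l' h => (hf l' l'.2).univ_prev l h i
        have hsub : ∀ l (hl : l < j) i, f l i ⊆ ⋃ l : {l // l < j}, f l i := fun l hl i =>
          Set.subset_iUnion (fun l : {l // l < j} => f l i) ⟨l, hl⟩
        have l₀ := hE.some
        refine ⟨fun i => ⋃ l : {l // l < j}, f l i, {i | j ≤ e.symm i}, none,
          fun i => H.iUnion _ (mk_lt_subtype_le hι' j) (monotone_of_univ_lt (hUl i))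
            (fun l => (hf l l.2).isModel i), fun i => ?_, fun i i' hii' => ?_, fun i i' hii' => ?_,
          fun i hi => ?_, fun i hi i' => ?_, by simp, by simp, fun i hi => ⟨hi, by simp⟩,
          fun l hl => Or.inl fun i => ?_, hsub⟩
        · exact ((hf l₀ l₀.2).subset i).trans (hsub l₀ l₀.2 i)
        · exact Set.iUnion_mono fun l => monotone_of_univ_lt (hf l l.2).univ hii'
        · exact hsub l₀ l₀.2 _ ((hf l₀ l₀.2).mem i i' hii')
        · exact NoFork.iUnion hL (fun l : {l // l < j} => f l i) (mk_lt_subtype_le hι' j)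
            (fun l => (hf l l.2).isModel i) (hUl i)
            (fun l => (hf l l.2).noFork i (l.2.le.trans hi))
        · obtain ⟨l', h1, h2⟩ := hmax (e.symm i) (not_le.1 hi)
          have := (hf l' h1).mem_prev _ h2 i'
          rw [Equiv.apply_symm_apply] at this
          exact hsub l' h1 _ this
        · obtain ⟨l', h1, h2⟩ := hmax l hl
          exact hsub l' h1 _ ((hf l' h1).mem_prev _ h2 i)
  obtain ⟨X, -, -, hX, hUX, hXX, hXR, -, hXk⟩ := exists_enlarged_family hL hSym hι hM₀ hM hM₀M k
    (Z := ∅) (by simp) hUM hMU hUm haU hUR hUR' hkR hkU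
  refine ⟨X, hX, fun i => (hMU i).trans (hUX i).1, hXX, fun i hi => hXR i (hjR i hi).1 (hjR i hi).2,
    fun i i' h => (hUX i').1 (haU i i' h), fun l hl i => ?_,
    fun l hl i => (hUX i).mono_left (hUM i) (hfU l hl i)⟩
  rcases haj l hl with h | h
  · exact (hUX i).1 (h i)
  · exact hXk _ h i

/-- Independence does not depend on the enumeration. -/
theorem Indep.reorder (hL : H.LocalCharacter) (hSym : H.ElemSymmetry) {ι ι' : Type u}
    [LinearOrder ι] [WellFoundedLT ι] [LinearOrder ι'] [WellFoundedLT ι'] (hι : #ι ≤ lam)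
    {M₀ M : Set C} (hM₀ : H.IsModel M₀) (hM : H.IsModel M) (hM₀M : M₀ ⊆ M) {a : ι → C}
    (h : H.Indep M₀ M a) (e : ι' ≃ ι) : H.Indep M₀ M (fun j => a (e j)) := by
  obtain ⟨N, hN⟩ := h
  rcases isEmpty_or_nonempty ι with hE | hE
  · have := e.isEmpty
    exact ⟨fun _ => M, fun _ _ _ => subset_rfl, fun _ => hM, fun _ => subset_rfl,
      fun i => isEmptyElim i, fun i => isEmptyElim i, fun i => isEmptyElim i⟩
  obtain ⟨f, hf⟩ := exists_of_history (fun j f X => H.Reorder M₀ M a e j f X)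
    (fun i f g x hfg h => h.congr hfg)
    (fun j f hf => exists_reorder hL hSym hι hM₀ hM hM₀M hN e j hf)
  obtain ⟨i₀, hi₀⟩ : ∃ i₀ : ι, ∀ i, i₀ ≤ i :=
    ⟨wellFounded_lt.min Set.univ Set.univ_nonempty,
      fun i => not_lt.1 (wellFounded_lt.not_lt_min _ (Set.mem_univ i))⟩
  -- The first column works: `a (e j)` is free from the entry of row `j` at index `e j`, which
  -- contains the entry at the least index `i₀`, and the elements enumerated before are in every
  -- entry of the row.
  refine ⟨fun j => f j i₀, monotone_of_univ_lt fun l j hl => (hf j).univ_prev l hl i₀,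
    fun j => (hf j).isModel i₀, fun j => (hf j).subset i₀, fun j => ?_, fun j => ?_,
    fun l j hl => (hf j).mem_prev l hl i₀⟩
  all_goals
    have h1 : H.NoFork M₀ (f j i₀) (a (e j)) :=
      ((hf j).noFork (e j) (by simp)).mono subset_rfl (hM₀M.trans ((hf j).subset i₀))
        (monotone_of_univ_lt (hf j).univ (hi₀ _))
  · exact h1
  · exact h1.notMem ((hf j).isModel i₀) fun h => hN.notMem (e j) (hN.subset _ (hM₀M h))

/-- Symmetry for independent sequences. -/
theorem Indep.symmetry (hL : H.LocalCharacter) (hSym : H.ElemSymmetry) {ι₁ ι₂ : Type u}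
    [LinearOrder ι₁] [WellFoundedLT ι₁] [LinearOrder ι₂] [WellFoundedLT ι₂] (hι₁ : #ι₁ ≤ lam)
    (hι₂ : #ι₂ ≤ lam) {M₀ M₂ : Set C} (hM₀ : H.IsModel M₀) (hM₂ : H.IsModel M₂) (hM₀M₂ : M₀ ⊆ M₂)
    {a₁ : ι₁ → C} {a₂ : ι₂ → C} (h₁ : H.Indep M₀ M₂ a₁) (ha₂ : ∀ i, a₂ i ∈ M₂)
    (h₂ : H.Indep M₀ M₀ a₂) :
    ∃ M₁, H.IsModel M₁ ∧ M₀ ⊆ M₁ ∧ (∀ i, a₁ i ∈ M₁) ∧ H.Indep M₀ M₁ a₂ := by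
  obtain ⟨N, hN⟩ := h₁
  obtain ⟨D, hD⟩ := h₂
  obtain ⟨Z, hZ, hDZ⟩ := H.exists_superset_iUnion D hι₂ (fun i => H.card_le (hD.isModel i))
  -- The chain for `a₁` is enlarged to contain a copy of the chain for `a₂`. The copy is taken over
  -- `M₂`, so `a₂` itself is not moved, and the two chains can be concatenated.
  obtain ⟨N', σ, hσ, hN'M, hNN', hN'N', hN'a, hZN', -⟩ :=
    exists_enlarged_family hL hSym hι₁ hM₀ hM₂ hM₀M₂ (R := Set.univ) none (H.card_le hZ)
      hN.isModel hN.subset hN.mono hN.mem (fun i _ => hN.noFork i) (by simp) (by simp) (by simp)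
  have hσa : ∀ i, σ • a₂ i = a₂ i := fun i => hσ _ (ha₂ i)
  have hσM₀ : σ • M₀ = M₀ := (hσ.mono hM₀M₂).smul_eq
  have hDN' : ∀ i j, σ • D i ⊆ N' j := fun i j =>
    (Set.smul_set_mono (hDZ i)).trans (hZN' j)
  have hc : H.Indep M₀ M₀ (fun i : ι₂ ⊕ₗ ι₁ => Sum.elim a₂ a₁ (ofLex i)) := by
    refine ⟨fun i => Sum.elim (fun i => σ • D i) N' (ofLex i), ?_, ?_, ?_, ?_, ?_, ?_⟩
    · rintro (i | i) (j | j) h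
      · exact Set.smul_set_mono (hD.mono (Sum.Lex.inl_le_inl_iff.1 h))
      · exact hDN' i j
      · exact absurd h Sum.Lex.not_inr_le_inl
      · exact monotone_of_univ_lt hN'N' (Sum.Lex.inr_le_inr_iff.1 h)
    · rintro (i | i)
      · exact H.smul σ (hD.isModel i)
      · exact hN'M i
    · rintro (i | i)
      · have := Set.smul_set_mono (a := σ) (hD.subset i)
        rwa [hσM₀] at this
      · exact hM₀M₂.trans ((hN.subset i).trans (hNN' i).1)
    · rintro (i | i)
      · have := (hD.noFork i).smul σ
        rwa [hσM₀, hσa] at this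
      · exact hN'a i (Set.mem_univ i) (by simp)
    · rintro (i | i)
      · intro h
        change a₂ i ∈ σ • D i at h
        rw [← hσa i, Set.smul_mem_smul_set_iff] at h
        exact hD.notMem i h
      · exact (hN'a i (Set.mem_univ i) (by simp)).notMem (hN'M i)
          fun h => hN.notMem i (hN.subset i (hM₀M₂ h))
    · rintro (i | i) (j | j) h
      · change a₂ i ∈ σ • D j
        rw [← hσa i, Set.smul_mem_smul_set_iff]
        exact hD.mem i j (Sum.Lex.inl_lt_inl_iff.1 h)
      · exact (hNN' j).1 (hN.subset j (ha₂ i))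
      · exact absurd h.le Sum.Lex.not_inr_le_inl
      · exact (hNN' j).1 (hN.mem i j (Sum.Lex.inr_lt_inr_iff.1 h))
  have hcard : #(ι₂ ⊕ₗ ι₁) ≤ lam := by
    change #(ι₂ ⊕ ι₁) ≤ lam
    rw [mk_sum, lift_id, lift_id]
    exact add_le_of_le H.aleph0_le hι₂ hι₁
  let e : ι₁ ⊕ₗ ι₂ ≃ ι₂ ⊕ₗ ι₁ := ofLex.trans ((Equiv.sumComm ι₁ ι₂).trans toLex)
  have wf₁ : WellFoundedLT (ι₁ ⊕ₗ ι₂) := ⟨Sum.lex_wf wellFounded_lt wellFounded_lt⟩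
  have wf₂ : WellFoundedLT (ι₂ ⊕ₗ ι₁) := ⟨Sum.lex_wf wellFounded_lt wellFounded_lt⟩
  obtain ⟨E, hE⟩ := hc.reorder hL hSym hcard hM₀ hM₀ subset_rfl e
  have hEr : ∀ M₁, (∀ i : ι₂, M₁ ⊆ E (toLex (Sum.inr i))) → H.Indep M₀ M₁ a₂ := fun M₁ h =>
    ⟨fun i => E (toLex (Sum.inr i)), fun i j hij => hE.mono (Sum.Lex.inr_le_inr_iff.2 hij),
      fun i => hE.isModel _, h, fun i => hE.noFork (toLex (Sum.inr i)),
      fun i => hE.notMem (toLex (Sum.inr i)),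
      fun i j hij => hE.mem (toLex (Sum.inr i)) _ (Sum.Lex.inr_lt_inr_iff.2 hij)⟩
  -- With `a₂` empty the reordered chain has no term after `a₁`, and any model containing `M₀` and
  -- `a₁` serves.
  rcases isEmpty_or_nonempty ι₂ with hI | hI
  · obtain ⟨M₁, h1, h2, h3⟩ := H.exists_superset₂ (H.card_le hM₀) (mk_range_le.trans hι₁ :
      #(Set.range a₁) ≤ lam)
    exact ⟨M₁, h1, h2, fun i => h3 ⟨i, rfl⟩, hEr _ fun i => hI.elim i⟩
  · obtain ⟨i₀, hi₀⟩ : ∃ i₀ : ι₂, ∀ i, i₀ ≤ i :=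
      ⟨wellFounded_lt.min Set.univ Set.univ_nonempty,
        fun i => not_lt.1 (wellFounded_lt.not_lt_min _ (Set.mem_univ i))⟩
    exact ⟨E (toLex (Sum.inr i₀)), hE.isModel _, hE.subset _,
      fun i => hE.mem (toLex (Sum.inl i)) _ (Sum.Lex.inl_lt_inr _ _),
      hEr _ fun i => hE.mono (Sum.Lex.inr_le_inr_iff.2 (hi₀ i))⟩

end HomogeneousSystem

/-! ### Embeddings, unions and direct limits in an abstract elementary class -/

open FirstOrder.Language (Substructure)

namespace AbstractClass

variable {L : FirstOrder.Language.{u, u}} {K : AbstractClass L}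
variable {M N P : Type u} [L.Structure M] [L.Structure N] [L.Structure P]

namespace Emb

theorem injective (f : K.Emb M N) : Function.Injective f := f.toEmb.injective

theorem mem_right (f : K.Emb M N) : K.Mem N := (K.mem_of_strong f.strong).2

theorem mem_left (f : K.Emb M N) : K.Mem M :=
  K.mem_iso f.toEmb.equivRange.symm (K.mem_of_strong f.strong).1

@[ext]
theorem ext {f g : K.Emb M N} (h : ∀ x, f x = g x) : f = g := by
  obtain ⟨f, _⟩ := f
  obtain ⟨g, _⟩ := g
  congr
  exact DFunLike.ext _ _ h

@[simp]
theorem comp_apply (g : K.Emb N P) (f : K.Emb M N) (x : M) : g.comp f x = g (f x) := rfl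

/-- The identity embedding. -/
def id (hM : K.Mem M) : K.Emb M M := ofEquiv hM (FirstOrder.Language.Equiv.refl L M)

theorem mk_range (f : K.Emb M N) : #f.toEmb.toHom.range = #M :=
  (mk_congr f.toEmb.equivRange.toEquiv).symm

theorem mk_image (f : K.Emb M N) (S : L.Substructure M) : #(f.image S) = #S :=
  mk_image_eq (s := (S : Set M)) f.injective

end Emb

/-- The image of `S ≤_K N` under an arbitrary embedding is `≤_K` the image of `N`. -/
theorem LE_map_range (f : N ↪[L] P) {S : L.Substructure N} (hS : K.Strong S) :
    K.LE (S.map f.toHom) f.toHom.range := by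
  refine ⟨FirstOrder.Language.Hom.map_le_range, ?_⟩
  convert K.strong_iso f.equivRange hS using 1
  ext x
  simp only [Substructure.mem_comap, Substructure.mem_map]
  constructor
  · rintro ⟨y, hy, hxy⟩
    exact ⟨y, hy, Subtype.ext hxy⟩
  · rintro ⟨y, hy, hxy⟩
    exact ⟨y, hy, congrArg Subtype.val hxy⟩

end AbstractClass

namespace AEC

variable {L : FirstOrder.Language.{u, u}} {K : AEC L}
variable {M N P : Type u} [L.Structure M] [L.Structure N] [L.Structure P]

open AbstractClass

/-- A `K`-embedding `f` whose image is contained in that of `g` factors through `g`. -/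
theorem exists_lift (g : K.Emb N P) (f : K.Emb M P) (h : ∀ x, ∃ y, g y = f x) :
    ∃ k : K.Emb M N, ∀ x, g (k x) = f x := by
  have hle : f.toEmb.toHom.range ≤ g.toEmb.toHom.range := by
    rintro _ ⟨x, rfl⟩
    exact h x
  have hLE := K.coherence hle f.strong g.strong
  let k : M ↪[L] N := g.toEmb.equivRange.symm.toEmbedding.comp
    ((Substructure.inclusion hle).comp f.toEmb.equivRange.toEmbedding)
  have hk : ∀ x, g (k x) = f x := fun x => by
    have : g.toEmb.equivRange (k x) = Substructure.inclusion hle (f.toEmb.equivRange x) :=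
      g.toEmb.equivRange.apply_symm_apply _
    exact congrArg Subtype.val this
  refine ⟨⟨k, ?_⟩, hk⟩
  convert K.strong_iso g.toEmb.equivRange.symm hLE.2 using 1
  ext y
  simp only [Substructure.mem_map]
  constructor
  · rintro ⟨x, rfl⟩
    refine ⟨g.toEmb.equivRange (k x), ⟨x, (hk x).symm⟩, ?_⟩
    exact g.toEmb.equivRange.symm_apply_apply _
  · rintro ⟨z, ⟨x, hx⟩, rfl⟩
    refine ⟨x, g.injective ((hk x).trans ?_)⟩
    change f x = (g.toEmb.equivRange (g.toEmb.equivRange.symm z) : P)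
    rw [FirstOrder.Language.Equiv.apply_symm_apply]
    exact hx

theorem LS_spec : L.card + ℵ₀ ≤ K.LS ∧ ∀ (N : Type u) [L.Structure N], K.Mem N →
    ∀ A : Set N, ∃ S : L.Substructure N, K.Strong S ∧ A ⊆ S ∧ #S ≤ #A + K.LS :=
  csInf_mem (s := {κ : Cardinal.{u} | L.card + ℵ₀ ≤ κ ∧ ∀ (N : Type u) [L.Structure N], K.Mem N →
    ∀ A : Set N, ∃ S : L.Substructure N, K.Strong S ∧ A ⊆ S ∧ #S ≤ #A + κ}) K.lst

variable {lam : Cardinal.{u}}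

theorem aleph0_le_of_LS_le (h : K.LS ≤ lam) : ℵ₀ ≤ lam :=
  (le_add_self.trans LS_spec.1).trans h

theorem exists_strong_le (h : K.LS ≤ lam) (hN : K.Mem N) (A : Set N) (hA : #A ≤ lam) :
    ∃ S : L.Substructure N, K.Strong S ∧ A ⊆ S ∧ #S ≤ lam := by
  obtain ⟨S, h1, h2, h3⟩ := LS_spec.2 N hN A
  exact ⟨S, h1, h2, h3.trans (add_le_of_le (aleph0_le_of_LS_le h) hA h)⟩

theorem exists_strong (h : K.LS ≤ lam) (hN : K.Mem N) (hlam : lam ≤ #N) (A : Set N)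
    (hA : #A ≤ lam) : ∃ S : L.Substructure N, K.Strong S ∧ A ⊆ S ∧ #S = lam := by
  obtain ⟨B, hB⟩ := le_mk_iff_exists_set.1 hlam
  obtain ⟨S, h1, h2, h3⟩ := exists_strong_le h hN (A ∪ B)
    ((mk_union_le _ _).trans (add_le_of_le (aleph0_le_of_LS_le h) hA hB.le))
  refine ⟨S, h1, Set.subset_union_left.trans h2, le_antisymm h3 ?_⟩
  rw [← hB]
  exact mk_le_mk_of_subset (Set.subset_union_right.trans h2)

/-- The union of a chain of strong substructures is strong. -/
theorem strong_iSup {ι : Type*} [LinearOrder ι] [Nonempty ι] {S : ι → L.Substructure N}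
    (hS : Monotone S) (hst : ∀ i, K.Strong (S i)) : K.Strong (⨆ i, S i) := by
  have := K.union_strong (Set.range S) (Set.range_nonempty S) (by
    rintro _ ⟨i, rfl⟩ _ ⟨j, rfl⟩
    exact ⟨_, ⟨max i j, rfl⟩, K.coherence (hS (le_max_left i j)) (hst _) (hst _),
      K.coherence (hS (le_max_right i j)) (hst _) (hst _)⟩) (by
    rintro _ ⟨i, rfl⟩
    exact hst i)
  rwa [sSup_range] at this

theorem mem_iSup {ι : Type*} [LinearOrder ι] [Nonempty ι] {S : ι → L.Substructure N}
    (hS : Monotone S) {x : N} : x ∈ ⨆ i, S i ↔ ∃ i, x ∈ S i :=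
  Substructure.mem_iSup_of_directed hS.directed_le

theorem coe_iSup {ι : Type*} [LinearOrder ι] [Nonempty ι] {S : ι → L.Substructure N}
    (hS : Monotone S) : ((⨆ i, S i : L.Substructure N) : Set N) = ⋃ i, (S i : Set N) := by
  ext x
  simpa using mem_iSup hS

theorem mk_iSup_le {ι : Type u} [LinearOrder ι] [Nonempty ι] {S : ι → L.Substructure N}
    (hS : Monotone S) (hlam : ℵ₀ ≤ lam) (hι : #ι ≤ lam) (hc : ∀ i, #(S i) ≤ lam) :
    #(⨆ i, S i : L.Substructure N) ≤ lam := by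
  have h : #((⨆ i, S i : L.Substructure N) : Set N) ≤ lam := by
    rw [coe_iSup hS]
    refine (mk_iUnion_le _).trans ?_
    calc #ι * ⨆ i, #(S i) ≤ lam * lam := mul_le_mul' hι (ciSup_le' hc)
      _ = lam := mul_eq_self hlam
  exact h

/-- A coherent chain of `K`-embeddings of strong substructures has a union. -/
theorem exists_emb_iSup {ι : Type u} [LinearOrder ι] [Nonempty ι] {S : ι → L.Substructure N}
    (hS : Monotone S) (φ : ∀ i, K.Emb (S i) P)
    (hφ : ∀ i j (h : i ≤ j) (x : S i), φ j ⟨x, hS h x.2⟩ = φ i x) :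
    ∃ ψ : K.Emb (⨆ i, S i : L.Substructure N) P,
      ∀ i x (hx : x ∈ S i) (hx' : x ∈ ⨆ i, S i), ψ ⟨x, hx'⟩ = φ i ⟨x, hx⟩ := by
  let S' : ι →o L.Substructure N := ⟨S, hS⟩
  let k := FirstOrder.Language.DirectLimit.lift L ι (fun i => S' i)
    (fun i j h => Substructure.inclusion (S'.monotone h)) (fun i => (φ i).toEmb)
    (fun i j h x => hφ i j h x)
  let ψ := k.comp (FirstOrder.Language.DirectLimit.Equiv_iSup S').symm.toEmbedding
  have hψ : ∀ i x (hx : x ∈ S i) (hx' : x ∈ ⨆ i, S i), ψ ⟨x, hx'⟩ = φ i ⟨x, hx⟩ := by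
    intro i x hx hx'
    have h1 : (FirstOrder.Language.DirectLimit.Equiv_iSup S').symm ⟨x, hx'⟩ =
        FirstOrder.Language.DirectLimit.of L ι (fun i => S' i)
          (fun _ _ h => Substructure.inclusion (S'.monotone h)) i ⟨x, hx⟩ :=
      FirstOrder.Language.DirectLimit.Equiv_isup_symm_inclusion_apply S' (i := i) ⟨x, hx⟩
    change k ((FirstOrder.Language.DirectLimit.Equiv_iSup S').symm ⟨x, hx'⟩) = _
    rw [h1]
    exact FirstOrder.Language.DirectLimit.lift_of _ _ _
  refine ⟨⟨ψ, ?_⟩, hψ⟩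
  have hr : ψ.toHom.range = ⨆ i, (φ i).toEmb.toHom.range := by
    have hm : Monotone fun i => (φ i).toEmb.toHom.range := by
      rintro i j h _ ⟨x, rfl⟩
      exact ⟨_, hφ i j h x⟩
    ext y
    rw [mem_iSup hm]
    constructor
    · rintro ⟨⟨x, hx⟩, rfl⟩
      obtain ⟨i, hi⟩ := (mem_iSup hS).1 hx
      exact ⟨i, ⟨x, hi⟩, (hψ i x hi hx).symm⟩
    · rintro ⟨i, ⟨x, hx⟩, rfl⟩
      exact ⟨⟨x, (mem_iSup hS).2 ⟨i, hx⟩⟩, hψ i x hx _⟩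
  rw [hr]
  refine strong_iSup ?_ fun i => (φ i).strong
  rintro i j h _ ⟨x, rfl⟩
  exact ⟨_, hφ i j h x⟩

/-- Direct limits of chains of `K`-embeddings. -/
theorem exists_directLimit {ι : Type u} [LinearOrder ι] [Nonempty ι] (A : ι → Type u)
    [∀ i, L.Structure (A i)] (f : ∀ i j, i ≤ j → K.Emb (A i) (A j))
    (hid : ∀ i x, f i i le_rfl x = x)
    (hcomp : ∀ i j k (hij : i ≤ j) (hjk : j ≤ k) x,
      f j k hjk (f i j hij x) = f i k (hij.trans hjk) x) :
    ∃ (D : Type u) (_ : L.Structure D) (g : ∀ i, K.Emb (A i) D),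
      (∀ i j h x, g j (f i j h x) = g i x) ∧ ∀ d, ∃ i x, g i x = d := by
  let f' : ∀ i j, i ≤ j → A i ↪[L] A j := fun i j h => (f i j h).toEmb
  have hds : DirectedSystem A fun i j h => f' i j h :=
    ⟨fun i x => hid i x, fun k j i hij hjk x => hcomp i j k _ _ x⟩
  let D := FirstOrder.Language.DirectLimit A f'
  let g : ∀ i, A i ↪[L] D := fun i => FirstOrder.Language.DirectLimit.of L ι A f' i
  have hg : ∀ i j h x, g j (f' i j h x) = g i x := fun i j h x =>
    FirstOrder.Language.DirectLimit.of_f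
  have hsurj : ∀ d : D, ∃ i x, g i x = d := fun d =>
    FirstOrder.Language.DirectLimit.exists_of d
  have hLE : ∀ i j, i ≤ j → K.LE (g i).toHom.range (g j).toHom.range := by
    intro i j h
    have := LE_map_range (g j) (f i j h).strong
    convert this using 1
    ext y
    constructor
    · rintro ⟨x, rfl⟩
      exact ⟨f i j h x, ⟨x, rfl⟩, hg i j h x⟩
    · rintro ⟨_, ⟨x, rfl⟩, rfl⟩
      exact ⟨x, (hg i j h x).symm⟩
  have := K.union_mem (Set.range fun i => (g i).toHom.range) (Set.range_nonempty _) (by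
      rintro _ ⟨i, rfl⟩
      exact K.mem_iso (g i).equivRange (f i i le_rfl).mem_left) (by
      rintro _ ⟨i, rfl⟩ _ ⟨j, rfl⟩
      exact ⟨_, ⟨max i j, rfl⟩, hLE i _ (le_max_left i j), hLE j _ (le_max_right i j)⟩) (by
      intro d
      obtain ⟨i, x, rfl⟩ := hsurj d
      exact ⟨_, ⟨i, rfl⟩, x, rfl⟩)
  exact ⟨D, inferInstance, fun i => ⟨g i, this.2 _ ⟨i, rfl⟩⟩, hg, hsurj⟩

end AEC

/-! ### Orbital types and amalgamation -/

namespace AbstractClass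

variable {L : FirstOrder.Language.{u, u}} {K : AbstractClass L}
variable {M N P : Type u} [L.Structure M] [L.Structure N] [L.Structure P]

/-- A type does not depend on the ambient model: `g` and the identity already give an amalgam. -/
theorem tpEmb_comp {ι : Type v} (g : K.Emb N P) (f : K.Emb M N) (b : ι → N) :
    tpEmb (g.comp f) (fun i => g (b i)) = tpEmb f b :=
  Quot.sound ⟨P, _, Emb.id g.mem_right, g, fun _ => rfl, fun _ => rfl⟩

theorem pull_tpEmb {ι : Type v} (f : K.Emb N P) (h : K.Emb M N) (b : ι → P) :
    (tpEmb f b).pull h = tpEmb (f.comp h) b := rfl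

end AbstractClass

namespace AEC

variable {L : FirstOrder.Language.{u, u}} {K : AEC L}
variable {M N P : Type u} [L.Structure M] [L.Structure N] [L.Structure P] {lam : Cardinal.{u}}

open AbstractClass

theorem mk_range_le_of_lift_le {ι : Type v} (hι : Cardinal.lift.{u} #ι ≤ Cardinal.lift.{v} lam)
    (b : ι → N) : #(Set.range b) ≤ lam :=
  lift_le.1 (mk_range_le_lift.trans hι)

/-- Every realization is already realized in a strong substructure of cardinality `lam`. -/
theorem exists_strong_realization (hLS : K.LS ≤ lam) (hM : #M = lam) {ι : Type v}
    (hι : Cardinal.lift.{u} #ι ≤ Cardinal.lift.{v} lam) (f : K.Emb M N) (b : ι → N) :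
    ∃ S : L.Substructure N, K.Strong S ∧ #S = lam ∧ (∀ m, f m ∈ S) ∧ ∀ i, b i ∈ S := by
  obtain ⟨S, h1, h2, h3⟩ := exists_strong hLS f.mem_right (hM ▸ mk_le_of_injective f.injective)
    (Set.range f ∪ Set.range b) ((mk_union_le _ _).trans (add_le_of_le (aleph0_le_of_LS_le hLS)
      (mk_range_le.trans hM.le) (mk_range_le_of_lift_le hι b)))
  exact ⟨S, h1, h3, fun m => h2 (Or.inl ⟨m, rfl⟩), fun i => h2 (Or.inr ⟨i, rfl⟩)⟩

theorem exists_tpEmb_eq (hLS : K.LS ≤ lam) (hM : #M = lam) {ι : Type v}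
    (hι : Cardinal.lift.{u} #ι ≤ Cardinal.lift.{v} lam) (p : K.GType M ι) :
    ∃ (N : Type u) (_ : L.Structure N) (f : K.Emb M N) (b : ι → N), #N = lam ∧ tpEmb f b = p := by
  induction p using Quot.ind with
  | mk x =>
    obtain ⟨S, h1, h2, h3, h4⟩ := exists_strong_realization hLS hM hι x.emb x.b
    obtain ⟨f, hf⟩ := exists_lift (Emb.incl h1) x.emb fun m => ⟨⟨_, h3 m⟩, rfl⟩
    refine ⟨S, inferInstance, f, fun i => ⟨x.b i, h4 i⟩, h2, ?_⟩
    rw [← tpEmb_comp (Emb.incl h1)]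
    have : (Emb.incl h1).comp f = x.emb := Emb.ext hf
    rw [this]
    rfl

/-- If two sequences from models of cardinality `lam` have the same type, this is witnessed by a
single amalgam of cardinality `lam`. -/
theorem exists_amalgam_of_tpEmb_eq (hLS : K.LS ≤ lam) (hAP : K.Amalgamation lam) (hM : #M = lam)
    (hN : #N = lam) (hP : #P = lam) {ι : Type v}
    (hι : Cardinal.lift.{u} #ι ≤ Cardinal.lift.{v} lam) {f : K.Emb M N} {g : K.Emb M P}
    {b : ι → N} {c : ι → P} (h : tpEmb f b = tpEmb g c) :
    ∃ (Q : Type u) (_ : L.Structure Q) (u : K.Emb N Q) (v : K.Emb P Q), #Q = lam ∧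
      (∀ m, u (f m) = v (g m)) ∧ ∀ i, u (b i) = v (c i) := by
  -- Realizations may have any cardinality while amalgamation holds only in `lam`. The relation
  -- therefore speaks of all strong submodels of cardinality `lam` containing the data, and in this
  -- form it is transitive.
  let R : K.Realization M ι → K.Realization M ι → Prop := fun x y =>
    ∀ (S : L.Substructure x.N) (T : L.Substructure y.N), K.Strong S → K.Strong T → #S = lam →
      #T = lam → ∀ (h1 : ∀ m, x.emb m ∈ S) (h2 : ∀ m, y.emb m ∈ T) (h3 : ∀ i, x.b i ∈ S)
      (h4 : ∀ i, y.b i ∈ T), ∃ (Q : Type u) (_ : L.Structure Q) (u : K.Emb S Q) (v : K.Emb T Q),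
        #Q = lam ∧ (∀ m, u ⟨_, h1 m⟩ = v ⟨_, h2 m⟩) ∧ ∀ i, u ⟨_, h3 i⟩ = v ⟨_, h4 i⟩
  have hrel : ∀ x y, K.EAt x y → R x y := by
    rintro x y ⟨P, _, f, g, hfg, hb⟩ S T hS hT hSc hTc h1 h2 h3 h4
    let f' := f.comp (Emb.incl hS)
    let g' := g.comp (Emb.incl hT)
    obtain ⟨Q, hQ, hQs, hQc⟩ := exists_strong hLS f.mem_right
      (hSc ▸ mk_le_of_injective f'.injective) (Set.range f' ∪ Set.range g')
      ((mk_union_le _ _).trans (add_le_of_le (aleph0_le_of_LS_le hLS)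
        (mk_range_le.trans hSc.le) (mk_range_le.trans hTc.le)))
    obtain ⟨u, hu⟩ := exists_lift (Emb.incl hQ) f' fun x => ⟨⟨_, hQs (Or.inl ⟨x, rfl⟩)⟩, rfl⟩
    obtain ⟨v, hv⟩ := exists_lift (Emb.incl hQ) g' fun x => ⟨⟨_, hQs (Or.inr ⟨x, rfl⟩)⟩, rfl⟩
    refine ⟨Q, inferInstance, u, v, hQc, fun m => ?_, fun i => ?_⟩
    · exact (Emb.incl hQ).injective ((hu ⟨_, h1 m⟩).trans ((hfg m).trans (hv ⟨_, h2 m⟩).symm))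
    · exact (Emb.incl hQ).injective ((hu ⟨_, h3 i⟩).trans ((hb i).trans (hv ⟨_, h4 i⟩).symm))
  have hR : ∀ x y, Relation.EqvGen K.EAt x y → R x y := by
    intro x y hxy
    induction hxy with
    | rel x y h => exact hrel x y h
    | refl x => exact hrel x x ⟨x.N, _, Emb.id x.emb.mem_right, Emb.id x.emb.mem_right,
        fun _ => rfl, fun _ => rfl⟩
    | symm x y _ ih =>
      intro S T hS hT hSc hTc h1 h2 h3 h4
      obtain ⟨Q, _, u, v, hQ, h5, h6⟩ := ih T S hT hS hTc hSc h2 h1 h4 h3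
      exact ⟨Q, _, v, u, hQ, fun m => (h5 m).symm, fun i => (h6 i).symm⟩
    | trans x y z _ _ ih1 ih2 =>
      intro S T hS hT hSc hTc h1 h2 h3 h4
      -- A small part of the middle realization, over which the two given amalgams can be
      -- amalgamated.
      obtain ⟨U, hU, hUc, h5, h6⟩ := exists_strong_realization hLS hM hι y.emb y.b
      obtain ⟨Q₁, _, u₁, v₁, hQ₁, h7, h8⟩ := ih1 S U hS hU hSc hUc h1 h5 h3 h6
      obtain ⟨Q₂, _, u₂, v₂, hQ₂, h9, h10⟩ := ih2 U T hU hT hUc hTc h5 h2 h6 h4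
      obtain ⟨Q, _, w₁, w₂, hQ, hw⟩ := hAP U Q₁ Q₂ v₁ u₂ hUc hQ₁ hQ₂
      refine ⟨Q, _, w₁.comp u₁, w₂.comp v₂, hQ, fun m => ?_, fun i => ?_⟩
      · simp only [Emb.comp_apply]
        rw [h7, hw, h9]
      · simp only [Emb.comp_apply]
        rw [h8, hw, h10]
  have hNm := f.mem_right
  have hPm := g.mem_right
  obtain ⟨Q, _, u, v, hQ, h1, h2⟩ := hR _ _ (Quot.eqvGen_exact h) ⊤ ⊤ (K.strong_refl hNm)
    (K.strong_refl hPm)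
    (hN ▸ mk_congr (Substructure.topEquiv (L := L) (M := N)).toEquiv)
    (hP ▸ mk_congr (Substructure.topEquiv (L := L) (M := P)).toEquiv)
    (fun _ => trivial) (fun _ => trivial) (fun _ => trivial) (fun _ => trivial)
  refine ⟨Q, _, u.comp (Emb.ofEquiv u.mem_left Substructure.topEquiv.symm),
    v.comp (Emb.ofEquiv v.mem_left Substructure.topEquiv.symm), hQ, h1, h2⟩

end AEC

/-! ### Chains of models on subsets of a fixed set -/

/-- A structure on a subset of `X`. -/
structure SetModel (L : FirstOrder.Language.{u, u}) (X : Type u) where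
  carrier : Set X
  [str : L.Structure carrier]

attribute [instance] SetModel.str

namespace SetModel

open AbstractClass

variable {L : FirstOrder.Language.{u, u}} {X : Type u} {lam : Cardinal.{u}}

/-- The inclusion of `A` in `B` is a `K`-embedding. -/
def Le (K : AbstractClass L) (A B : SetModel L X) : Prop :=
  ∃ f : K.Emb A.carrier B.carrier, ∀ x, (f x : X) = x

/-- A structure of cardinality at most `lam` can be copied onto a subset of `X` in such a way that
prescribed parts of it are identified with given subsets. -/
theorem exists_copy (hX : lam < #X) (hlam : ℵ₀ ≤ lam) {ι : Type u} (A : ι → Set X)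
    (hι : #ι ≤ lam) (hA : ∀ i, #(A i) ≤ lam) (D : Type u) [L.Structure D] (hD : #D ≤ lam)
    (φ : ∀ i, A i → D) (hφ : ∀ i j (x : A i) (y : A j), φ i x = φ j y ↔ (x : X) = y) :
    ∃ (B : SetModel L X) (e : D ≃[L] B.carrier), ∀ i x, (e (φ i x) : X) = x := by
  classical
  have hU : #(⋃ i, A i) ≤ lam := by
    refine (mk_iUnion_le _).trans ?_
    calc #ι * ⨆ i, #(A i) ≤ lam * lam := mul_le_mul' hι (ciSup_le' hA)
      _ = lam := mul_eq_self hlam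
  have hinf : Infinite X := infinite_iff.2 (hlam.trans hX.le)
  -- The prescribed subsets occupy at most `lam` points of `X`, so the complement has room for the
  -- rest of `D`.
  have hUc : #((⋃ i, A i)ᶜ : Set X) = #X := mk_compl_of_infinite _ (hU.trans_lt hX)
  obtain ⟨j⟩ : #D ≤ #((⋃ i, A i)ᶜ : Set X) := hUc ▸ hD.trans hX.le
  let F : D → X := fun d =>
    if h : ∃ i, ∃ x : A i, φ i x = d then (h.choose_spec.choose : X) else j d
  have hF : ∀ i (x : A i), F (φ i x) = x := fun i x => by
    have h : ∃ i', ∃ x' : A i', φ i' x' = φ i x := ⟨i, x, rfl⟩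
    have : F (φ i x) = h.choose_spec.choose := dif_pos h
    rw [this]
    exact (hφ _ _ _ _).1 h.choose_spec.choose_spec
  have hF' : ∀ d, (¬ ∃ i, ∃ x : A i, φ i x = d) → F d = j d := fun d h => dif_neg h
  have hinj : Function.Injective F := by
    intro d d' hdd'
    by_cases h : ∃ i, ∃ x : A i, φ i x = d <;> by_cases h' : ∃ i, ∃ x : A i, φ i x = d'
    · obtain ⟨i, x, rfl⟩ := h
      obtain ⟨i', x', rfl⟩ := h'
      rw [hF, hF] at hdd'
      exact (hφ _ _ _ _).2 hdd'
    · obtain ⟨i, x, rfl⟩ := h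
      rw [hF, hF' _ h'] at hdd'
      exact absurd (Set.mem_iUnion.2 ⟨i, hdd' ▸ x.2⟩) (j d').2
    · obtain ⟨i, x, rfl⟩ := h'
      rw [hF, hF' _ h] at hdd'
      exact absurd (Set.mem_iUnion.2 ⟨i, hdd' ▸ x.2⟩) (j d).2
    · rw [hF' _ h, hF' _ h'] at hdd'
      exact j.injective (Subtype.ext hdd')
  let e := Equiv.ofInjective F hinj
  let str : L.Structure (Set.range F) := e.inducedStructure
  exact ⟨⟨Set.range F⟩, e.inducedStructureEquiv, fun i x => hF i x⟩

/-- Models living on subsets of one set are linked by inclusions, which commute automatically. A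
chain built by recursion thus takes values in a single type and needs no record of its transition
maps. -/
theorem exists_limit {K : AEC L} {ι : Type u} [LinearOrder ι] [Nonempty ι] (A : ι → SetModel L X)
    (hA : ∀ i j, i ≤ j → Le K.toAbstractClass (A i) (A j)) {κ : Cardinal.{u}} (hκ : ℵ₀ ≤ κ)
    (hι : #ι ≤ κ) (hAc : ∀ i, #(A i).carrier ≤ κ) :
    ∃ (D : Type u) (_ : L.Structure D) (g : ∀ i, K.Emb (A i).carrier D),
      (∀ i j x y, g i x = g j y ↔ (x : X) = y) ∧ (∀ d, ∃ i x, g i x = d) ∧ #D ≤ κ := by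
  choose f hf using hA
  obtain ⟨D, _, g, h1, h2⟩ := AEC.exists_directLimit (K := K) (fun i => (A i).carrier) f
    (fun i x => Subtype.ext (hf _ _ _ x))
    (fun i j k hij hjk x => Subtype.ext (by rw [hf, hf, hf]))
  refine ⟨D, _, g, fun i j x y => ?_, h2, ?_⟩
  · rw [← h1 i (max i j) (le_max_left i j), ← h1 j (max i j) (le_max_right i j),
      (g _).injective.eq_iff, Subtype.ext_iff, hf, hf]
  · have hs : Function.Surjective (fun p : Σ i, (A i).carrier => g p.1 p.2) := fun d => by
      obtain ⟨i, x, h⟩ := h2 d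
      exact ⟨⟨i, x⟩, h⟩
    refine (mk_le_of_surjective hs).trans ?_
    rw [mk_sigma]
    refine (sum_le_mk_mul_iSup _).trans ?_
    calc #ι * ⨆ i, #(A i).carrier ≤ κ * κ := mul_le_mul' hι (ciSup_le' hAc)
      _ = κ := mul_eq_self hκ

end SetModel

/-! ### Existence of a saturated model -/

theorem mk_Iio_ord_succ_le {lam : Cardinal.{u}} (i : (Order.succ lam).ord.ToType) :
    #{j // j < i} ≤ lam := by
  have h := mk_Iio_lt i (by simp)
  rw [mk_toType, card_ord] at h
  exact Order.lt_succ_iff.1 h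

theorem noMaxOrder_ord_succ {lam : Cardinal.{u}} (hlam : ℵ₀ ≤ lam) :
    NoMaxOrder (Order.succ lam).ord.ToType :=
  Cardinal.noMaxOrder (hlam.trans (Order.le_succ lam))

/-- A small set of indices below `lam⁺` is bounded. -/
theorem exists_ge_of_mk_le {lam : Cardinal.{u}} (hlam : ℵ₀ ≤ lam) {T : Type u} (hT : #T ≤ lam)
    (f : T → (Order.succ lam).ord.ToType) : ∃ i, ∀ t, f t ≤ i := by
  by_contra! h
  have hU : (⋃ t, {j | j < f t}) = Set.univ := Set.eq_univ_of_forall fun i => by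
    obtain ⟨t, ht⟩ := h i
    exact Set.mem_iUnion.2 ⟨t, ht⟩
  have h1 : #(⋃ t, {j | j < f t}) ≤ lam := by
    refine (mk_iUnion_le _).trans ?_
    calc #T * ⨆ t, #{j | j < f t} ≤ lam * lam :=
          mul_le_mul' hT (ciSup_le' fun t => mk_Iio_ord_succ_le _)
      _ = lam := mul_eq_self hlam
  rw [hU, mk_univ, mk_toType, card_ord] at h1
  exact absurd h1 (not_le.2 (Order.lt_succ lam))

/-- A bookkeeping function in which every task occurs cofinally often. -/
theorem exists_bookkeeping {lam : Cardinal.{u}} (hlam : ℵ₀ ≤ lam) {T : Type u} (hT : #T ≤ lam)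
    [Nonempty T] : ∃ π : (Order.succ lam).ord.ToType → (Order.succ lam).ord.ToType × T,
      ∀ q j, ∃ i, j < i ∧ π i = q := by
  have hs : ℵ₀ ≤ Order.succ lam := hlam.trans (Order.le_succ lam)
  -- The extra coordinate gives each task `lam⁺` indices, too many to be bounded below `lam⁺`.
  obtain ⟨e⟩ : Nonempty ((Order.succ lam).ord.ToType ≃
      ((Order.succ lam).ord.ToType × T) × (Order.succ lam).ord.ToType) := by
    rw [← Cardinal.eq]
    simp only [mk_prod, lift_id, mk_toType, card_ord]
    rw [mul_eq_left hs (hT.trans (Order.le_succ lam)) (mk_ne_zero T), mul_eq_self hs]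
  refine ⟨fun i => (e i).1, fun q j => ?_⟩
  by_contra! h
  have := noMaxOrder_ord_succ hlam
  obtain ⟨j', hj'⟩ := exists_gt j
  have h1 : ∀ l, e.symm (q, l) < j' := fun l => by
    by_contra hl
    exact h (e.symm (q, l)) (hj'.trans_le (not_lt.1 hl)) (by simp)
  have h2 : #(Order.succ lam).ord.ToType ≤ #{i // i < j'} :=
    mk_le_of_injective (f := fun l => ⟨e.symm (q, l), h1 l⟩) fun l l' h => by
      simpa using congrArg (fun x => (e x.1).2) h
  rw [mk_toType, card_ord] at h2
  exact absurd (h2.trans (mk_Iio_ord_succ_le j')) (not_le.2 (Order.lt_succ lam))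

namespace AEC

open AbstractClass

variable {L : FirstOrder.Language.{u, u}}

/-- `C` realizes all types over its models of cardinality `lam`, and has cardinality at most
`lam⁺`. -/
structure Saturated (K : AEC L) (lam : Cardinal.{u}) (C : Type u) [L.Structure C] : Prop where
  mem : K.Mem C
  le_card : lam ≤ #C
  card_le : #C ≤ Order.succ lam
  realize : ∀ {S : L.Substructure C} (hS : K.Strong S), #S = lam → ∀ p : K.GType S Unit,
    ∃ b, tp hS (fun _ => b) = p

variable {K : AEC L} {lam : Cardinal.{u}}
variable {M N P : Type u} [L.Structure M] [L.Structure N] [L.Structure P]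

theorem lift_unit_le (hlam : ℵ₀ ≤ lam) :
    Cardinal.lift.{u} #Unit ≤ Cardinal.lift.{0} lam := by
  simpa using one_le_aleph0.trans hlam

/-- A type over `M` is realized in some extension of a given extension of `M`. -/
theorem exists_realizing_extension (hLS : K.LS ≤ lam) (hAP : K.Amalgamation lam) (hM : #M = lam)
    (hN : #N = lam) (f : K.Emb M N) (p : K.GType M Unit) :
    ∃ (Q : Type u) (_ : L.Structure Q) (h : K.Emb N Q) (b : Q), #Q = lam ∧
      tpEmb (h.comp f) (fun _ => b) = p := by
  obtain ⟨N', _, f', b, hN', rfl⟩ :=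
    exists_tpEmb_eq hLS hM (lift_unit_le (aleph0_le_of_LS_le hLS)) p
  obtain ⟨Q, _, h, h', hQ, e⟩ := hAP M N N' f f' hM hN hN'
  refine ⟨Q, _, h, h' (b ()), hQ, ?_⟩
  rw [show h.comp f = h'.comp f' from Emb.ext e]
  exact tpEmb_comp h' f' b

/-- Every type over `A` with code `k` is realized in `B`. -/
def Realizes (K : AEC L) {X T : Type u} (enc : ∀ A : SetModel L X, K.GType A.carrier Unit → T)
    (k : T) (A B : SetModel L X) : Prop :=
  ∀ p, enc A p = k → ∀ f : K.Emb A.carrier B.carrier, (∀ x, (f x : X) = x) →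
    ∃ b, tpEmb f (fun _ : Unit => b) = p

/-- A chain of length `lam⁺` of models of cardinality `lam`: by stability the types over each term
have codes in a set of size `lam`, and the bookkeeping function names the type to be realized at
each stage. -/
theorem exists_saturated (hss : K.Superstable lam) :
    ∃ (C : Type u) (_ : L.Structure C), K.Saturated lam C := by
  classical
  have hlam := aleph0_le_of_LS_le hss.ls_le
  let κ : Type u := (Order.succ lam).ord.ToType
  have hκ : #κ = Order.succ lam := by simp [κ]
  have hX : lam < #κ := hκ ▸ Order.lt_succ lam
  let T : Type u := lam.ord.ToType
  have hT : #T = lam := by simp [T]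
  have hTne : Nonempty T := mk_ne_zero_iff.1 (hT ▸ (aleph0_pos.trans_le hlam).ne')
  have hκne : Nonempty κ := mk_ne_zero_iff.1 (hκ ▸ (aleph0_pos.trans_le (hlam.trans
    (Order.le_succ _))).ne')
  have hmax : NoMaxOrder κ := noMaxOrder_ord_succ hlam
  obtain ⟨π, hπ⟩ := exists_bookkeeping hlam hT.le
  obtain ⟨enc, henc⟩ : ∃ enc : ∀ A : SetModel L κ, K.GType A.carrier Unit → T,
      ∀ A : SetModel L κ, K.MemCard lam A.carrier → Function.Injective (enc A) := by
    have : ∀ A : SetModel L κ, ∃ e : K.GType A.carrier Unit → T,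
        K.MemCard lam A.carrier → Function.Injective e := by
      intro A
      by_cases hA : K.MemCard lam A.carrier
      · have h := hss.stable A.carrier hA
        rw [← hT] at h
        have h' : Cardinal.lift.{u} #(K.GType A.carrier Unit) ≤ Cardinal.lift.{u + 1} #T := by
          rw [Cardinal.lift_id'.{u, u + 1}]
          exact h
        obtain ⟨e⟩ := lift_mk_le'.1 h'
        exact ⟨e, fun _ => e.injective⟩
      · exact ⟨fun _ => Classical.arbitrary T, fun h => absurd h hA⟩
    choose e he using this
    exact ⟨e, he⟩
  obtain ⟨M₀, _, hM₀⟩ := hss.nonempty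
  have hne : Nonempty (SetModel L κ) := by
    obtain ⟨B, e, -⟩ :=
      SetModel.exists_copy (L := L) hX hlam (ι := PEmpty) (fun _ => ∅) (by simp) (by simp)
      M₀ hM₀.2.le (fun i => i.elim) (fun i => i.elim)
    exact ⟨B⟩
  obtain ⟨A, hA⟩ := exists_of_history (ι := κ) (P := SetModel L κ)
    (fun i f x => K.MemCard lam x.carrier ∧
      (∀ j < i, SetModel.Le K.toAbstractClass (f j) x) ∧
      ∀ j < i, j = (π i).1 → K.Realizes enc (π i).2 (f j) x) (by
      rintro i f g x hfg ⟨h1, h2, h3⟩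
      exact ⟨h1, fun j hj => hfg j hj ▸ h2 j hj, fun j hj => hfg j hj ▸ h3 j hj⟩) (by
      intro i f hf
      rcases isEmpty_or_nonempty {j // j < i} with hE | hE
      · obtain ⟨B, e, -⟩ := SetModel.exists_copy (L := L) hX hlam (ι := PEmpty)
          (fun _ => ∅) (by simp)
          (by simp) M₀ hM₀.2.le (fun i => i.elim) (fun i => i.elim)
        exact ⟨B, ⟨K.mem_iso e hM₀.1, hM₀.2 ▸ (mk_congr e.toEquiv).symm⟩,
          fun j hj => hE.elim ⟨j, hj⟩, fun j hj => hE.elim ⟨j, hj⟩⟩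
      · obtain ⟨D, _, g, hg, -, hD⟩ := SetModel.exists_limit (K := K)
          (fun j : {j // j < i} => f j) (fun j k hjk => by
            rcases hjk.eq_or_lt with rfl | h
            · exact ⟨Emb.id (hf j j.2).1.1, fun _ => rfl⟩
            · exact (hf k k.2).2.1 j h) hlam (mk_Iio_ord_succ_le i) (fun j => (hf j j.2).1.2.le)
        obtain ⟨j₀⟩ := id hE
        have hDc : #D = lam := le_antisymm hD
          ((hf j₀ j₀.2).1.2 ▸ mk_le_of_injective (g j₀).injective)
        obtain ⟨Q, _, h, hQ, hr⟩ : ∃ (Q : Type u) (_ : L.Structure Q) (h : K.Emb D Q), #Q = lam ∧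
            ∀ j (hj : j < i), j = (π i).1 → ∀ p, enc (f j) p = (π i).2 →
              ∃ b, tpEmb (h.comp (g ⟨j, hj⟩)) (fun _ : Unit => b) = p := by
          by_cases hp : ∃ (hj : (π i).1 < i) (p : _), enc (f (π i).1) p = (π i).2
          · obtain ⟨hj, p, hp⟩ := hp
            obtain ⟨Q, _, h, b, hQ, e⟩ := exists_realizing_extension hss.ls_le hss.amalgamation
              (hf _ hj).1.2 hDc (g ⟨_, hj⟩) p
            refine ⟨Q, _, h, hQ, ?_⟩
            rintro j hj' rfl p' hp'
            obtain rfl := henc _ (hf _ hj).1 (hp'.trans hp.symm)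
            exact ⟨b, e⟩
          · refine ⟨D, _, Emb.id (g j₀).mem_right, hDc, ?_⟩
            rintro j hj rfl p hp'
            exact absurd ⟨hj, p, hp'⟩ hp
        obtain ⟨B, e, he⟩ := SetModel.exists_copy (L := L) hX hlam
          (fun j : {j // j < i} => (f j).carrier) (mk_Iio_ord_succ_le i)
          (fun j => (hf j j.2).1.2.le) Q hQ.le (fun j x => h (g j x))
          (fun j k x y => by rw [h.injective.eq_iff, hg])
        have hB : K.Mem B.carrier := K.mem_iso e h.mem_right
        refine ⟨B, ⟨hB, hQ ▸ (mk_congr e.toEquiv).symm⟩, fun j hj =>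
          ⟨(Emb.ofEquiv hB e).comp (h.comp (g ⟨j, hj⟩)), he ⟨j, hj⟩⟩, ?_⟩
        intro j hj hjπ p hp k hk
        obtain ⟨b, hb⟩ := hr j hj hjπ p hp
        refine ⟨e b, ?_⟩
        have : k = (Emb.ofEquiv hB e).comp (h.comp (g ⟨j, hj⟩)) :=
          Emb.ext fun x => Subtype.ext ((hk x).trans (he ⟨j, hj⟩ x).symm)
        rw [this, ← hb]
        exact tpEmb_comp (Emb.ofEquiv hB e) _ _)
  have hLe : ∀ i j, i ≤ j → SetModel.Le K.toAbstractClass (A i) (A j) := fun i j hij => by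
    rcases hij.eq_or_lt with rfl | h
    · exact ⟨Emb.id (hA i).1.1, fun _ => rfl⟩
    · exact (hA j).2.1 i h
  obtain ⟨C, _, g, hg, hgs, hC⟩ := SetModel.exists_limit (K := K) A hLe
    (hlam.trans (Order.le_succ lam)) hκ.le (fun i => (hA i).1.2.le.trans (Order.le_succ lam))
  have i₀ : κ := Classical.arbitrary κ
  refine ⟨C, _, (g i₀).mem_right, (hA i₀).1.2 ▸ mk_le_of_injective (g i₀).injective, hC,
    fun {S} hS hSc p => ?_⟩
  choose s x hx using fun y : S => hgs y
  -- A small submodel lies in some `A i`. Its type extends to a type over `A i` by amalgamation, and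
  -- the extended type is realized at a later stage.
  obtain ⟨i, hi⟩ := exists_ge_of_mk_le hlam hSc.le s
  obtain ⟨φ, hφ⟩ := exists_lift (g i) (Emb.incl hS) fun y => by
    obtain ⟨f, hf⟩ := hLe _ _ (hi y)
    exact ⟨f (x y), ((hg _ _ _ _).2 (hf _)).trans (hx y)⟩
  obtain ⟨Q, _, h, b, hQ, hb⟩ := exists_realizing_extension hss.ls_le hss.amalgamation hSc
    (hA i).1.2 φ p
  obtain ⟨j, hij, hj⟩ := hπ (i, enc (A i) (tpEmb h (fun _ : Unit => b))) i
  obtain ⟨f, hf⟩ := hLe i j hij.le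
  obtain ⟨b', hb'⟩ := (hA j).2.2 i hij (by rw [hj]) _ (by rw [hj]) f hf
  refine ⟨g j b', ?_⟩
  have e : Emb.incl hS = (g j).comp (f.comp φ) :=
    Emb.ext fun y => (hφ y).symm.trans ((hg _ _ _ _).2 (hf _).symm)
  change tpEmb (Emb.incl hS) _ = p
  rw [e]
  refine (tpEmb_comp (g j) _ (fun _ => b')).trans ?_
  rw [← pull_tpEmb, hb', pull_tpEmb, hb]

end AEC

/-! ### Homogeneity of saturated models -/

/-- A family with an additional first term. -/
def withFirst {J P : Type*} (p : P) (f : J → P) : WithBot J → P := WithBot.recBotCoe p f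

theorem withFirst_rel {J P : Type*} [LinearOrder J] {r : P → P → Prop} (hr : ∀ p, r p p) {p : P}
    {f : J → P} (hp : ∀ j, r p (f j)) (hf : ∀ i j, i < j → r (f i) (f j)) (i j : WithBot J)
    (hij : i ≤ j) : r (withFirst p f i) (withFirst p f j) := by
  induction i with
  | bot =>
    induction j with
    | bot => exact hr p
    | coe j => exact hp j
  | coe i =>
    induction j with
    | bot => exact absurd hij (WithBot.not_coe_le_bot i)
    | coe j =>
      rcases (WithBot.coe_le_coe.1 hij).eq_or_lt with rfl | h
      · exact hr _
      · exact hf i j h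

theorem mk_withBot_le {lam : Cardinal.{u}} (hlam : ℵ₀ ≤ lam) {J : Type u} (hJ : #J ≤ lam) :
    #(WithBot J) ≤ lam := by
  have : #(Option J) ≤ lam := by
    rw [mk_option]
    exact add_le_of_le hlam hJ (one_le_aleph0.trans hlam)
  exact this

namespace AEC

open AbstractClass

variable {L : FirstOrder.Language.{u, u}}

/-- A `K`-embedding of a strong substructure of `C` into a structure on a subset of `X`, both of
cardinality `lam`. -/
structure PartialEmb (K : AEC L) (lam : Cardinal.{u}) (C X : Type u) [L.Structure C] where
  model : SetModel L X
  dom : L.Substructure C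
  emb : K.Emb dom model.carrier
  strong : K.Strong dom
  mk_model : #model.carrier = lam
  mk_dom : #dom = lam

variable {K : AEC L} {lam : Cardinal.{u}}
variable {M N P : Type u} [L.Structure M] [L.Structure N] [L.Structure P]

namespace PartialEmb

variable {C X : Type u} [L.Structure C]

/-- Extension of partial embeddings. -/
structure Ext (p q : K.PartialEmb lam C X) : Prop where
  le : SetModel.Le K.toAbstractClass p.model q.model
  dom_le : p.dom ≤ q.dom
  eq : ∀ x (h : x ∈ p.dom) (h' : x ∈ q.dom), (q.emb ⟨x, h'⟩ : X) = p.emb ⟨x, h⟩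

theorem Ext.refl (p : K.PartialEmb lam C X) : p.Ext p :=
  ⟨⟨Emb.id p.emb.mem_right, fun _ => rfl⟩, le_rfl, fun _ _ _ => rfl⟩

theorem exists_limit (hlam : ℵ₀ ≤ lam) {ι : Type u} [LinearOrder ι] [Nonempty ι] (hι : #ι ≤ lam)
    (p : ι → K.PartialEmb lam C X) (hp : ∀ i j, i ≤ j → (p i).Ext (p j)) :
    ∃ (D : Type u) (_ : L.Structure D) (g : ∀ i, K.Emb (p i).model.carrier D)
      (S : L.Substructure C) (γ : K.Emb S D), (∀ i j x y, g i x = g j y ↔ (x : X) = y) ∧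
      #D = lam ∧ K.Strong S ∧ #S = lam ∧ (∀ i, (p i).dom ≤ S) ∧
      (∀ x ∈ S, ∃ i, x ∈ (p i).dom) ∧
      ∀ i x (hx : x ∈ (p i).dom) (hx' : x ∈ S), γ ⟨x, hx'⟩ = g i ((p i).emb ⟨x, hx⟩) := by
  obtain ⟨D, _, g, hg, -, hD⟩ := SetModel.exists_limit (K := K) (fun i => (p i).model)
    (fun i j h => (hp i j h).le) hlam hι (fun i => (p i).mk_model.le)
  have hm : Monotone fun i => (p i).dom := fun i j h => (hp i j h).dom_le
  obtain ⟨γ, hγ⟩ := exists_emb_iSup hm (fun i => (g i).comp (p i).emb) (fun i j h x =>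
    (hg _ _ _ _).2 ((hp i j h).eq _ _ _))
  have i₀ : ι := Classical.arbitrary ι
  have hle : ∀ i, (p i).dom ≤ ⨆ i, (p i).dom := fun i => le_iSup (fun i => (p i).dom) i
  refine ⟨D, _, g, ⨆ i, (p i).dom, γ, hg,
    le_antisymm hD ((p i₀).mk_model ▸ mk_le_of_injective (g i₀).injective),
    strong_iSup hm fun i => (p i).strong, le_antisymm (mk_iSup_le hm hlam hι fun i =>
      (p i).mk_dom.le)
      ((p i₀).mk_dom.symm.le.trans (mk_le_mk_of_subset (hle i₀))), hle,
        fun x hx => (mem_iSup hm).1 hx, hγ⟩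

end PartialEmb

variable {C : Type u} [L.Structure C]

/-- Saturated models are model-homogeneous. -/
theorem Saturated.exists_emb (hss : K.Superstable lam) (hC : K.Saturated lam C) (hM : #M = lam)
    (hN : #N = lam) (j : K.Emb M C) (f : K.Emb M N) :
    ∃ h : K.Emb N C, ∀ m, h (f m) = j m := by
  have hlam := aleph0_le_of_LS_le hss.ls_le
  let X : Type u := (Order.succ lam).ord.ToType
  have hX : lam < #X := by simp [X]
  obtain ⟨A₀, e₀, -⟩ := SetModel.exists_copy (L := L) hX hlam (ι := PEmpty) (fun _ => ∅) (by simp)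
    (by simp) N hN.le (fun i => i.elim) (fun i => i.elim)
  have hA₀ : K.Mem A₀.carrier := K.mem_iso e₀ f.mem_right
  let γ₀ : K.Emb j.toEmb.toHom.range A₀.carrier :=
    ((Emb.ofEquiv hA₀ e₀).comp f).comp (Emb.ofEquiv j.mem_left j.toEmb.equivRange.symm)
  have hγ₀ : ∀ m (h : j m ∈ j.toEmb.toHom.range), γ₀ ⟨j m, h⟩ = e₀ (f m) := fun m h =>
    congrArg (fun x => e₀ (f x)) (j.toEmb.equivRange.symm_apply_apply m)
  let p₀ : K.PartialEmb lam C X := ⟨A₀, _, γ₀, j.strong, hN ▸ (mk_congr e₀.toEquiv).symm,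
    j.mk_range.trans hM⟩
  let κ : Type u := lam.ord.ToType
  have hκ : #κ = lam := by simp [κ]
  obtain ⟨ν⟩ : Nonempty (κ ≃ N) := Cardinal.eq.1 (hκ.trans hN.symm)
  have : Nonempty (K.PartialEmb lam C X) := ⟨p₀⟩
  -- Submodels of `C` are embedded into growing extensions of `N`, stage `i` putting the `i`-th
  -- element of `N` in the range. At the end `N` lies in the range, and the inverse map embeds it in
  -- `C`.
  obtain ⟨p, hp⟩ := exists_of_history (ι := κ) (P := K.PartialEmb lam C X)
    (fun i p q => p₀.Ext q ∧ (∀ j < i, (p j).Ext q) ∧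
      ∃ x, (q.emb x : X) = e₀ (ν i)) (by
      rintro i p p' q hpp ⟨h1, h2, h3⟩
      exact ⟨h1, fun j hj => hpp j hj ▸ h2 j hj, h3⟩) (by
      intro i p hp
      let p' : WithBot {j // j < i} → K.PartialEmb lam C X := withFirst p₀ fun j => p j
      obtain ⟨D, _, g, S, γ, hg, hD, hS, hSc, hle, -, hγ⟩ := PartialEmb.exists_limit hlam
        (mk_withBot_le hlam (HomogeneousSystem.mk_lt_subtype_le hκ.le i)) p'
        (withFirst_rel PartialEmb.Ext.refl (fun j => (hp j j.2).1) fun j k h => (hp k k.2).2.1 j h)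
      -- Saturation finds in `C` a realization `b` of the type of the target element over the
      -- current domain; equality of types then gives an amalgam identifying `b` with the target.
      obtain ⟨b, hb⟩ := hC.realize hS hSc (tpEmb γ fun _ => g ⊥ (e₀ (ν i)))
      obtain ⟨B, hB, hSB, hBc⟩ := exists_strong hss.ls_le hC.mem hC.le_card (S ∪ {b})
        ((mk_union_le _ _).trans (add_le_of_le hlam hSc.le (by
          rw [mk_singleton]
          exact one_le_aleph0.trans hlam)))
      have hSB' : S ≤ B := fun x hx => hSB (Or.inl hx)
      have hbB : b ∈ B := hSB (Or.inr rfl)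
      let ι := Emb.inclusion (K.coherence hSB' hS hB)
      have ht : tpEmb ι (fun _ : Unit => ⟨b, hbB⟩) = tpEmb γ fun _ => g ⊥ (e₀ (ν i)) := by
        rw [← hb]
        exact (tpEmb_comp (Emb.incl hB) ι (fun _ : Unit => ⟨b, hbB⟩)).symm
      obtain ⟨Q, _, s, t, hQ, hst, hst'⟩ := exists_amalgam_of_tpEmb_eq hss.ls_le hss.amalgamation
        hSc hBc hD (lift_unit_le hlam) ht
      obtain ⟨A, e, he⟩ := SetModel.exists_copy (L := L) hX hlam
        (fun o => (p' o).model.carrier) (mk_withBot_le hlam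
          (HomogeneousSystem.mk_lt_subtype_le hκ.le i))
        (fun o => (p' o).mk_model.le) Q hQ.le (fun o x => t (g o x))
        (fun j k x y => by rw [t.injective.eq_iff, hg])
      have hA : K.Mem A.carrier := K.mem_iso e s.mem_right
      let q : K.PartialEmb lam C X := ⟨A, B, (Emb.ofEquiv hA e).comp s, hB,
        hQ ▸ (mk_congr e.toEquiv).symm, hBc⟩
      have hq : ∀ o, (p' o).Ext q := fun o =>
        ⟨⟨(Emb.ofEquiv hA e).comp (t.comp (g o)), he o⟩, (hle o).trans hSB', fun x h h' => by
          have h1 : s ⟨x, h'⟩ = t (γ ⟨x, hle o h⟩) := hst ⟨x, hle o h⟩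
          change ((e (s ⟨x, h'⟩) : A.carrier) : X) = _
          rw [h1, hγ o x h, he]⟩
      refine ⟨q, hq ⊥, fun j hj => hq (WithBot.some ⟨j, hj⟩), ⟨b, hbB⟩, ?_⟩
      change ((e (s ⟨b, hbB⟩) : A.carrier) : X) = _
      rw [hst' ()]
      exact he ⊥ _)
  let p' : WithBot κ → K.PartialEmb lam C X := withFirst p₀ p
  obtain ⟨D, _, g, S, γ, hg, hD, hS, hSc, hle, -, hγ⟩ := PartialEmb.exists_limit hlam
    (mk_withBot_le hlam hκ.le) p'
    (withFirst_rel PartialEmb.Ext.refl (fun j => (hp j).1) fun j k h => (hp k).2.1 j h)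
  obtain ⟨k, hk⟩ := exists_lift γ ((g ⊥).comp (Emb.ofEquiv hA₀ e₀)) fun x => by
    obtain ⟨i, rfl⟩ := ν.surjective x
    obtain ⟨y, hy⟩ := (hp i).2.2
    exact ⟨⟨y, hle (WithBot.some i) y.2⟩, (hγ (WithBot.some i) y y.2 _).trans ((hg _ _ _ _).2 hy)⟩
  refine ⟨(Emb.incl hS).comp k, fun m => ?_⟩
  have hm : j m ∈ j.toEmb.toHom.range := ⟨m, rfl⟩
  have h1 : γ ⟨j m, hle ⊥ hm⟩ = g ⊥ (e₀ (f m)) := (hγ ⊥ (j m) hm _).trans (congrArg _ (hγ₀ m hm))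
  have h2 : k (f m) = ⟨j m, hle ⊥ hm⟩ := γ.injective ((hk (f m)).trans h1.symm)
  exact congrArg Subtype.val h2

end AEC

namespace AEC

open AbstractClass

variable {L : FirstOrder.Language.{u, u}} {lam : Cardinal.{u}}

/-- A `K`-embedding into `C` of a strong substructure of `C` of cardinality `lam`. -/
structure PartialAut (K : AEC L) (lam : Cardinal.{u}) (C : Type u) [L.Structure C] where
  dom : L.Substructure C
  emb : K.Emb dom C
  strong : K.Strong dom
  mk_dom : #dom = lam

variable {K : AEC L} {C : Type u} [L.Structure C]

/-- Extension of partial automorphisms. -/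
structure PartialAut.Ext (p q : K.PartialAut lam C) : Prop where
  dom_le : p.dom ≤ q.dom
  eq : ∀ x (h : x ∈ p.dom) (h' : x ∈ q.dom), q.emb ⟨x, h'⟩ = p.emb ⟨x, h⟩

theorem PartialAut.Ext.refl (p : K.PartialAut lam C) : p.Ext p := ⟨le_rfl, fun _ _ _ => rfl⟩

theorem PartialAut.Ext.trans {p q r : K.PartialAut lam C} (h : p.Ext q) (h' : q.Ext r) : p.Ext r :=
  ⟨h.dom_le.trans h'.dom_le, fun x hx hx' => (h'.eq x (h.dom_le hx) hx').trans (h.eq x hx _)⟩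

theorem Saturated.exists_strong_insert (hss : K.Superstable lam) (hC : K.Saturated lam C)
    {S : L.Substructure C} (hSc : #S = lam) (c : C) :
    ∃ T : L.Substructure C, K.Strong T ∧ #T = lam ∧ S ≤ T ∧ c ∈ T := by
  have hlam := aleph0_le_of_LS_le hss.ls_le
  obtain ⟨B, hB, hSB, hBc⟩ := exists_strong hss.ls_le hC.mem hC.le_card (S ∪ {c})
    ((mk_union_le _ _).trans (add_le_of_le hlam hSc.le (by
      rw [mk_singleton]
      exact one_le_aleph0.trans hlam)))
  exact ⟨B, hB, hBc, fun x hx => hSB (Or.inl hx), hSB (Or.inr rfl)⟩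

theorem PartialAut.exists_forth (hss : K.Superstable lam) (hC : K.Saturated lam C)
    (p : K.PartialAut lam C) (c : C) : ∃ q : K.PartialAut lam C, p.Ext q ∧ c ∈ q.dom := by
  obtain ⟨T, hT, hTc, hle, hc⟩ := hC.exists_strong_insert hss p.mk_dom c
  obtain ⟨h, hh⟩ := hC.exists_emb hss p.mk_dom hTc p.emb
    (Emb.inclusion (K.coherence hle p.strong hT))
  exact ⟨⟨T, h, hT, hTc⟩, ⟨hle, fun x hx hx' => hh ⟨x, hx⟩⟩, hc⟩

/-- The forth step for the inverse: a model `T` containing the range and `c` is embedded into `C` so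
as to extend the inverse of the map, and the image of `T` becomes the new domain. -/
theorem PartialAut.exists_back (hss : K.Superstable lam) (hC : K.Saturated lam C)
    (p : K.PartialAut lam C) (c : C) :
    ∃ q : K.PartialAut lam C, p.Ext q ∧ ∃ x, q.emb x = c := by
  obtain ⟨T, hT, hTc, hle, hc⟩ := hC.exists_strong_insert hss (p.emb.mk_range.trans p.mk_dom) c
  obtain ⟨k, hk⟩ := exists_lift (Emb.incl hT) p.emb fun x => ⟨⟨_, hle ⟨x, rfl⟩⟩, rfl⟩
  obtain ⟨h, hh⟩ := hC.exists_emb hss p.mk_dom hTc (Emb.incl p.strong) k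
  let e := h.toEmb.equivRange
  refine ⟨⟨h.toEmb.toHom.range, (Emb.incl hT).comp (Emb.ofEquiv h.mem_left e.symm), h.strong,
    h.mk_range.trans hTc⟩, ⟨fun x hx => ⟨k ⟨x, hx⟩, hh ⟨x, hx⟩⟩, fun x hx hx' => ?_⟩,
    e ⟨c, hc⟩, ?_⟩
  · have h1 : (⟨x, hx'⟩ : h.toEmb.toHom.range) = e (k ⟨x, hx⟩) := Subtype.ext (hh ⟨x, hx⟩).symm
    change ((e.symm ⟨x, hx'⟩ : T) : C) = _
    rw [h1, FirstOrder.Language.Equiv.symm_apply_apply]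
    exact hk _
  · exact congrArg Subtype.val (e.symm_apply_apply ⟨c, hc⟩)

/-- Saturated models of cardinality `lam⁺` are homogeneous. -/
theorem Saturated.exists_equiv (hss : K.Superstable lam) (hC : K.Saturated lam C)
    {S : L.Substructure C} (hS : K.Strong S) (hSc : #S = lam) (φ : K.Emb S C) :
    ∃ σ : C ≃[L] C, ∀ x : S, σ x = φ x := by
  have hlam := aleph0_le_of_LS_le hss.ls_le
  let κ : Type u := (Order.succ lam).ord.ToType
  have hκ : #κ = Order.succ lam := by simp [κ]
  have hCne : Nonempty C :=
    mk_ne_zero_iff.1 ((aleph0_pos.trans_le (hlam.trans hC.le_card)).ne')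
  obtain ⟨ν, hν⟩ : ∃ ν : κ → C, Function.Surjective ν := by
    obtain ⟨e⟩ := hC.card_le.trans hκ.ge
    exact ⟨Function.invFun e, Function.invFun_surjective e.injective⟩
  let p₀ : K.PartialAut lam C := ⟨S, φ, hS, hSc⟩
  have : Nonempty (K.PartialAut lam C) := ⟨p₀⟩
  obtain ⟨p, hp⟩ := exists_of_history (ι := κ) (P := K.PartialAut lam C)
    (fun i p q => p₀.Ext q ∧ (∀ j < i, (p j).Ext q) ∧ ν i ∈ q.dom ∧ ∃ x, q.emb x = ν i) (by
      rintro i p p' q hpp ⟨h1, h2, h3⟩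
      exact ⟨h1, fun j hj => hpp j hj ▸ h2 j hj, h3⟩) (by
      intro i p hp
      let p' : WithBot {j // j < i} → K.PartialAut lam C := withFirst p₀ fun j => p j
      have hp' : ∀ o o', o ≤ o' → (p' o).Ext (p' o') :=
        withFirst_rel PartialAut.Ext.refl (fun j => (hp j j.2).1) fun j k h => (hp k k.2).2.1 j h
      have hm : Monotone fun o => (p' o).dom := fun o o' h => (hp' o o' h).dom_le
      obtain ⟨γ, hγ⟩ := exists_emb_iSup hm (fun o => (p' o).emb)
        fun o o' h x => (hp' o o' h).eq _ _ _
      have hle : ∀ o, (p' o).dom ≤ ⨆ o, (p' o).dom := fun o => le_iSup (fun o => (p' o).dom) o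
      -- An index below `lam⁺` has at most `lam` predecessors, so the union of the earlier maps
      -- still has a domain of cardinality `lam`.
      let r : K.PartialAut lam C := ⟨_, γ, strong_iSup hm fun o => (p' o).strong,
        le_antisymm (mk_iSup_le hm hlam (mk_withBot_le hlam (mk_Iio_ord_succ_le i))
          fun o => (p' o).mk_dom.le)
          ((p' ⊥).mk_dom.symm.le.trans (mk_le_mk_of_subset (hle ⊥)))⟩
      have hr : ∀ o, (p' o).Ext r := fun o => ⟨hle o, fun x h h' => hγ o x h h'⟩
      obtain ⟨s, hrs, hs⟩ := r.exists_forth hss hC (ν i)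
      obtain ⟨t, hst, ht⟩ := s.exists_back hss hC (ν i)
      have hrt := hrs.trans hst
      exact ⟨t, (hr ⊥).trans hrt, fun j hj => (hr (WithBot.some ⟨j, hj⟩)).trans hrt,
        hst.dom_le hs, ht⟩)
  have hκne : Nonempty κ :=
    mk_ne_zero_iff.1 (hκ ▸ (aleph0_pos.trans_le (hlam.trans (Order.le_succ _))).ne')
  have hp' : ∀ o o', o ≤ o' → (p o).Ext (p o') := fun o o' h => by
    rcases h.eq_or_lt with rfl | h
    · exact PartialAut.Ext.refl _
    · exact (hp o').2.1 o h
  have hm : Monotone fun o => (p o).dom := fun o o' h => (hp' o o' h).dom_le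
  obtain ⟨γ, hγ⟩ := exists_emb_iSup hm (fun o => (p o).emb) fun o o' h x => (hp' o o' h).eq _ _ _
  have htop : ∀ x, x ∈ ⨆ o, (p o).dom := fun x => by
    obtain ⟨i, rfl⟩ := hν x
    exact (mem_iSup hm).2 ⟨i, (hp i).2.2.1⟩
  have hγ' : ∀ i x (hx : x ∈ (p i).dom), γ ⟨x, htop x⟩ = (p i).emb ⟨x, hx⟩ := fun i x hx =>
    hγ i x hx _
  let T : L.Substructure C := ⨆ o, (p o).dom
  have hT : T = ⊤ := eq_top_iff.2 fun x _ => htop x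
  have hmem : ∀ x, x ∈ γ.toEmb.toHom.range := fun x => by
    obtain ⟨i, rfl⟩ := hν x
    obtain ⟨y, hy⟩ := (hp i).2.2.2
    exact ⟨⟨y, htop y⟩, (hγ' i y y.2).trans hy⟩
  let ψ : C ↪[L] C := γ.toEmb.comp
    ((Substructure.inclusion hT.ge).comp Substructure.topEquiv.symm.toEmbedding)
  have hψ : ∀ x, ψ x = γ ⟨x, htop x⟩ := fun x => rfl
  have hsurj : Function.Surjective ψ := fun y => by
    obtain ⟨x, hx⟩ := hmem y
    exact ⟨x, hx⟩
  let σ : C ≃[L] C := { Equiv.ofBijective ψ ⟨ψ.injective, hsurj⟩ with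
    map_fun' := fun f x => ψ.map_fun f x
    map_rel' := fun r x => ψ.map_rel r x }
  have i₀ : κ := Classical.arbitrary κ
  refine ⟨σ, fun x => ?_⟩
  change ψ x = φ x
  rw [hψ, hγ' i₀ x ((hp i₀).1.dom_le x.2)]
  exact (hp i₀).1.eq x x.2 _

end AEC

/-! ### The system of small models of a saturated model -/

namespace AEC

open AbstractClass

variable {L : FirstOrder.Language.{u, u}}

/-- The group of automorphisms of `C`, as a group of permutations. -/
def autGroup (L : FirstOrder.Language.{u, u}) (C : Type u) [L.Structure C] :
    Subgroup (Equiv.Perm C) where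
  carrier := {σ | ∃ e : C ≃[L] C, e.toEquiv = σ}
  mul_mem' := by
    rintro _ _ ⟨e, rfl⟩ ⟨f, rfl⟩
    exact ⟨e.comp f, rfl⟩
  one_mem' := ⟨FirstOrder.Language.Equiv.refl L C, rfl⟩
  inv_mem' := by
    rintro _ ⟨e, rfl⟩
    exact ⟨e.symm, rfl⟩

variable {C : Type u} [L.Structure C]

/-- An automorphism, as an element of the automorphism group. -/
def toAut (e : C ≃[L] C) : autGroup L C := ⟨e.toEquiv, e, rfl⟩

@[simp]
theorem toAut_smul (e : C ≃[L] C) (x : C) : toAut e • x = e x := rfl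

theorem exists_eq_toAut (g : autGroup L C) : ∃ e : C ≃[L] C, g = toAut e := by
  obtain ⟨_, e, rfl⟩ := g
  exact ⟨e, rfl⟩

variable {K : AEC L} {lam : Cardinal.{u}}
variable {M N P : Type u} [L.Structure M] [L.Structure N] [L.Structure P]

/-- Any two embeddings of a model of cardinality `lam` in a saturated model are conjugate. -/
theorem Saturated.exists_aut (hss : K.Superstable lam) (hC : K.Saturated lam C) (hM : #M = lam)
    (j j' : K.Emb M C) : ∃ σ : C ≃[L] C, ∀ m, σ (j m) = j' m := by
  obtain ⟨σ, hσ⟩ := hC.exists_equiv hss j.strong (j.mk_range.trans hM)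
    (j'.comp (Emb.ofEquiv j.mem_left j.toEmb.equivRange.symm))
  refine ⟨σ, fun m => (hσ (j.toEmb.equivRange m)).trans ?_⟩
  exact congrArg j' (j.toEmb.equivRange.symm_apply_apply m)

/-- Equality of types in a saturated model is conjugacy. -/
theorem Saturated.tpEmb_eq_iff (hss : K.Superstable lam) (hC : K.Saturated lam C) (hM : #M = lam)
    {ι : Type v} (hι : Cardinal.lift.{u} #ι ≤ Cardinal.lift.{v} lam) {j j' : K.Emb M C}
    {b c : ι → C} : tpEmb j b = tpEmb j' c ↔
      ∃ σ : C ≃[L] C, (∀ m, σ (j m) = j' m) ∧ ∀ i, σ (b i) = c i := by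
  constructor
  · intro h
    obtain ⟨S, hS, hSc, hjS, hbS⟩ := exists_strong_realization hss.ls_le hM hι j b
    obtain ⟨T, hT, hTc, hjT, hcT⟩ := exists_strong_realization hss.ls_le hM hι j' c
    obtain ⟨k, hk⟩ := exists_lift (Emb.incl hS) j fun m => ⟨⟨_, hjS m⟩, rfl⟩
    obtain ⟨k', hk'⟩ := exists_lift (Emb.incl hT) j' fun m => ⟨⟨_, hjT m⟩, rfl⟩
    have h1 : tpEmb k (fun i => (⟨b i, hbS i⟩ : S)) = tpEmb k' (fun i => (⟨c i, hcT i⟩ : T)) := by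
      rw [← tpEmb_comp (Emb.incl hS), ← tpEmb_comp (Emb.incl hT),
        show (Emb.incl hS).comp k = j from Emb.ext hk,
        show (Emb.incl hT).comp k' = j' from Emb.ext hk']
      exact h
    obtain ⟨Q, _, s, t, hQ, h2, h3⟩ := exists_amalgam_of_tpEmb_eq hss.ls_le hss.amalgamation hM
      hSc hTc hι h1
    -- The amalgam is embedded back into `C` over `T`. This turns it into an embedding of `S` that
    -- carries `b` to `c`, which extends to an automorphism.
    obtain ⟨q, hq⟩ := hC.exists_emb hss hTc hQ (Emb.incl hT) t
    obtain ⟨σ, hσ⟩ := hC.exists_equiv hss hS hSc (q.comp s)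
    refine ⟨σ, fun m => ?_, fun i => ?_⟩
    · have : σ (k m : S) = q (s (k m)) := hσ (k m)
      rw [h2, hq] at this
      exact (congrArg σ (hk m)).symm.trans (this.trans (hk' m))
    · have : σ (b i) = q (s ⟨b i, hbS i⟩) := hσ ⟨b i, hbS i⟩
      rw [h3, hq] at this
      exact this
  · rintro ⟨σ, h1, h2⟩
    exact Quot.sound ⟨C, _, Emb.ofEquiv hC.mem σ, Emb.id hC.mem, h1, h2⟩

/-- The models of cardinality `lam` in a saturated model of cardinality `lam⁺`. -/
def Saturated.system (hss : K.Superstable lam) (hcat : K.Categorical lam)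
    (hC : K.Saturated lam C) : HomogeneousSystem (autGroup L C) C lam where
  IsModel W := ∃ S : L.Substructure C, K.Strong S ∧ #S = lam ∧ (S : Set C) = W
  aleph0_le := aleph0_le_of_LS_le hss.ls_le
  card_le := by
    rintro _ ⟨S, -, h, rfl⟩
    exact h.le
  exists_superset A hA := by
    obtain ⟨S, h1, h2, h3⟩ := exists_strong hss.ls_le hC.mem hC.le_card A hA
    exact ⟨S, ⟨S, h1, h3, rfl⟩, h2⟩
  smul g W := by
    rintro ⟨S, h1, h2, rfl⟩
    obtain ⟨e, rfl⟩ := exists_eq_toAut g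
    exact ⟨_, K.strong_iso e h1, ((Emb.ofEquiv hC.mem e).mk_image S).trans h2, rfl⟩
  iUnion W hι hW h := by
    choose S h1 h2 h3 using h
    obtain rfl : (fun i => (S i : Set C)) = W := funext h3
    have hm : Monotone S := hW
    have i₀ := Classical.arbitrary
    exact ⟨⨆ i, S i, strong_iSup hm h1,
      le_antisymm (mk_iSup_le hm (aleph0_le_of_LS_le hss.ls_le) hι fun i => (h2 i).le)
        ((h2 (i₀ _)).symm.le.trans (mk_le_mk_of_subset (le_iSup S (i₀ _)))), coe_iSup hm⟩
  glue W g hι hW h hg := by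
    choose S h1 h2 h3 using h
    choose e he using fun i => exists_eq_toAut (g i)
    obtain rfl : (fun i => (S i : Set C)) = W := funext h3
    obtain rfl : g = fun i => toAut (e i) := funext he
    have hm : Monotone S := hW
    have i₀ := Classical.arbitrary
    obtain ⟨ψ, hψ⟩ := exists_emb_iSup hm
      (fun i => (Emb.ofEquiv hC.mem (e i)).comp (Emb.incl (h1 i)))
      fun i j h x => hg i j h x x.2
    obtain ⟨σ, hσ⟩ := hC.exists_equiv hss (strong_iSup hm h1)
      (le_antisymm (mk_iSup_le hm (aleph0_le_of_LS_le hss.ls_le) hι fun i => (h2 i).le)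
        ((h2 (i₀ _)).symm.le.trans (mk_le_mk_of_subset (le_iSup S (i₀ _))))) ψ
    refine ⟨toAut σ, fun i x hx => ?_⟩
    have hx' : x ∈ ⨆ i, S i := le_iSup S i hx
    exact (hσ ⟨x, hx'⟩).trans (hψ i x hx hx')
  small_types := by
    rintro _ ⟨S, h1, h2, rfl⟩
    choose b hb using hC.realize h1 h2
    refine ⟨Set.range b, ?_, fun a => ?_⟩
    · have h3 : Cardinal.lift.{u + 1} #(Set.range b) ≤ Cardinal.lift.{u} #(K.GType S Unit) :=
        mk_range_le_lift
      rw [Cardinal.lift_id'.{u, u + 1}] at h3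
      exact Cardinal.lift_le.1 (h3.trans (hss.stable S ⟨(K.mem_of_strong h1).1, h2⟩))
    · obtain ⟨σ, h3, h4⟩ := (hC.tpEmb_eq_iff hss h2 (lift_unit_le (aleph0_le_of_LS_le hss.ls_le))).1
        (hb (tp h1 fun _ => a)).symm
      exact ⟨toAut σ, fun x hx => h3 ⟨x, hx⟩, ⟨_, (h4 ()).symm⟩⟩
  -- Categoricity provides an isomorphism, and homogeneity extends it to an automorphism of `C`.
  conj := by
    rintro _ _ ⟨S, h1, h2, rfl⟩ ⟨T, h3, h4, rfl⟩
    obtain ⟨e⟩ := hcat.2 S T ⟨(K.mem_of_strong h1).1, h2⟩ ⟨(K.mem_of_strong h3).1, h4⟩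
    obtain ⟨σ, hσ⟩ := hC.exists_aut hss h2 (Emb.incl h1)
      ((Emb.incl h3).comp (Emb.ofEquiv (K.mem_of_strong h3).1 e))
    refine ⟨toAut σ, Set.ext fun x => ⟨?_, fun hx => ?_⟩⟩
    · rintro ⟨y, hy, rfl⟩
      have : σ y = e ⟨y, hy⟩ := hσ ⟨y, hy⟩
      change σ y ∈ T
      rw [this]
      exact (e ⟨y, hy⟩).2
    · refine ⟨e.symm ⟨x, hx⟩, (e.symm ⟨x, hx⟩).2, ?_⟩
      exact (hσ (e.symm ⟨x, hx⟩)).trans (congrArg Subtype.val (e.apply_symm_apply ⟨x, hx⟩))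

section

variable (hss : K.Superstable lam) (hcat : K.Categorical lam) (hC : K.Saturated lam C)

theorem isModel_coe {S : L.Substructure C} :
    (hC.system hss hcat).IsModel (S : Set C) ↔ K.Strong S ∧ #S = lam := by
  constructor
  · rintro ⟨T, h1, h2, h3⟩
    obtain rfl := SetLike.coe_injective h3
    exact ⟨h1, h2⟩
  · exact fun h => ⟨S, h.1, h.2, rfl⟩

theorem isModel_image (j : K.Emb M C) {S : L.Substructure M} (hS : K.Strong S) (hSc : #S = lam) :
    (hC.system hss hcat).IsModel (j.image S : Set C) :=
  (isModel_coe hss hcat hC).2 ⟨j.strong_image hS, (j.mk_image S).trans hSc⟩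

theorem isModel_range (j : K.Emb M C) (hM : #M = lam) :
    (hC.system hss hcat).IsModel (j.toEmb.toHom.range : Set C) :=
  (isModel_coe hss hcat hC).2 ⟨j.strong, j.mk_range.trans hM⟩

/-- Models inside the image of an embedding are images of strong substructures. -/
theorem exists_image_eq (j : K.Emb M C) {W : Set C} (hW : (hC.system hss hcat).IsModel W)
    (hWj : W ⊆ (j.toEmb.toHom.range : Set C)) :
    ∃ S : L.Substructure M, K.Strong S ∧ #S = lam ∧ (j.image S : Set C) = W := by
  obtain ⟨T, h1, h2, rfl⟩ := hW
  obtain ⟨k, hk⟩ := exists_lift j (Emb.incl h1) fun x => hWj x.2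
  refine ⟨_, k.strong, k.mk_range.trans h2, Set.ext fun x => ⟨?_, fun hx => ?_⟩⟩
  · rintro ⟨_, ⟨y, rfl⟩, rfl⟩
    have : j (k y) = y := hk y
    exact this ▸ y.2
  · exact ⟨_, ⟨⟨x, hx⟩, rfl⟩, hk ⟨x, hx⟩⟩

/-- Homogeneity passes between abstract extensions and submodels of `C`: `exists_emb` places an
extension of `S` inside `C`, and `exists_equiv` extends an embedding into `T` to an automorphism. -/
theorem universal_iff (j : K.Emb M C) {S T : L.Substructure M} (hS : K.Strong S) (hT : K.Strong T)
    (hSc : #S = lam) :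
    K.Universal lam S T ↔ (hC.system hss hcat).Univ (j.image S : Set C) (j.image T) := by
  constructor
  · rintro ⟨hle, hU⟩
    refine ⟨fun x hx => ?_, ?_⟩
    · obtain ⟨y, hy, rfl⟩ := hx
      exact ⟨y, hle.1 hy, rfl⟩
    rintro _ ⟨W, hW, hWc, rfl⟩ hSW
    obtain ⟨k, hk⟩ := exists_lift (Emb.incl hW) (j.comp (Emb.incl hS))
      fun x => ⟨⟨_, hSW ⟨x, x.2, rfl⟩⟩, rfl⟩
    obtain ⟨f, hf⟩ := hU W k hWc
    obtain ⟨σ, hσ⟩ := hC.exists_equiv hss hW hWc ((j.comp (Emb.incl hT)).comp f)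
    refine ⟨toAut σ, ?_, ?_⟩
    · rintro _ ⟨x, hx, rfl⟩
      have h1 : (k ⟨x, hx⟩ : C) = j x := hk ⟨x, hx⟩
      have h2 : σ (k ⟨x, hx⟩ : C) = j (f (k ⟨x, hx⟩) : M) := hσ (k ⟨x, hx⟩)
      have h3 : (f (k ⟨x, hx⟩) : M) = x := congrArg Subtype.val (hf ⟨x, hx⟩)
      rw [h1, h3] at h2
      exact h2
    · rintro _ ⟨x, hx, rfl⟩
      exact ⟨f ⟨x, hx⟩, (f ⟨x, hx⟩).2, (hσ ⟨x, hx⟩).symm⟩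
  · rintro ⟨hsub, hU⟩
    have hle : S ≤ T := fun x hx => by
      obtain ⟨y, hy, h⟩ := hsub ⟨x, hx, rfl⟩
      exact j.injective h ▸ hy
    refine ⟨K.coherence hle hS hT, fun M' _ h hM' => ?_⟩
    obtain ⟨k, hk⟩ := hC.exists_emb hss hSc hM' (j.comp (Emb.incl hS)) h
    obtain ⟨g, hg, hg'⟩ := hU _ (isModel_range hss hcat hC k hM') (by
      rintro _ ⟨x, hx, rfl⟩
      exact ⟨h ⟨x, hx⟩, hk ⟨x, hx⟩⟩)
    obtain ⟨σ, rfl⟩ := exists_eq_toAut g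
    obtain ⟨f, hf⟩ := exists_lift (j.comp (Emb.incl hT)) ((Emb.ofEquiv hC.mem σ).comp k) fun x => by
      obtain ⟨y, hy, hyx⟩ := hg' ⟨_, ⟨x, rfl⟩, rfl⟩
      exact ⟨⟨y, hy⟩, hyx⟩
    refine ⟨f, fun m => (j.comp (Emb.incl hT)).injective ?_⟩
    rw [hf]
    change σ (k (h m)) = j m
    rw [hk]
    exact hg _ ⟨m, m.2, rfl⟩

/-- An isomorphism between small submodels is the restriction of an automorphism of `C`, and
equality of types is conjugacy, so the two notions of splitting test the same maps. -/
theorem nonSplit_iff (j : K.Emb M C) {S : L.Substructure M} (hS : K.Strong S) (c : C) :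
    K.NonSplit lam S (tpEmb j fun _ => c) ↔
      (hC.system hss hcat).NoSplit (j.image S) (j.toEmb.toHom.range : Set C) c := by
  have hι := lift_unit_le (aleph0_le_of_LS_le hss.ls_le)
  constructor
  · rintro ⟨-, h⟩ _ ⟨W, hW, hWc, rfl⟩ hSW hWj g hg hgW
    obtain ⟨σ, rfl⟩ := exists_eq_toAut g
    obtain ⟨k, hk⟩ := exists_lift j (Emb.incl hW) fun x => hWj x.2
    obtain ⟨l, hl⟩ := exists_lift j ((Emb.ofEquiv hC.mem σ).comp (Emb.incl hW))
      fun x => hgW ⟨x, x.2, rfl⟩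
    have hk' : ∀ x (hx : x ∈ S), k ⟨j x, hSW ⟨x, hx, rfl⟩⟩ = x := fun x hx =>
      j.injective (hk _)
    have hl' : ∀ x (hx : x ∈ S), l ⟨j x, hSW ⟨x, hx, rfl⟩⟩ = x := fun x hx =>
      j.injective ((hl _).trans (hg (j x) ⟨x, hx, rfl⟩))
    have le₁ : S ≤ k.toEmb.toHom.range := fun x hx => ⟨_, hk' x hx⟩
    have le₂ : S ≤ l.toEmb.toHom.range := fun x hx => ⟨_, hl' x hx⟩
    have key := h _ _ k.strong l.strong le₁ le₂
      (k.mk_range.trans hWc) (l.mk_range.trans hWc)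
      (l.toEmb.equivRange.comp k.toEmb.equivRange.symm) (fun x => by
        refine Subtype.ext ?_
        have h1 : Substructure.inclusion le₁ x =
            k.toEmb.equivRange ⟨j x, hSW ⟨x, x.2, rfl⟩⟩ := Subtype.ext (hk' x x.2).symm
        rw [h1]
        change (l.toEmb.equivRange (k.toEmb.equivRange.symm (k.toEmb.equivRange _)) : M) = x
        rw [FirstOrder.Language.Equiv.symm_apply_apply]
        exact hl' x x.2)
    rw [pull_tpEmb, pull_tpEmb, hC.tpEmb_eq_iff hss (k.mk_range.trans hWc) hι] at key
    obtain ⟨τ, h1, h2⟩ := key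
    refine ⟨toAut τ, fun x hx => ?_, h2 ()⟩
    have h3 := h1 (k.toEmb.equivRange ⟨x, hx⟩)
    change τ (j (k ⟨x, hx⟩)) = j (l (k.toEmb.equivRange.symm (k.toEmb.equivRange ⟨x, hx⟩))) at h3
    rw [FirstOrder.Language.Equiv.symm_apply_apply, hk, hl] at h3
    exact h3
  · refine fun h => ⟨hS, fun N₁ N₂ h₁ h₂ le₁ le₂ c₁ c₂ f hf => ?_⟩
    obtain ⟨σ, hσ⟩ := hC.exists_aut hss c₁ (j.comp (Emb.incl h₁))
      ((j.comp (Emb.incl h₂)).comp (Emb.ofEquiv (K.mem_of_strong h₂).1 f))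
    have hσ' : ∀ x (hx : x ∈ N₁), σ (j x) = j (f ⟨x, hx⟩ : M) := fun x hx => hσ ⟨x, hx⟩
    obtain ⟨g, hg, hgc⟩ := h _ (isModel_image hss hcat hC j h₁ c₁)
      (by rintro _ ⟨x, hx, rfl⟩; exact ⟨x, le₁ hx, rfl⟩) (by rintro _ ⟨x, hx, rfl⟩; exact ⟨x, rfl⟩)
      (toAut σ) (by
        rintro _ ⟨x, hx, rfl⟩
        exact (hσ' x (le₁ hx)).trans (congrArg (fun y : N₂ => j y) (hf ⟨x, hx⟩))) (by
        rintro _ ⟨_, ⟨x, hx, rfl⟩, rfl⟩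
        exact ⟨_, (hσ' x hx).symm⟩)
    obtain ⟨τ, rfl⟩ := exists_eq_toAut g
    rw [pull_tpEmb, pull_tpEmb, hC.tpEmb_eq_iff hss c₁ hι]
    exact ⟨τ, fun x => (hg (j x) ⟨x, x.2, rfl⟩).trans (hσ' x x.2), fun _ => hgc⟩

end

end AEC

/-! ### Limit models, local character, nonforking and symmetry in the system -/

namespace HomogeneousSystem

variable {G : Type v} {C : Type u} [Group G] [MulAction G C] {lam : Cardinal.{u}}

/-- The continuous chain, indexed by ordinals, with the same union as the increasing family `S`. -/
def ordChain {ι : Type u} [LinearOrder ι] [WellFoundedLT ι] (S : ι → Set C) (o : Ordinal.{u}) :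
    Set C :=
  -- At a non-limit ordinal the index of that rank is included; at a limit only smaller ranks are,
  -- which forces continuity.
  ⋃ i : {i : ι // Ordinal.typein (α := ι) (· < ·) i < o ∨
    (Ordinal.typein (α := ι) (· < ·) i = o ∧ ¬ Order.IsSuccLimit o)}, S i

variable {H : HomogeneousSystem G C lam}

section ordChain

variable {ι : Type u} [LinearOrder ι] [WellFoundedLT ι] {S : ι → Set C}

theorem mem_ordChain {o : Ordinal.{u}} {x : C} : x ∈ ordChain S o ↔
    ∃ i, (Ordinal.typein (α := ι) (· < ·) i < o ∨ (Ordinal.typein (α := ι) (· < ·) i = o ∧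
      ¬ Order.IsSuccLimit o)) ∧
      x ∈ S i := by
  simp [ordChain]

theorem ordChain_mono : Monotone (ordChain S) := fun o o' h x hx => by
  rw [mem_ordChain] at hx ⊢
  obtain ⟨i, h1 | ⟨h1, h2⟩, hx⟩ := hx
  · exact ⟨i, Or.inl (h1.trans_le h), hx⟩
  · rcases h.eq_or_lt with rfl | h
    · exact ⟨i, Or.inr ⟨h1, h2⟩, hx⟩
    · exact ⟨i, Or.inl (h1.trans_lt h), hx⟩

theorem subset_ordChain {o : Ordinal.{u}} {i : ι} (h : Ordinal.typein (α := ι) (· < ·) i < o) :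
    S i ⊆ ordChain S o := fun _ hx => mem_ordChain.2 ⟨i, Or.inl h, hx⟩

theorem subset_ordChain_of_not {o : Ordinal.{u}} {i : ι} (h : Ordinal.typein (α := ι) (· < ·) i = o)
    (ho : ¬ Order.IsSuccLimit o) : S i ⊆ ordChain S o :=
  fun _ hx => mem_ordChain.2 ⟨i, Or.inr ⟨h, ho⟩, hx⟩

theorem ordChain_subset (hS : Monotone S) (i : ι) :
    ordChain S (Ordinal.typein (α := ι) (· < ·) i) ⊆ S i := fun x hx => by
  obtain ⟨k, h, hx⟩ := mem_ordChain.1 hx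
  refine hS (?_ : k ≤ i) hx
  rcases h with h | ⟨h, -⟩
  · exact ((Ordinal.typein_lt_typein (α := ι) (· < ·)).1 h).le
  · exact (Ordinal.typein_injective (α := ι) (· < ·) h).le

theorem ordChain_type : ordChain S (Ordinal.type (α := ι) (· < ·)) = ⋃ i, S i := by
  ext x
  rw [mem_ordChain, Set.mem_iUnion]
  exact ⟨fun ⟨i, _, h⟩ => ⟨i, h⟩, fun ⟨i, h⟩ => ⟨i, Or.inl (Ordinal.typein_lt_type
    (α := ι) (· < ·) i), h⟩⟩

theorem isModel_ordChain (hι : #ι ≤ lam) [Nonempty ι] (hS : Monotone S)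
    (hM : ∀ i, H.IsModel (S i)) (o : Ordinal.{u}) : H.IsModel (ordChain S o) := by
  have hne : Nonempty {i : ι // Ordinal.typein (α := ι) (· < ·) i < o ∨
      (Ordinal.typein (α := ι) (· < ·) i = o ∧ ¬ Order.IsSuccLimit o)} := by
    have h0 : (0 : Ordinal.{u}) < Ordinal.type (α := ι) (· < ·) := by
      rw [pos_iff_ne_zero]
      exact Ordinal.type_ne_zero_of_nonempty _
    obtain ⟨i, hi⟩ := Ordinal.typein_surj (α := ι) (· < ·) h0
    refine ⟨i, ?_⟩
    rw [hi]
    rcases eq_or_ne o 0 with rfl | h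
    · exact Or.inr ⟨rfl, fun h => h.1 isMin_bot⟩
    · exact Or.inl (pos_iff_ne_zero.2 h)
  exact H.iUnion _ ((mk_subtype_le _).trans hι) (fun i j h => hS h) fun i => hM i

end ordChain

end HomogeneousSystem

namespace AEC

open AbstractClass

variable {L : FirstOrder.Language.{u, u}} {K : AEC L} {lam : Cardinal.{u}}
variable {M N P : Type u} [L.Structure M] [L.Structure N] [L.Structure P]
variable {C : Type u} [L.Structure C]

section

variable (hss : K.Superstable lam) (hcat : K.Categorical lam) (hC : K.Saturated lam C)

theorem image_mono (j : K.Emb M C) {S T : L.Substructure M} :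
    (j.image S : Set C) ⊆ j.image T ↔ S ≤ T := by
  refine ⟨fun h x hx => ?_, fun h => ?_⟩
  · obtain ⟨y, hy, e⟩ := h ⟨x, hx, rfl⟩
    exact j.injective e ▸ hy
  · rintro _ ⟨x, hx, rfl⟩
    exact ⟨x, h hx, rfl⟩

theorem image_subset_range (j : K.Emb M C) (S : L.Substructure M) :
    (j.image S : Set C) ⊆ (j.toEmb.toHom.range : Set C) := by
  rintro _ ⟨x, hx, rfl⟩
  exact ⟨x, rfl⟩

theorem coe_image_image (g : K.Emb N P) (f : K.Emb M N) (S : L.Substructure M) :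
    (g.image (f.image S) : Set P) = (g.comp f).image S := by
  ext x
  constructor
  · rintro ⟨_, ⟨y, hy, rfl⟩, rfl⟩
    exact ⟨y, hy, rfl⟩
  · rintro ⟨y, hy, rfl⟩
    exact ⟨_, ⟨y, hy, rfl⟩, rfl⟩

theorem coe_image_range (g : K.Emb N P) (f : K.Emb M N) :
    (g.image f.toEmb.toHom.range : Set P) = (g.comp f).toEmb.toHom.range := by
  ext x
  constructor
  · rintro ⟨_, ⟨y, rfl⟩, rfl⟩
    exact ⟨y, rfl⟩
  · rintro ⟨y, rfl⟩
    exact ⟨_, ⟨y, rfl⟩, rfl⟩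

theorem coe_image_comap (h : K.Emb N P) {S T : L.Substructure N} (hT : K.Strong T) (hST : S ≤ T) :
    ((h.comp (Emb.incl hT)).image (S.comap T.subtype.toHom) : Set P) = h.image S := by
  ext x
  constructor
  · rintro ⟨y, hy, rfl⟩
    exact ⟨y, hy, rfl⟩
  · rintro ⟨y, hy, rfl⟩
    exact ⟨⟨y, hST hy⟩, hy, rfl⟩

theorem coe_range_comp_incl (h : K.Emb N P) {T : L.Substructure N} (hT : K.Strong T) :
    ((h.comp (Emb.incl hT)).toEmb.toHom.range : Set P) = h.image T := by
  ext x
  constructor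
  · rintro ⟨y, rfl⟩
    exact ⟨y, y.2, rfl⟩
  · rintro ⟨y, hy, rfl⟩
    exact ⟨⟨y, hy⟩, rfl⟩

/-- A model which is the union of an increasing family of models, universal over one another, is
the union of a universal chain. -/
theorem exists_isUniversalChain (j : K.Emb M C) {ι : Type u} [LinearOrder ι] [WellFoundedLT ι]
    [Nonempty ι] [NoMaxOrder ι] {S : ι → Set C} (hι : #ι ≤ lam)
    (hS : ∀ i, (hC.system hss hcat).IsModel (S i))
    (hU : ∀ i i', i < i' → (hC.system hss hcat).Univ (S i) (S i'))
    (hj : (j.toEmb.toHom.range : Set C) = ⋃ i, S i) :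
    ∃ (δ : Ordinal.{u}) (D : Ordinal.{u} → L.Substructure M), K.IsUniversalChain lam δ D ∧
      ∀ o < δ, ∃ i, (j.image (D o) : Set C) ⊆ S i := by
  have hm : Monotone S := HomogeneousSystem.monotone_of_univ_lt hU
  have hmod := HomogeneousSystem.isModel_ordChain hι hm hS
  have hsub : ∀ o, HomogeneousSystem.ordChain S o ⊆ (j.toEmb.toHom.range : Set C) :=
    fun o x hx => by
    obtain ⟨i, -, hx⟩ := HomogeneousSystem.mem_ordChain.1 hx
    rw [hj]
    exact Set.mem_iUnion.2 ⟨i, hx⟩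
  choose D hD hDc hDe using fun o => exists_image_eq hss hcat hC j (hmod o) (hsub o)
  have hDm : Monotone D := fun o o' h => (image_mono j).1 (by
    rw [hDe, hDe]
    exact HomogeneousSystem.ordChain_mono h)
  have hsurj : ∀ o < Ordinal.type (α := ι) (· < ·), ∃ i : ι,
    Ordinal.typein (α := ι) (· < ·) i = o :=
    fun o ho => Ordinal.typein_surj _ ho
  have hlim : Order.IsSuccLimit (Ordinal.type (α := ι) (· < ·)) := by
    rw [Ordinal.isSuccLimit_iff]
    refine ⟨Ordinal.type_ne_zero_of_nonempty _, ?_⟩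
    rw [Order.isSuccPrelimit_iff_succ_lt]
    intro o ho
    obtain ⟨i, rfl⟩ := hsurj o ho
    obtain ⟨i', hi'⟩ := exists_gt i
    exact (Order.succ_le_of_lt ((Ordinal.typein_lt_typein (α := ι) (· < ·)).2 hi')).trans_lt
      (Ordinal.typein_lt_type (α := ι) (· < ·) i')
  refine ⟨Ordinal.type (α := ι) (· < ·), D, ⟨hlim, ?_, ⟨fun o _ => ⟨hD o, hDc o⟩,
    fun o o' h _ => K.coherence (hDm h) (hD o) (hD o'), ?_⟩, ?_, ?_⟩, ?_⟩
  · rw [lt_ord, Ordinal.card_type, Order.lt_succ_iff]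
    exact hι
  · intro o _ ho x hx
    have hx' : j x ∈ HomogeneousSystem.ordChain S o := hDe o ▸ ⟨x, hx, rfl⟩
    obtain ⟨i, h | ⟨-, h⟩, hi⟩ := HomogeneousSystem.mem_ordChain.1 hx'
    · refine ⟨_, ho.succ_lt h, ?_⟩
      have := HomogeneousSystem.subset_ordChain (S := S) (Order.lt_succ
        (Ordinal.typein (α := ι) (· < ·) i)) hi
      rw [← hDe] at this
      obtain ⟨y, hy, e⟩ := this
      exact j.injective e ▸ hy
    · exact absurd ho h
  · refine eq_top_iff.2 ((image_mono j).1 ?_)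
    rw [hDe, HomogeneousSystem.ordChain_type, ← hj]
    exact image_subset_range j _
  · intro o ho
    rw [universal_iff hss hcat hC j (hD o) (hD _) (hDc o), hDe, hDe]
    obtain ⟨i, rfl⟩ := hsurj o ho
    obtain ⟨i', hi'⟩ := hsurj _ (hlim.succ_lt ho)
    have hii' : i < i' := by
      rw [← Ordinal.typein_lt_typein (α := ι) (· < ·), hi']
      exact Order.lt_succ _
    -- The term at rank `o` is contained in `S i`, while the term at the successor contains `S i'`
    -- because a successor is not a limit. Passing to unions at limits therefore preserves
    -- universality.
    exact ((hU i i' hii').mono_left (hS i) (HomogeneousSystem.ordChain_subset hm i)).mono_right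
      (HomogeneousSystem.subset_ordChain_of_not hi' (Order.not_isSuccLimit_succ _))
  · intro o ho
    obtain ⟨i, rfl⟩ := hsurj o ho
    refine ⟨i, ?_⟩
    rw [hDe]
    exact HomogeneousSystem.ordChain_subset hm i

theorem Saturated.nonempty_emb (hss : K.Superstable lam) (hC : K.Saturated lam C) (hM : K.Mem M)
    (hMc : #M = lam) : Nonempty (K.Emb M C) := by
  obtain ⟨S, hS, -, hSc⟩ := exists_strong hss.ls_le hC.mem hC.le_card ∅ (by simp)
  obtain ⟨M₃, _, h3, ⟨f⟩, ⟨g⟩⟩ := hss.jointEmbedding S M ⟨(K.mem_of_strong hS).1, hSc⟩ ⟨hM, hMc⟩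
  obtain ⟨h, -⟩ := hC.exists_emb hss hSc h3 (Emb.incl hS) f
  exact ⟨h.comp g⟩

/-- By categoricity, every model of cardinality `lam` is limit. -/
theorem isLimitModel (hss : K.Superstable lam) (hcat : K.Categorical lam)
    (hC : K.Saturated lam C) (hM : K.Mem M) (hMc : #M = lam) : K.IsLimitModel lam M := by
  obtain ⟨j⟩ := hC.nonempty_emb hss hM hMc
  obtain ⟨S, t, -, h2, h3, h4⟩ := (hC.system hss hcat).exists_eq_omegaLimit
    (isModel_range hss hcat hC j hMc)
  have : NoMaxOrder (ULift.{u} ℕ) := ⟨fun n => ⟨⟨n.down + 1⟩, Nat.lt_succ_self _⟩⟩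
  obtain ⟨δ, D, h, -⟩ := exists_isUniversalChain hss hcat hC j (ι := ULift.{u} ℕ)
    (S := fun n => t n.down) (by simpa using aleph0_le_of_LS_le hss.ls_le) (fun n => h2 _)
    (fun i i' h => HomogeneousSystem.univ_of_lt h3 h) (by
      rw [h4]
      ext x
      simp)
  exact ⟨δ, D, h⟩

theorem mk_of_isLimitModel (h : K.IsLimitModel lam M) : #M = lam := by
  obtain ⟨δ, D, -, -, h1, h2, -⟩ := h
  have := (h1.1 δ le_rfl).2
  rw [h2] at this
  exact (mk_congr (Substructure.topEquiv (L := L) (M := M)).toEquiv).symm.trans this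

/-- The given family need not be continuous. Each term below the top of the associated continuous
chain lies in some `S i`, and nonsplitting passes up to the larger base. -/
theorem localCharacter_system : (hC.system hss hcat).LocalCharacter := by
  intro ι _ _ _ _ S hι hS hU a
  obtain ⟨W, hW, hWc, hWe⟩ := (hC.system hss hcat).iUnion S hι
    (HomogeneousSystem.monotone_of_univ_lt hU) hS
  have hr : ((Emb.incl hW).toEmb.toHom.range : Set C) = W :=
    congrArg SetLike.coe (Substructure.range_subtype W)
  obtain ⟨δ, D, hD, hDS⟩ := exists_isUniversalChain hss hcat hC (Emb.incl hW) hι hS hU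
    (hr.trans hWe)
  obtain ⟨o, ho, h⟩ := hss.localCharacter W δ D hD (tpEmb (Emb.incl hW) fun _ => a)
  obtain ⟨i, hi⟩ := hDS o ho
  rw [nonSplit_iff hss hcat hC _ h.1] at h
  refine ⟨i, h.mono hi ?_⟩
  rw [hr, hWe]

/-- The clauses on limit models hold by `isLimitModel`; the rest is the translation of universality
and nonsplitting. -/
theorem nonFork_iff (j : K.Emb M C) (hM : #M = lam) {S : L.Substructure M} (hS : K.Strong S)
    (hSc : #S = lam) (c : C) : K.NonFork lam S (tpEmb j fun _ => c) ↔
      (hC.system hss hcat).NoFork (j.image S) (j.toEmb.toHom.range : Set C) c := by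
  constructor
  · rintro ⟨-, -, -, S₀, h1, h2, h3⟩
    exact ⟨image_subset_range j S, _, isModel_image hss hcat hC j h3.1 h1,
      (universal_iff hss hcat hC j h3.1 hS h1).1 h2, (nonSplit_iff hss hcat hC j h3.1 c).1 h3⟩
  · rintro ⟨-, _, h1, h2, h3⟩
    obtain ⟨S₀, h4, h5, rfl⟩ := exists_image_eq hss hcat hC j h1
      (h2.1.trans (image_subset_range j S))
    exact ⟨isLimitModel hss hcat hC j.mem_left hM, hS,
      isLimitModel hss hcat hC (K.mem_of_strong hS).1 hSc, S₀, h5,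
      (universal_iff hss hcat hC j h4 hS h5).2 h2, (nonSplit_iff hss hcat hC j h4 c).2 h3⟩

theorem elemNonFork_iff (h : K.Emb N C) {M₀ M : L.Substructure N} (hM₀ : K.Strong M₀)
    (hM : K.Strong M) (hM₀c : #M₀ = lam) (hMc : #M = lam) (a : N) :
    K.ElemNonFork lam M₀ M a ↔
      (hC.system hss hcat).NoFork (h.image M₀) (h.image M) (h a) := by
  have key : ∀ hle : M₀ ≤ M, K.NonFork lam (M₀.comap M.subtype.toHom) (tp hM fun _ : Unit => a) ↔
      (hC.system hss hcat).NoFork (h.image M₀) (h.image M) (h a) := fun hle => by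
    have hLE := K.coherence hle hM₀ hM
    have e : tp hM (fun _ : Unit => a) = tpEmb (h.comp (Emb.incl hM)) fun _ => h a :=
      (tpEmb_comp h (Emb.incl hM) fun _ => a).symm
    have hc : #(M₀.comap M.subtype.toHom : L.Substructure M) = lam := by
      rw [← (h.comp (Emb.incl hM)).mk_image]
      refine Eq.trans ?_ ((h.mk_image M₀).trans hM₀c)
      exact congrArg (fun s : Set C => #s) (coe_image_comap h hM hle)
    rw [e, nonFork_iff hss hcat hC _ hMc hLE.2 hc, coe_image_comap h hM hle, coe_range_comp_incl]
  constructor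
  · rintro ⟨hLE, _, h'⟩
    exact (key hLE.1).1 h'
  · intro h'
    have hle := (image_mono h).1 h'.1
    exact ⟨K.coherence hle hM₀ hM, hM, (key hle).2 h'⟩

/-- Inside `C`, models `N ∋ a, b` and `N'` containing `N` and `M'` are chosen to make an abstract
symmetry witness. The exchanged witness lives in an abstract extension of `N` and is brought back
into `C` over `N`, so that `a` and `b` stay in place. -/
theorem elemSymmetry_system (hsym : K.SymmetryAt lam) : (hC.system hss hcat).ElemSymmetry := by
  rintro _ ⟨M, hM, hMc, rfl⟩ a b ⟨_, ⟨M', hM', hM'c, rfl⟩, hb, hf⟩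
  have hlam := aleph0_le_of_LS_le hss.ls_le
  have hab : #({a, b} : Set C) ≤ lam := (lt_aleph0_of_finite _).le.trans hlam
  obtain ⟨_, ⟨N, hN, hNc, rfl⟩, hMN, habN⟩ :=
    (hC.system hss hcat).exists_superset₂ (A := M) hMc.le hab
  have ha : a ∈ N := habN (by simp)
  have hb' : b ∈ N := habN (by simp)
  obtain ⟨_, ⟨N', hN', hN'c, rfl⟩, hNN', hM'N'⟩ :=
    (hC.system hss hcat).exists_superset₂ (A := N) (B := M') hNc.le hM'c.le
  have hlim : ∀ {S : L.Substructure C}, K.Strong S → #S = lam → K.IsLimitModel lam S :=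
    fun h h' => isLimitModel hss hcat hC (K.mem_of_strong h).1 h'
  have hMN' : M ≤ N := hMN
  have hLE : K.LE M N := K.coherence hMN hM hN
  have hLE' : K.LE N N' := K.coherence hNN' hN hN'
  have hLE'' : K.LE M' N' := K.coherence hM'N' hM' hN'
  have hcom : ∀ {S T : L.Substructure C}, K.LE S T → #S = lam → K.Strong T →
      #(S.comap T.subtype.toHom : L.Substructure T) = lam := fun {S T} h h' hT => by
    rw [← h', ← ((Emb.id hC.mem).comp (Emb.incl hT)).mk_image, ← (Emb.id hC.mem).mk_image S]
    exact congrArg (fun s : Set C => #s) (coe_image_comap (Emb.id hC.mem) hT h.1)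
  have hidS : ∀ S : L.Substructure C, (((Emb.id hC.mem).image S : L.Substructure C) : Set C) = S :=
    fun S => Set.image_id _
  have himg : ((((Emb.incl hN').image ((Emb.inclusion hLE').image (M.comap N.subtype.toHom))) :
      L.Substructure C) : Set C) = M := by
    rw [coe_image_image]
    exact (coe_image_comap (Emb.id hC.mem) hN hLE.1).trans (hidS M)
  have himg' : (((Emb.incl hN').image (M'.comap N'.subtype.toHom) : L.Substructure C) : Set C) =
      M' := (coe_image_comap (Emb.id hC.mem) hN' hLE''.1).trans (hidS M')
  have hw : K.SymmetryWitness lam (M.comap N.subtype.toHom : L.Substructure N) ⟨a, ha⟩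
      ⟨b, hb'⟩ := by
    refine ⟨N', _, Emb.inclusion hLE', M'.comap N'.subtype.toHom, hlim hN' hN'c,
      isLimitModel hss hcat hC (K.mem_of_strong hLE''.2).1 (hcom hLE'' hM'c hN'), hb, ?_⟩
    rw [elemNonFork_iff hss hcat hC (Emb.incl hN') (Emb.strong_image _ hLE.2) hLE''.2
      ((Emb.mk_image _ _).trans (hcom hLE hMc hN)) (hcom hLE'' hM'c hN'), himg, himg']
    exact hf
  obtain ⟨N₁, _, f, M₁, h1, h2, h3, h4⟩ := (hsym N _ (hlim hN hNc) hLE.2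
    (isLimitModel hss hcat hC (K.mem_of_strong hLE.2).1 (hcom hLE hMc hN)) _ _).1 hw
  obtain ⟨h, hh⟩ := hC.exists_emb hss hNc (mk_of_isLimitModel h1) (Emb.incl hN) f
  have hM₁ := h4.2.1
  rw [elemNonFork_iff hss hcat hC h (Emb.strong_image _ hLE.2) hM₁
    ((Emb.mk_image _ _).trans (hcom hLE hMc hN)) (mk_of_isLimitModel h2), coe_image_image,
    show h.comp f = (Emb.id hC.mem).comp (Emb.incl hN) from Emb.ext hh,
    coe_image_comap _ hN hLE.1, hidS, hh] at h4
  exact ⟨_, isModel_image hss hcat hC h hM₁ (mk_of_isLimitModel h2), ⟨_, h3, hh ⟨a, ha⟩⟩, h4⟩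

end

end AEC

/-! ### Transfer of independence, and the theorem -/

namespace AEC

open AbstractClass

variable {L : FirstOrder.Language.{u, u}} {K : AEC L} {lam : Cardinal.{u}}
variable {N : Type u} [L.Structure N] {C : Type u} [L.Structure C]
variable (hss : K.Superstable lam) (hcat : K.Categorical lam) (hC : K.Saturated lam C)

theorem mk_toType_le {α : Ordinal.{u}} : #α.ToType ≤ lam ↔ α < (Order.succ lam).ord := by
  rw [lt_ord, Order.lt_succ_iff, mk_toType]

/-- An independent sequence is independent in the system of models of a saturated model. -/
theorem indep_of_independent (h : K.Emb N C) {M₀ M : L.Substructure N} {α : Ordinal.{u}}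
    {a : Set.Iio α → N} (H : K.Independent lam M₀ M a) :
    (hC.system hss hcat).Indep (h.image M₀ : Set C) (h.image M)
      fun i : α.ToType => h (a (Ordinal.ToType.mk.symm i)) := by
  obtain ⟨-, hN, hM, hM₀, hLE, hMs, N', _, f, D, hN', hD, hD0, hDa⟩ := H
  have hM₀s : K.Strong M₀ := K.strong_trans hLE.1 hLE.2 hMs
  obtain ⟨h', hh⟩ := hC.exists_emb hss hN hN' h f
  have himg : ∀ S : L.Substructure N, (h'.image (f.image S) : Set C) = h.image S := fun S => by
    rw [coe_image_image, show h'.comp f = h from Emb.ext hh]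
  have hle : ∀ i : α.ToType, ((Ordinal.ToType.mk.symm i : Set.Iio α) : Ordinal.{u}) ≤ α :=
    fun i => (Ordinal.ToType.mk.symm i).2.le
  refine ⟨fun i => h'.image (D (Ordinal.ToType.mk.symm i : Set.Iio α)), fun i j hij => ?_,
    fun i => ?_, fun i => ?_, fun i => ?_, fun i => ?_, fun i j hij => ?_⟩
  · exact (image_mono h').2 (hD.2.1 _ _ (Ordinal.ToType.mk.symm.monotone hij) (hle j)).1
  · exact isModel_image hss hcat hC h' (hD.1 _ (hle i)).1 (hD.1 _ (hle i)).2
  · rw [← himg, ← hD0]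
    exact (image_mono h').2 (hD.2.1 _ _ (bot_le : (0 : Ordinal) ≤ _) (hle i)).1
  · have := (hDa (Ordinal.ToType.mk.symm i)).2.2
    rwa [elemNonFork_iff hss hcat hC h' (f.strong_image hM₀s) (hD.1 _ (hle i)).1
      ((f.mk_image _).trans hM₀) (hD.1 _ (hle i)).2, himg, hh] at this
  · rintro ⟨x, hx, e⟩
    rw [← hh] at e
    exact (hDa (Ordinal.ToType.mk.symm i)).2.1 (h'.injective e ▸ hx)
  · refine ⟨_, (hD.2.1 _ _ (Order.succ_le_of_lt ?_) (hle j)).1 (hDa (Ordinal.ToType.mk.symm i)).1,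
      hh _⟩
    exact Ordinal.ToType.mk.symm.strictMono hij

/-- A sequence which is independent in the system of models of a saturated model is independent. -/
theorem independent_of_indep (h : K.Emb N C) (hN : #N = lam) {M₀ M : L.Substructure N}
    (hM₀ : K.Strong M₀) (hM₀c : #M₀ = lam) (hM : K.Strong M) (hMc : #M = lam) (hle : M₀ ≤ M)
    {α : Ordinal.{u}} (hα : α < (Order.succ lam).ord) {a : Set.Iio α → N}
    (H : (hC.system hss hcat).Indep (h.image M₀ : Set C) (h.image M)
      fun i : α.ToType => h (a (Ordinal.ToType.mk.symm i))) : K.Independent lam M₀ M a := by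
  obtain ⟨E, hE⟩ := H
  have hlam := aleph0_le_of_LS_le hss.ls_le
  have hι : #α.ToType ≤ lam := mk_toType_le.2 hα
  obtain ⟨_, ⟨T, hT, hTc, rfl⟩, hTE⟩ := (hC.system hss hcat).exists_superset_iUnion
    (fun i : Option α.ToType => i.elim (h.toEmb.toHom.range : Set C) E)
    (by
      rw [mk_option]
      exact add_le_of_le hlam hι (one_le_aleph0.trans hlam))
    (by
      rintro (_ | i)
      · exact (h.mk_range.trans hN).le
      · exact (hC.system hss hcat).card_le (hE.isModel i))
  have hET : ∀ i, E i ⊆ T := fun i => hTE (some i)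
  have hNT : (h.toEmb.toHom.range : Set C) ⊆ T := hTE none
  obtain ⟨f, hf⟩ := exists_lift (Emb.incl hT) h fun x => ⟨⟨_, hNT ⟨x, rfl⟩⟩, rfl⟩
  have himg : ∀ S : L.Substructure N, ((Emb.incl hT).image (f.image S) : Set C) = h.image S :=
    fun S => by rw [coe_image_image, show (Emb.incl hT).comp f = h from Emb.ext hf]
  have hTr : (T : Set C) = (Emb.incl hT).toEmb.toHom.range :=
    (congrArg SetLike.coe (Substructure.range_subtype T)).symm
  let r : α.ToType → Ordinal.{u} := fun i => (Ordinal.ToType.mk.symm i : Set.Iio α)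
  have hr : ∀ o < α, ∃ i, r i = o := fun o ho =>
    ⟨Ordinal.ToType.mk ⟨o, ho⟩, congrArg Subtype.val (Ordinal.ToType.mk.symm_apply_apply _)⟩
  have hrm : ∀ i j, r i ≤ r j → i ≤ j := fun i j hij => Ordinal.ToType.mk.symm.le_iff_le.1 hij
  have hrlt : ∀ i j, r i < r j → i < j := fun i j hij => Ordinal.ToType.mk.symm.lt_iff_lt.1 hij
  -- The family `E` need not be continuous nor start at `M`. The new chain is `M` at `0`, the union
  -- of earlier terms at a limit, `E` at the other ordinals below `α`, and `T` at `α` when `α` is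
  -- neither `0` nor a limit. Each term at `i < α` lies in the corresponding `E`, so freeness and
  -- nonalgebraicity are inherited.
  have hex : ∀ o ≤ α, ∃ W : L.Substructure T, (K.Strong W ∧ #W = lam) ∧
      (o = 0 → ((Emb.incl hT).image W : Set C) = h.image M) ∧
      (∀ i, r i = o → ((Emb.incl hT).image W : Set C) ⊆ E i) ∧
      (∀ i, r i < o → E i ⊆ (Emb.incl hT).image W) ∧
      (∀ i, r i < o → h (a (Ordinal.ToType.mk.symm i)) ∈ ((Emb.incl hT).image W : Set C)) ∧
      (h.image M : Set C) ⊆ (Emb.incl hT).image W ∧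
      (Order.IsSuccLimit o → ∀ x ∈ ((Emb.incl hT).image W : Set C), ∃ i, r i < o ∧ x ∈ E i) := by
    intro o ho
    suffices ∃ X, (hC.system hss hcat).IsModel X ∧ X ⊆ T ∧ (o = 0 → X = h.image M) ∧
        (∀ i, r i = o → X ⊆ E i) ∧ (∀ i, r i < o → E i ⊆ X) ∧
        (∀ i, r i < o → h (a (Ordinal.ToType.mk.symm i)) ∈ X) ∧ (h.image M : Set C) ⊆ X ∧
        (Order.IsSuccLimit o → ∀ x ∈ X, ∃ i, r i < o ∧ x ∈ E i) by
      obtain ⟨X, h1, h2, h3⟩ := this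
      obtain ⟨W, hW, hWc, rfl⟩ := exists_image_eq hss hcat hC (Emb.incl hT) h1 (h2.trans hTr.le)
      exact ⟨W, ⟨hW, hWc⟩, h3⟩
    rcases eq_or_ne o 0 with rfl | h0
    · exact ⟨_, isModel_image hss hcat hC h hM hMc, (image_subset_range h M).trans hNT,
        fun _ => rfl, fun i _ => hE.subset i, fun i hi => absurd hi not_lt_bot,
        fun i hi => absurd hi not_lt_bot, subset_rfl, fun h => absurd isMin_bot h.1⟩
    by_cases hlim : Order.IsSuccLimit o
    · obtain ⟨i₀, hi₀⟩ := hr 0 ((pos_iff_ne_zero.2 h0).trans_le ho)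
      have hi₀' : r i₀ < o := hi₀ ▸ pos_iff_ne_zero.2 h0
      have : Nonempty {i // r i < o} := ⟨⟨i₀, hi₀'⟩⟩
      refine ⟨_, (hC.system hss hcat).iUnion (fun i : {i // r i < o} => E i)
        ((mk_subtype_le _).trans hι) (fun i j hij => hE.mono hij) (fun i => hE.isModel i),
        Set.iUnion_subset fun i => hET i, fun h => absurd h h0,
        fun i hi => Set.iUnion_subset fun k => hE.mono (hrm _ _ (k.2.le.trans hi.ge)),
        fun i hi => Set.subset_iUnion (fun i : {i // r i < o} => E i) ⟨i, hi⟩, fun i hi => ?_,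
        (hE.subset i₀).trans (Set.subset_iUnion (fun i : {i // r i < o} => E i) ⟨i₀, hi₀'⟩), ?_⟩
      · obtain ⟨j, hj⟩ := hr _ ((hlim.succ_lt hi).trans_le ho)
        exact Set.mem_iUnion.2 ⟨⟨j, hj ▸ hlim.succ_lt hi⟩,
          hE.mem i j (hrlt _ _ (hj ▸ Order.lt_succ _))⟩
      · intro _ x hx
        obtain ⟨i, hi⟩ := Set.mem_iUnion.1 hx
        exact ⟨i, i.2, hi⟩
    rcases ho.lt_or_eq with hlt | rfl
    · obtain ⟨k, hk⟩ := hr o hlt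
      exact ⟨_, hE.isModel k, hET k, fun h => absurd h h0,
        fun i hi => hE.mono (hrm _ _ (hk.trans hi.symm).le),
        fun i hi => hE.mono (hrm _ _ (hi.le.trans hk.ge)),
        fun i hi => hE.mem i k (hrlt _ _ (hk.symm ▸ hi)), hE.subset k, fun h => absurd h hlim⟩
    · exact ⟨_, ⟨T, hT, hTc, rfl⟩, subset_rfl, fun h => absurd h h0,
        fun i hi => absurd hi (Ordinal.ToType.mk.symm i).2.ne, fun i _ => hET i,
        fun i _ => hNT ⟨_, rfl⟩, (image_subset_range h M).trans hNT, fun h => absurd h hlim⟩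
  choose! D hD hD0 hDle hDge hDa hDM hDlim using hex
  have hDmono : ∀ o o', o ≤ o' → o' ≤ α → D o ≤ D o' := fun o o' hoo ho' => by
    rcases hoo.eq_or_lt with rfl | hlt
    · rfl
    · obtain ⟨i, hi⟩ := hr o (hlt.trans_le ho')
      exact (image_mono (Emb.incl hT)).1
        ((hDle o (hoo.trans ho') i hi).trans (hDge o' ho' i (hi ▸ hlt)))
  have hmem : ∀ (x : N) o, o ≤ α → (h x ∈ ((Emb.incl hT).image (D o) : Set C) ↔ f x ∈ D o) :=
    fun x o _ => by
      rw [← hf]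
      exact ⟨fun ⟨y, hy, e⟩ => (Emb.incl hT).injective e ▸ hy, fun hx => ⟨_, hx, rfl⟩⟩
  refine ⟨hα, hN, hMc, hM₀c, K.coherence hle hM₀ hM, hM, T, _, f, D, hTc,
    ⟨hD, fun o o' h h' => K.coherence (hDmono o o' h h') (hD o (h.trans h')).1 (hD o' h').1, ?_⟩,
    ?_, fun i => ?_⟩
  · intro o ho hlim x hx
    obtain ⟨i, hi, hxi⟩ := hDlim o ho hlim x ⟨x, hx, rfl⟩
    obtain ⟨y, hy, e⟩ := hDge _ ((hlim.succ_lt hi).le.trans ho) i (Order.lt_succ _) hxi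
    exact ⟨_, hlim.succ_lt hi, (Emb.incl hT).injective e ▸ hy⟩
  · refine le_antisymm ((image_mono (Emb.incl hT)).1 ?_) ((image_mono (Emb.incl hT)).1 ?_)
    · rw [himg, hD0 0 bot_le rfl]
    · rw [himg, hD0 0 bot_le rfl]
  · obtain ⟨k, hk⟩ : ∃ k, Ordinal.ToType.mk.symm k = i :=
      ⟨Ordinal.ToType.mk i, Ordinal.ToType.mk.symm_apply_apply i⟩
    have hrk : r k = i := congrArg Subtype.val hk
    have hsucc : Order.succ (i : Ordinal.{u}) ≤ α := Order.succ_le_of_lt i.2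
    have hi : (i : Ordinal.{u}) ≤ α := i.2.le
    have h1 := hE.notMem k
    have h2 := hE.noFork k
    rw [hk] at h1 h2
    refine ⟨?_, fun h' => h1 (hDle i hi k hrk ((hmem _ _ hi).2 h')), ?_⟩
    · have h3 := hDa _ hsucc k (hrk ▸ Order.lt_succ _)
      rw [hk] at h3
      exact (hmem _ _ hsucc).1 h3
    · rw [elemNonFork_iff hss hcat hC (Emb.incl hT) (f.strong_image hM₀) (hD i hi).1
        ((f.mk_image _).trans hM₀c) (hD i hi).2, himg, hf]
      exact h2.mono subset_rfl ((image_mono h).2 hle |>.trans (hDM i hi)) (hDle i hi k hrk)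

theorem lift_mk_Iio_le {α : Ordinal.{u}} (hα : α < (Order.succ lam).ord) :
    Cardinal.lift.{u} #(Set.Iio α) ≤ Cardinal.lift.{u + 1} lam := by
  have h : Cardinal.lift.{u} #(Set.Iio α) = Cardinal.lift.{u + 1} #α.ToType :=
    mk_congr_lift Ordinal.ToType.mk.toEquiv
  rw [h]
  exact Cardinal.lift_le.2 (mk_toType_le.2 hα)

theorem orderInvariant_indepSeqFrame (hss : K.Superstable lam) (hsym : K.SymmetryAt lam)
    (hcat : K.Categorical lam) : (K.indepSeqFrame lam).OrderInvariant := by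
  intro N _ M₀ M α β a e H
  obtain ⟨C, _, hC⟩ := exists_saturated hss
  have H' := H
  obtain ⟨hα, hN, hM, hM₀, hLE, hMs, -⟩ := H'
  have hM₀s : K.Strong M₀ := K.strong_trans hLE.1 hLE.2 hMs
  obtain ⟨h⟩ := hC.nonempty_emb hss (K.mem_of_strong hMs).2 hN
  let e' : β.ToType ≃ α.ToType :=
    (Ordinal.ToType.mk.symm.toEquiv.trans e).trans Ordinal.ToType.mk.toEquiv
  have hβ : β < (Order.succ lam).ord :=
    mk_toType_le.1 ((mk_congr e').le.trans (mk_toType_le.2 hα))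
  refine independent_of_indep hss hcat hC h hN hM₀s hM₀ hMs hM hLE.1 hβ ?_
  have := (indep_of_independent hss hcat hC h H).reorder (localCharacter_system hss hcat hC)
    (elemSymmetry_system hss hcat hC hsym) (mk_toType_le.2 hα)
    (isModel_image hss hcat hC h hM₀s hM₀) (isModel_image hss hcat hC h hMs hM)
    ((image_mono h).2 hLE.1) e'
  simpa [e'] using this

/-- Basicness gives an independent realization `a'` in another model. Equality of types yields an
automorphism of `C` moving `a'` to `a₂` and matching the two copies of `M₀`; independence moves
along with it. -/
theorem symmetry_indepSeqFrame (hss : K.Superstable lam) (hsym : K.SymmetryAt lam)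
    (hcat : K.Categorical lam) : (K.indepSeqFrame lam).Symmetry := by
  intro N _ M₀ M₂ α₁ α₂ a₁ a₂ h₀ H ha₂ ⟨N₃, _, g, a', htp, H₃⟩
  obtain ⟨C, _, hC⟩ := exists_saturated hss
  have hH := H
  have hH₃ := H₃
  obtain ⟨hα₁, hN, hM₂, hM₀, hLE, hM₂s, -⟩ := hH
  obtain ⟨hα₂, hN₃, -⟩ := hH₃
  obtain ⟨h⟩ := hC.nonempty_emb hss (K.mem_of_strong hM₂s).2 hN
  obtain ⟨h₃, hh₃⟩ := hC.exists_emb hss hM₀ hN₃ (h.comp (Emb.incl h₀)) g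
  have htp' : tpEmb (h₃.comp g) (fun i => h₃ (a' i)) =
      tpEmb (h.comp (Emb.incl h₀)) (fun i => h (a₂ i)) := by
    rw [tpEmb_comp, tpEmb_comp]
    exact htp.symm
  obtain ⟨σ, hσ, hσa⟩ := (hC.tpEmb_eq_iff hss hM₀ (lift_mk_Iio_le hα₂)).1 htp'
  have hσM : toAut σ • (h₃.image g.toEmb.toHom.range : Set C) = h.image M₀ := by
    rw [coe_image_range]
    ext x
    constructor
    · rintro ⟨_, ⟨m, rfl⟩, rfl⟩
      exact ⟨m, m.2, (hσ m).symm⟩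
    · rintro ⟨m, hm, rfl⟩
      exact ⟨_, ⟨⟨m, hm⟩, rfl⟩, hσ ⟨m, hm⟩⟩
  have h₂ := (indep_of_independent hss hcat hC h₃ H₃).smul (toAut σ)
  rw [hσM] at h₂
  simp only [toAut_smul, hσa] at h₂
  obtain ⟨W, hW, hM₀W, ha₁, hind⟩ := (indep_of_independent hss hcat hC h H).symmetry
    (localCharacter_system hss hcat hC) (elemSymmetry_system hss hcat hC hsym)
    (mk_toType_le.2 hα₁) (mk_toType_le.2 hα₂) (isModel_image hss hcat hC h h₀ hM₀)
    (isModel_image hss hcat hC h hM₂s hM₂) ((image_mono h).2 hLE.1)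
    (fun i => ⟨_, ha₂ _, rfl⟩) h₂
  obtain ⟨_, ⟨T, hT, hTc, rfl⟩, hNT, hWT⟩ := (hC.system hss hcat).exists_superset₂
    (A := (h.toEmb.toHom.range : Set C)) (h.mk_range.trans hN).le
    ((hC.system hss hcat).card_le hW)
  obtain ⟨f, hf⟩ := exists_lift (Emb.incl hT) h fun x => ⟨⟨_, hNT ⟨x, rfl⟩⟩, rfl⟩
  have hfM₀ : ((Emb.incl hT).image (f.image M₀) : Set C) = h.image M₀ := by
    rw [coe_image_image, show (Emb.incl hT).comp f = h from Emb.ext hf]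
  obtain ⟨M₁, hM₁, hM₁c, rfl⟩ := exists_image_eq hss hcat hC (Emb.incl hT) hW
    (hWT.trans (congrArg SetLike.coe (Substructure.range_subtype T)).ge)
  refine ⟨T, _, f, M₁, fun i => ?_, ?_⟩
  · obtain ⟨y, hy, e⟩ := ha₁ (Ordinal.ToType.mk i)
    rw [OrderIso.symm_apply_apply, ← hf] at e
    exact (Emb.incl hT).injective e ▸ hy
  · refine independent_of_indep hss hcat hC (Emb.incl hT) hTc (f.strong_image h₀)
      ((f.mk_image _).trans hM₀) hM₁ hM₁c ((image_mono (Emb.incl hT)).1 (hfM₀ ▸ hM₀W)) hα₂ ?_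
    rw [hfM₀]
    simp only [hf]
    exact hind

end AEC

theorem mainTheorem11 {L : FirstOrder.Language.{u, u}} (K : AEC L) (lam : Cardinal.{u})
    (hss : K.Superstable lam) (hsym : K.SymmetryAt lam) (hcat : K.Categorical lam) :
    (K.indepSeqFrame lam).Symmetry ∧ (K.indepSeqFrame lam).OrderInvariant :=
  ⟨AEC.symmetry_indepSeqFrame hss hsym hcat, AEC.orderInvariant_indepSeqFrame hss hsym hcat⟩
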